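/- Let $\mathbb{F}$ be the field with two elements and let $$\mathcal{A}(1)=\mathbb{F}\langle Sq^1,Sq^2\rangle/\big((Sq^1)^2,\ (Sq^2)^2+Sq^1Sq^2Sq^1\big)$$ be the graded cocommutative Hopf algebra over $\mathbb{F}$ with $|Sq^i|=i$ and coproduct $\Delta Sq^1=Sq^1\otimes 1+1\otimes Sq^1$, $\Delta Sq^2=Sq^2\otimes 1+Sq^1\otimes Sq^1+1\otimes Sq^2$; it is the sub-Hopf algebra of the mod $2$ Steenrod algebra generated by $Sq^1$ and $Sq^2$. Let $\mathbf{St}(\mathcal{A}(1))$ be the stable category of $\mathcal{A}(1)$-modules: its objects are the $\mathbb{Z}$-graded left $\mathcal{A}(1)$-modules, and its morphisms are the $\mathcal{A}(1)$-linear maps of degree zero modulo those that factor through a projective module. It is monoidal under the tensor product over $\mathbb{F}$ with the diagonal action, with unit $\mathbb{1}=\mathbb{F}$ in degree $0$. Its Picard group $\mathrm{Pic}(\mathcal{A}(1))$ is the group of isomorphism classes of $\otimes$-invertible objects of $\mathbf{St}(\mathcal{A}(1))$. For a module $M$ and $b\in\mathbb{Z}$ let $M[b]$ be the shift $(M[b])_{k+b}=M_k$.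 Let $\Omega M=\ker(\mathcal{A}(1)\to\mathbb{1})\otimes M$, where $\mathcal{A}(1)\to\mathbb{1}$ is the augmentation, and let $\Omega^{-1}M=\mathrm{coker}(\mathbb{1}\to\mathcal{A}(1)[-6])\otimes M$, where $\mathbb{1}\to\mathcal{A}(1)[-6]$ is the inclusion of the top class $Sq^2Sq^2Sq^2$; this is the inverse of $\Omega$ on the stable category. For $a\in\mathbb{Z}$ let $\Omega^a$ be the corresponding iterate. Let $J$ be the joker: the module with basis $x_{-2},x_{-1},x_0,x_1,x_2$, $|x_i|=i$, in which $Sq^1x_{-2}=x_{-1}$, $Sq^1x_1=x_2$, $Sq^2x_{-2}=x_0$, $Sq^2x_{-1}=x_1$, $Sq^2x_0=x_2$, and all other values of $Sq^1$ and $Sq^2$ on the basis are zero. Put $J^0=\mathbb{1}$ and $J^1=J$. Then the map $$\mathbb{Z}\oplus\mathbb{Z}\oplus\mathbb{Z}/2\longrightarrow \mathrm{Pic}(\mathcal{A}(1)),\qquad (a,b,c)\longmapsto\big[\Omega^aJ^c[b]\big],$$ is well defined and is an isomorphism of groups. -/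

import Mathlib

open CategoryTheory MonoidalCategory
open scoped TensorProduct

namespace SteenrodA1

/-- The field with two elements. -/
abbrev 𝔽 : Type := ZMod 2

/-- The relations `(Sq¹)² = 0` and `(Sq²)² + Sq¹ Sq² Sq¹ = 0`, where the letters `0` and `1` stand for
`Sq¹` and `Sq²`. -/
inductive Rel : FreeAlgebra 𝔽 (Fin 2) → FreeAlgebra 𝔽 (Fin 2) → Prop
  | sq1_sq1 : Rel (FreeAlgebra.ι 𝔽 0 * FreeAlgebra.ι 𝔽 0) 0
  | sq2_sq2 : Rel (FreeAlgebra.ι 𝔽 1 * FreeAlgebra.ι 𝔽 1 +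
      FreeAlgebra.ι 𝔽 0 * FreeAlgebra.ι 𝔽 1 * FreeAlgebra.ι 𝔽 0) 0

/-- The algebra `𝒜(1) = 𝔽⟨Sq¹, Sq²⟩ / ((Sq¹)², (Sq²)² + Sq¹ Sq² Sq¹)`. -/
def A1 : Type := RingQuot Rel

noncomputable instance : Ring A1 := inferInstanceAs (Ring (RingQuot Rel))
noncomputable instance : Algebra 𝔽 A1 := inferInstanceAs (Algebra 𝔽 (RingQuot Rel))

namespace A1

/-- The quotient map from the free algebra. -/
noncomputable def mk : FreeAlgebra 𝔽 (Fin 2) →ₐ[𝔽] A1 := RingQuot.mkAlgHom 𝔽 Rel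

theorem mk_surjective : Function.Surjective mk := RingQuot.mkAlgHom_surjective 𝔽 Rel

theorem mk_rel {x y : FreeAlgebra 𝔽 (Fin 2)} (h : Rel x y) : mk x = mk y :=
  RingQuot.mkAlgHom_rel 𝔽 h

/-- The generators: `gen 0 = Sq¹` and `gen 1 = Sq²`. -/
noncomputable def gen (i : Fin 2) : A1 := mk (FreeAlgebra.ι 𝔽 i)

/-- The first Steenrod square. -/
noncomputable abbrev sq1 : A1 := gen 0

/-- The second Steenrod square. -/
noncomputable abbrev sq2 : A1 := gen 1

theorem sq1_sq1 : sq1 * sq1 = 0 := by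
  have h := mk_rel Rel.sq1_sq1
  rw [map_mul, map_zero] at h
  exact h

theorem sq2_sq2_add : sq2 * sq2 + sq1 * sq2 * sq1 = 0 := by
  have h := mk_rel Rel.sq2_sq2
  rw [map_add, map_mul, map_mul, map_mul, map_zero] at h
  exact h

theorem sq2_sq2 : sq2 * sq2 = sq1 * sq2 * sq1 := by
  rw [← sub_eq_zero, ZModModule.sub_eq_add]
  exact sq2_sq2_add

/-- The universal property of `𝒜(1)`. -/
noncomputable def lift {B : Type*} [Ring B] [Algebra 𝔽 B] (s t : B) (h1 : s * s = 0)
    (h2 : t * t = s * t * s) : A1 →ₐ[𝔽] B :=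
  RingQuot.liftAlgHom 𝔽 ⟨FreeAlgebra.lift 𝔽 ![s, t], by
    rintro _ _ (_ | _)
    · simpa using h1
    · have : t * t + s * t * s = 0 := by
        rw [h2]
        exact ZModModule.add_self _
      simpa using this⟩

section lift

variable {B : Type*} [Ring B] [Algebra 𝔽 B] {s t : B} (h1 : s * s = 0) (h2 : t * t = s * t * s)

@[simp] theorem lift_sq1 : lift s t h1 h2 (gen 0) = s :=
  (RingQuot.liftAlgHom_mkAlgHom_apply 𝔽 _ _ _).trans (by simp)

@[simp] theorem lift_sq2 : lift s t h1 h2 (gen 1) = t :=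
  (RingQuot.liftAlgHom_mkAlgHom_apply 𝔽 _ _ _).trans (by simp)

end lift

/-- A property of elements of `𝒜(1)` may be checked on monomials in `Sq¹` and `Sq²`. -/
theorem induction {p : A1 → Prop} (one : p 1) (add : ∀ a b, p a → p b → p (a + b))
    (smul : ∀ (r : 𝔽) a, p a → p (r • a)) (gen_mul : ∀ i a, p a → p (gen i * a)) (a : A1) : p a := by
  have key : ∀ (x : FreeAlgebra 𝔽 (Fin 2)) (a : A1), p a → p (mk x * a) := by
    intro x
    induction x with
    | grade0 r =>
      intro a ha
      rw [AlgHom.commutes, ← Algebra.smul_def]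
      exact smul r a ha
    | grade1 i => exact fun a ha => gen_mul i a ha
    | mul x y hx hy =>
      intro a ha
      rw [map_mul, mul_assoc]
      exact hx _ (hy _ ha)
    | add x y hx hy =>
      intro a ha
      rw [map_add, add_mul]
      exact add _ _ (hx _ ha) (hy _ ha)
  obtain ⟨x, rfl⟩ := mk_surjective a
  simpa using key x 1 one

theorem algHom_ext {B : Type*} [Ring B] [Algebra 𝔽 B] {f g : A1 →ₐ[𝔽] B}
    (h1 : f sq1 = g sq1) (h2 : f sq2 = g sq2) : f = g := by
  ext a
  induction a using induction with
  | one => simp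
  | add a b ha hb => rw [map_add, map_add, ha, hb]
  | smul r a ha => rw [map_smul, map_smul, ha]
  | gen_mul i a ha =>
    rw [map_mul, map_mul, ha]
    fin_cases i
    · exact congrArg (· * g a) h1
    · exact congrArg (· * g a) h2

/-- If `(s, t)` and `(s', t')` satisfy the relations of `𝒜(1)` and commute with each other, then so
does `(s + s', t + s s' + t')`. -/
theorem cartan_rel {B : Type*} [Ring B] [Algebra 𝔽 B] {s t s' t' : B} (h1 : s * s = 0)
    (h2 : t * t = s * t * s) (h1' : s' * s' = 0) (h2' : t' * t' = s' * t' * s')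
    (c11 : s' * s = s * s') (c12 : t' * s = s * t') (c21 : s' * t = t * s')
    (c22 : t' * t = t * t') :
    (s + s') * (s + s') = 0 ∧
      (t + s * s' + t') * (t + s * s' + t') = (s + s') * (t + s * s' + t') * (s + s') := by
  have e : ∀ x : B, x + x = 0 := fun x => ZModModule.add_self x
  have a11 : ∀ x, s' * (s * x) = s * (s' * x) := fun x => by rw [← mul_assoc, c11, mul_assoc]
  have a12 : ∀ x, t' * (s * x) = s * (t' * x) := fun x => by rw [← mul_assoc, c12, mul_assoc]
  have b1 : ∀ x, s * (s * x) = 0 := fun x => by rw [← mul_assoc, h1, zero_mul]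
  rw [← sub_eq_zero (b := _ * (s + s'))]
  simp only [ZModModule.sub_eq_add, mul_add, add_mul, mul_assoc, c11, c12, c21, c22, a11, a12,
    h1, h1', h2, h2', b1, mul_zero, add_zero, zero_add]
  constructor
  · exact e _
  · abel_nf
    simp only [two_zsmul, e]

theorem comul_rel : (sq1 ⊗ₜ[𝔽] 1 + 1 ⊗ₜ[𝔽] sq1) * (sq1 ⊗ₜ[𝔽] 1 + 1 ⊗ₜ[𝔽] sq1) = 0 ∧
    (sq2 ⊗ₜ[𝔽] 1 + sq1 ⊗ₜ[𝔽] sq1 + 1 ⊗ₜ[𝔽] sq2) * (sq2 ⊗ₜ[𝔽] 1 + sq1 ⊗ₜ[𝔽] sq1 + 1 ⊗ₜ[𝔽] sq2) =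
      (sq1 ⊗ₜ[𝔽] 1 + 1 ⊗ₜ[𝔽] sq1) * (sq2 ⊗ₜ[𝔽] 1 + sq1 ⊗ₜ[𝔽] sq1 + 1 ⊗ₜ[𝔽] sq2) *
        (sq1 ⊗ₜ[𝔽] 1 + 1 ⊗ₜ[𝔽] sq1) := by
  have h := cartan_rel (B := A1 ⊗[𝔽] A1) (s := sq1 ⊗ₜ 1) (t := sq2 ⊗ₜ 1) (s' := 1 ⊗ₜ sq1)
    (t' := 1 ⊗ₜ sq2) (by simp [sq1_sq1]) (by simp [sq2_sq2]) (by simp [sq1_sq1])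
    (by simp [sq2_sq2]) (by simp) (by simp) (by simp) (by simp)
  rwa [Algebra.TensorProduct.tmul_mul_tmul sq1 1 1 sq1, mul_one, one_mul] at h

/-- The coproduct, determined by the Cartan formulas `Sq¹ ↦ Sq¹ ⊗ 1 + 1 ⊗ Sq¹` and
`Sq² ↦ Sq² ⊗ 1 + Sq¹ ⊗ Sq¹ + 1 ⊗ Sq²`. -/
noncomputable def comulHom : A1 →ₐ[𝔽] A1 ⊗[𝔽] A1 :=
  lift (sq1 ⊗ₜ 1 + 1 ⊗ₜ sq1) (sq2 ⊗ₜ 1 + sq1 ⊗ₜ sq1 + 1 ⊗ₜ sq2) comul_rel.1 comul_rel.2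

@[simp] theorem comulHom_sq1 : comulHom (gen 0) = sq1 ⊗ₜ 1 + 1 ⊗ₜ sq1 :=
  lift_sq1 comul_rel.1 comul_rel.2

@[simp] theorem comulHom_sq2 : comulHom (gen 1) = sq2 ⊗ₜ 1 + sq1 ⊗ₜ sq1 + 1 ⊗ₜ sq2 :=
  lift_sq2 comul_rel.1 comul_rel.2

/-- The counit, which kills `Sq¹` and `Sq²`. -/
noncomputable def counitHom : A1 →ₐ[𝔽] 𝔽 := lift 0 0 (by simp) (by simp)

@[simp] theorem counitHom_gen (i : Fin 2) : counitHom (gen i) = 0 := by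
  fin_cases i
  · exact lift_sq1 _ _
  · exact lift_sq2 _ _

noncomputable instance : Bialgebra 𝔽 A1 :=
  Bialgebra.ofAlgHom comulHom counitHom
    (algHom_ext
      (by simp [TensorProduct.add_tmul, TensorProduct.tmul_add, Algebra.TensorProduct.one_def]
          abel)
      (by simp [TensorProduct.add_tmul, TensorProduct.tmul_add, Algebra.TensorProduct.one_def]
          abel))
    (algHom_ext (by simp) (by simp))
    (algHom_ext (by simp) (by simp))

@[simp] theorem comul_eq (a : A1) : Coalgebra.comul (R := 𝔽) a = comulHom a := rfl

@[simp] theorem counit_eq (a : A1) : Coalgebra.counit (R := 𝔽) a = counitHom a := rfl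

instance : Coalgebra.IsCocomm 𝔽 A1 where
  comm_comp_comul := by
    have h : ((Algebra.TensorProduct.comm 𝔽 A1 A1).toAlgHom.comp comulHom) = comulHom :=
      algHom_ext (by simp; abel) (by simp; abel)
    exact congrArg AlgHom.toLinearMap h

/-- The antipode, as an anti-homomorphism; it fixes `Sq¹` and `Sq²`. -/
noncomputable def antipodeHom : A1 →ₐ[𝔽] A1ᵐᵒᵖ :=
  lift (MulOpposite.op sq1) (MulOpposite.op sq2) (by rw [← MulOpposite.op_mul, sq1_sq1]; rfl)
    (by simp only [← MulOpposite.op_mul, sq2_sq2, mul_assoc])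

/-- The antipode. -/
noncomputable def antipodeMap : A1 →ₗ[𝔽] A1 :=
  (MulOpposite.opLinearEquiv 𝔽).symm.toLinearMap ∘ₗ antipodeHom.toLinearMap

theorem antipodeMap_mul (a b : A1) : antipodeMap (a * b) = antipodeMap b * antipodeMap a := by
  simp [antipodeMap]

@[simp] theorem antipodeMap_one : antipodeMap 1 = 1 := by simp [antipodeMap]

@[simp] theorem antipodeMap_gen (i : Fin 2) : antipodeMap (gen i) = gen i := by
  fin_cases i
  · exact congrArg MulOpposite.unop (lift_sq1 _ _)
  · exact congrArg MulOpposite.unop (lift_sq2 _ _)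

noncomputable instance : HopfAlgebra 𝔽 A1 where
  antipode := antipodeMap
  mul_antipode_rTensor_comul := by
    have key : ∀ (i : Fin 2) (T : A1 ⊗[𝔽] A1),
        LinearMap.mul' 𝔽 A1 (antipodeMap.rTensor A1 (comulHom (gen i) * T)) = 0 := by
      intro i T
      induction T with
      | zero => simp
      | add x y hx hy => rw [mul_add, map_add, map_add, hx, hy, add_zero]
      | tmul x y =>
        have e := ZModModule.add_self (antipodeMap x * (gen i * y))
        fin_cases i
        · simpa [add_mul, antipodeMap_mul, mul_assoc] using e
        · have h : sq1 * (sq1 * y) = 0 := by rw [← mul_assoc, sq1_sq1, zero_mul]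
          simpa [add_mul, antipodeMap_mul, mul_assoc, h] using e
    ext a
    induction a using induction with
    | one => simp [Algebra.TensorProduct.one_def]
    | add a b ha hb => rw [map_add, map_add, ha, hb]
    | smul r a ha => rw [map_smul, map_smul, ha]
    | gen_mul i a ha => simp [key]
  mul_antipode_lTensor_comul := by
    have key : ∀ (x y : A1) (T : A1 ⊗[𝔽] A1),
        LinearMap.mul' 𝔽 A1 (antipodeMap.lTensor A1 (x ⊗ₜ y * T)) =
          x * LinearMap.mul' 𝔽 A1 (antipodeMap.lTensor A1 T) * antipodeMap y := by
      intro x y T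
      induction T with
      | zero => simp
      | add S T hS hT => simp only [mul_add, add_mul, map_add, hS, hT]
      | tmul p q => simp [antipodeMap_mul, mul_assoc]
    ext a
    induction a using induction with
    | one => simp [Algebra.TensorProduct.one_def]
    | add a b ha hb => rw [map_add, map_add, ha, hb]
    | smul r a ha => rw [map_smul, map_smul, ha]
    | gen_mul i a ha =>
      simp only [LinearMap.comp_apply, comul_eq, counit_eq, Algebra.linearMap_apply] at ha
      have e := ZModModule.add_self (gen i * algebraMap 𝔽 A1 (counitHom a))
      have c := Algebra.commutes (A := A1) (counitHom a)
      fin_cases i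
      · simpa [add_mul, key, ha, c] using e
      · have h : sq1 * (sq1 * algebraMap 𝔽 A1 (counitHom a)) = 0 := by
          rw [← mul_assoc, sq1_sq1, zero_mul]
        simpa [add_mul, key, ha, c, mul_assoc, h] using e

/-- The degree of a generator: `Sq¹` has degree `1` and `Sq²` has degree `2`. -/
def deg (i : Fin 2) : ℤ := (i : ℤ) + 1

/-- The homogeneous part of degree `n`, spanned by the monomials of degree `n` in the generators. -/
noncomputable def gr (n : ℤ) : Submodule 𝔽 A1 :=
  Submodule.span 𝔽 {x | ∃ w : List (Fin 2), (w.map deg).sum = n ∧ x = (w.map gen).prod}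

theorem one_mem_gr : (1 : A1) ∈ gr 0 := Submodule.subset_span ⟨[], by simp, by simp⟩

theorem gen_mul_mem_gr (i : Fin 2) {n : ℤ} {a : A1} (ha : a ∈ gr n) :
    gen i * a ∈ gr (deg i + n) := by
  have : gr n ≤ (gr (deg i + n)).comap (LinearMap.mulLeft 𝔽 (gen i)) := by
    rw [gr, Submodule.span_le]
    rintro _ ⟨w, rfl, rfl⟩
    exact Submodule.subset_span ⟨i :: w, by simp, by simp⟩
  exact this ha

theorem gen_mem_gr (i : Fin 2) : gen i ∈ gr (deg i) := by
  simpa using gen_mul_mem_gr i one_mem_gr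

end A1

/-- A `ℤ`-indexed family of subspaces is a grading if and only if it spans and there is a linear map
recording the degrees of homogeneous elements. -/
theorem isInternal_iff {V : Type*} [AddCommGroup V] [Module 𝔽 V] (gr : ℤ → Submodule 𝔽 V) :
    DirectSum.IsInternal gr ↔ (∀ x, x ∈ ⨆ n, gr n) ∧
      ∃ δ : V →ₗ[𝔽] (ℤ →₀ V), ∀ n, ∀ x ∈ gr n, δ x = Finsupp.single n x := by
  constructor
  · intro h
    refine ⟨fun x => h.submodule_iSup_eq_top ▸ Submodule.mem_top,
      (DirectSum.toModule 𝔽 ℤ (ℤ →₀ V) fun n => Finsupp.lsingle n ∘ₗ (gr n).subtype) ∘ₗ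
        (LinearEquiv.ofBijective (DirectSum.coeLinearMap gr) h).symm.toLinearMap, ?_⟩
    intro n x hx
    have : (LinearEquiv.ofBijective (DirectSum.coeLinearMap gr) h).symm x =
        DirectSum.lof 𝔽 ℤ (fun n => gr n) n ⟨x, hx⟩ := by
      rw [LinearEquiv.symm_apply_eq]
      exact (DirectSum.coeLinearMap_lof gr n ⟨x, hx⟩).symm
    simp [this]
  · rintro ⟨h1, δ, h2⟩
    have key : ∀ x : DirectSum ℤ fun n => gr n,
        ∀ n, δ (DirectSum.coeLinearMap gr x) n = x n := by
      intro x n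
      induction x using DirectSum.induction_on with
      | zero => simp
      | of i x =>
        rw [DirectSum.coeLinearMap_of, h2 i x x.2, Finsupp.single_apply]
        split_ifs with h
        · subst h; simp
        · rw [DirectSum.of_eq_of_ne _ _ _ (Ne.symm h)]; rfl
      | add x y hx hy => simp [hx, hy]
    constructor
    · intro x y hxy
      ext n
      rw [← key, ← key]
      exact congrArg (fun z => δ z n) hxy
    · intro x
      have := h1 x
      rwa [Submodule.iSup_eq_range_dfinsupp_lsum] at this

/-- A graded `𝒜(1)`-module: a `ℤ`-graded `𝔽`-vector space with an action of `𝒜(1)` for which an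
element of degree `i` raises degrees by `i`. -/
structure GrMod where
  /-- The underlying vector space. -/
  V : Type
  [addCommGroup : AddCommGroup V]
  [module : Module 𝔽 V]
  /-- The action. -/
  ρ : A1 →ₐ[𝔽] Module.End 𝔽 V
  /-- The homogeneous parts. -/
  gr : ℤ → Submodule 𝔽 V
  isInternal : DirectSum.IsInternal gr
  act_mem : ∀ {i j : ℤ} {a : A1} {x : V}, a ∈ A1.gr i → x ∈ gr j → ρ a x ∈ gr (i + j)

namespace GrMod

attribute [instance] addCommGroup module

/-- It is enough to check the compatibility of action and grading on `Sq¹` and `Sq²`. -/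
theorem act_mem_of_gen {V : Type*} [AddCommGroup V] [Module 𝔽 V] {ρ : A1 →ₐ[𝔽] Module.End 𝔽 V}
    {gr : ℤ → Submodule 𝔽 V} (h1 : ∀ (n : ℤ) (x : V), x ∈ gr n → ρ (A1.gen 0) x ∈ gr (1 + n))
    (h2 : ∀ (n : ℤ) (x : V), x ∈ gr n → ρ (A1.gen 1) x ∈ gr (2 + n)) {i j : ℤ} {a : A1} {x : V}
    (ha : a ∈ A1.gr i) (hx : x ∈ gr j) : ρ a x ∈ gr (i + j) := by
  have : A1.gr i ≤ (gr (i + j)).comap (LinearMap.applyₗ x ∘ₗ ρ.toLinearMap) := by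
    rw [A1.gr, Submodule.span_le]
    rintro _ ⟨w, rfl, rfl⟩
    simp only [Submodule.comap_coe, Set.mem_preimage, SetLike.mem_coe]
    clear ha
    induction w with
    | nil => simpa using hx
    | cons k w ih =>
      fin_cases k
      · simpa [add_assoc, A1.deg] using h1 _ _ ih
      · simpa [add_assoc, A1.deg] using h2 _ _ ih
  exact this ha

theorem act_gen0 (M : GrMod) {n : ℤ} {x : M.V} (hx : x ∈ M.gr n) :
    M.ρ (A1.gen 0) x ∈ M.gr (1 + n) := M.act_mem (A1.gen_mem_gr 0) hx

theorem act_gen1 (M : GrMod) {n : ℤ} {x : M.V} (hx : x ∈ M.gr n) :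
    M.ρ (A1.gen 1) x ∈ M.gr (2 + n) := M.act_mem (A1.gen_mem_gr 1) hx

theorem iSup_gr (M : GrMod) (x : M.V) : x ∈ ⨆ n, M.gr n :=
  ((isInternal_iff M.gr).1 M.isInternal).1 x

/-- The map sending a homogeneous element `x` of degree `n` to `x` placed at `n`. -/
noncomputable def δ (M : GrMod) : M.V →ₗ[𝔽] (ℤ →₀ M.V) :=
  ((isInternal_iff M.gr).1 M.isInternal).2.choose

theorem δ_of_mem (M : GrMod) {n : ℤ} {x : M.V} (hx : x ∈ M.gr n) : M.δ x = Finsupp.single n x :=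
  ((isInternal_iff M.gr).1 M.isInternal).2.choose_spec n x hx

/-- Induction on homogeneous elements. -/
theorem hom_induction (M : GrMod) {p : M.V → Prop} (hom : ∀ n, ∀ x ∈ M.gr n, p x)
    (add : ∀ x y, p x → p y → p (x + y)) (x : M.V) : p x :=
  Submodule.iSup_induction M.gr (motive := p) (M.iSup_gr x) hom (hom 0 0 (zero_mem _)) add

theorem δ_apply_mem (M : GrMod) (x : M.V) (n : ℤ) : M.δ x n ∈ M.gr n := by
  induction x using M.hom_induction with
  | hom m x hx =>
    rw [M.δ_of_mem hx, Finsupp.single_apply]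
    split_ifs with h
    · exact h ▸ hx
    · exact zero_mem _
  | add x y hx hy => simpa using add_mem hx hy

/-- A morphism of graded `𝒜(1)`-modules: an `𝒜(1)`-linear map of degree zero. -/
@[ext]
structure Hom (M N : GrMod) where
  /-- The underlying linear map. -/
  toLin : M.V →ₗ[𝔽] N.V
  map_act : ∀ (a : A1) (x : M.V), toLin (M.ρ a x) = N.ρ a (toLin x)
  map_mem : ∀ (n : ℤ) (x : M.V), x ∈ M.gr n → toLin x ∈ N.gr n

instance : Category GrMod where
  Hom := Hom
  id M := ⟨LinearMap.id, fun _ _ => rfl, fun _ _ h => h⟩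
  comp f g := ⟨g.toLin ∘ₗ f.toLin, fun a x => by simp [f.map_act, g.map_act],
    fun n x h => g.map_mem n _ (f.map_mem n x h)⟩

@[ext] theorem hom_ext {M N : GrMod} {f g : M ⟶ N} (h : f.toLin = g.toLin) : f = g := Hom.ext h

@[simp] theorem id_toLin (M : GrMod) : Hom.toLin (𝟙 M) = LinearMap.id := rfl

@[simp] theorem comp_toLin {M N P : GrMod} (f : M ⟶ N) (g : N ⟶ P) :
    (f ≫ g).toLin = g.toLin ∘ₗ f.toLin := rfl

/-- Linearity over `𝒜(1)` may be checked on `Sq¹` and `Sq²`. -/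
theorem map_act_of_gen {V W : Type*} [AddCommGroup V] [Module 𝔽 V] [AddCommGroup W] [Module 𝔽 W]
    {ρ : A1 →ₐ[𝔽] Module.End 𝔽 V} {σ : A1 →ₐ[𝔽] Module.End 𝔽 W} (f : V →ₗ[𝔽] W)
    (h : ∀ i x, f (ρ (A1.gen i) x) = σ (A1.gen i) (f x)) (a : A1) (x : V) :
    f (ρ a x) = σ a (f x) := by
  induction a using A1.induction generalizing x with
  | one => simp
  | add a b ha hb => simp [ha, hb]
  | smul r a ha => simp [ha]
  | gen_mul i a ha => simp [h, ha]

instance (M N : GrMod) : Zero (M ⟶ N) := ⟨⟨0, by simp, fun _ _ _ => by simp⟩⟩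

instance (M N : GrMod) : Add (M ⟶ N) :=
  ⟨fun f g => ⟨f.toLin + g.toLin, fun a x => by simp [f.map_act, g.map_act],
    fun n x h => add_mem (f.map_mem n x h) (g.map_mem n x h)⟩⟩

instance (M N : GrMod) : Neg (M ⟶ N) :=
  ⟨fun f => ⟨-f.toLin, fun a x => by simp [f.map_act], fun n x h => neg_mem (f.map_mem n x h)⟩⟩

instance (M N : GrMod) : Sub (M ⟶ N) :=
  ⟨fun f g => ⟨f.toLin - g.toLin, fun a x => by simp [f.map_act, g.map_act],
    fun n x h => sub_mem (f.map_mem n x h) (g.map_mem n x h)⟩⟩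

@[simp] theorem zero_toLin (M N : GrMod) : Hom.toLin (0 : M ⟶ N) = 0 := rfl
@[simp] theorem add_toLin {M N : GrMod} (f g : M ⟶ N) : (f + g).toLin = f.toLin + g.toLin := rfl
@[simp] theorem neg_toLin {M N : GrMod} (f : M ⟶ N) : (-f).toLin = -f.toLin := rfl
@[simp] theorem sub_toLin {M N : GrMod} (f g : M ⟶ N) : (f - g).toLin = f.toLin - g.toLin := rfl

instance : Preadditive GrMod where
  homGroup M N :=
    { add_assoc := fun f g h => hom_ext (add_assoc _ _ _)
      zero_add := fun f => hom_ext (zero_add _)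
      add_zero := fun f => hom_ext (add_zero _)
      add_comm := fun f g => hom_ext (add_comm _ _)
      neg_add_cancel := fun f => hom_ext (neg_add_cancel _)
      sub_eq_add_neg := fun f g => hom_ext (sub_eq_add_neg _ _)
      nsmul := nsmulRec
      zsmul := zsmulRec }
  add_comp _ _ _ f g h := hom_ext (by simp [LinearMap.comp_add])
  comp_add _ _ _ f g h := hom_ext (by simp [LinearMap.add_comp])

/-! ### The tensor product -/

section tensorAct

variable {V W : Type*} [AddCommGroup V] [Module 𝔽 V] [AddCommGroup W] [Module 𝔽 W]
  (ρ : A1 →ₐ[𝔽] Module.End 𝔽 V) (σ : A1 →ₐ[𝔽] Module.End 𝔽 W)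

/-- The diagonal action on a tensor product: `a` acts by `∑ a' ⊗ a''`. -/
noncomputable def tensorAct : A1 →ₐ[𝔽] Module.End 𝔽 (V ⊗[𝔽] W) :=
  ((Module.endTensorEndAlgHom (R := 𝔽) (S := 𝔽) (A := 𝔽)).comp
    (Algebra.TensorProduct.map ρ σ)).comp (Bialgebra.comulAlgHom 𝔽 A1)

@[simp] theorem tensorAct_sq1 (x : V) (y : W) :
    tensorAct ρ σ (A1.gen 0) (x ⊗ₜ y) = ρ A1.sq1 x ⊗ₜ y + x ⊗ₜ σ A1.sq1 y := by
  simp [tensorAct, Module.endTensorEndAlgHom_apply]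

@[simp] theorem tensorAct_sq2 (x : V) (y : W) :
    tensorAct ρ σ (A1.gen 1) (x ⊗ₜ y) =
      ρ A1.sq2 x ⊗ₜ y + ρ A1.sq1 x ⊗ₜ σ A1.sq1 y + x ⊗ₜ σ A1.sq2 y := by
  simp [tensorAct, Module.endTensorEndAlgHom_apply]

end tensorAct

/-- The tensor product grading: degree `n` is spanned by the `x ⊗ y` with `|x| + |y| = n`. -/
def tensorGr {V W : Type*} [AddCommGroup V] [Module 𝔽 V] [AddCommGroup W] [Module 𝔽 W]
    (gr : ℤ → Submodule 𝔽 V) (gr' : ℤ → Submodule 𝔽 W) (n : ℤ) : Submodule 𝔽 (V ⊗[𝔽] W) :=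
  Submodule.span 𝔽 {t | ∃ (i j : ℤ) (x : V) (y : W),
    i + j = n ∧ x ∈ gr i ∧ y ∈ gr' j ∧ t = x ⊗ₜ y}

theorem tmul_mem {V W : Type*} [AddCommGroup V] [Module 𝔽 V] [AddCommGroup W] [Module 𝔽 W]
    {gr : ℤ → Submodule 𝔽 V} {gr' : ℤ → Submodule 𝔽 W} {i j n : ℤ} {x : V} {y : W}
    (hx : x ∈ gr i) (hy : y ∈ gr' j) (h : i + j = n) : x ⊗ₜ y ∈ tensorGr gr gr' n :=
  Submodule.subset_span ⟨i, j, x, y, h, hx, hy, rfl⟩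

theorem map_mem_of_tmul {V W U : Type*} [AddCommGroup V] [Module 𝔽 V] [AddCommGroup W] [Module 𝔽 W]
    [AddCommGroup U] [Module 𝔽 U] {gr : ℤ → Submodule 𝔽 V} {gr' : ℤ → Submodule 𝔽 W} {n : ℤ}
    {S : Submodule 𝔽 U} (f : V ⊗[𝔽] W →ₗ[𝔽] U)
    (h : ∀ i j x y, i + j = n → x ∈ gr i → y ∈ gr' j → f (x ⊗ₜ y) ∈ S) :
    ∀ t ∈ tensorGr gr gr' n, f t ∈ S := by
  have : tensorGr gr gr' n ≤ S.comap f := by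
    rw [tensorGr, Submodule.span_le]
    rintro _ ⟨i, j, x, y, hn, hx, hy, rfl⟩
    exact h i j x y hn hx hy
  exact this

theorem tensor_isInternal (M N : GrMod) : DirectSum.IsInternal (tensorGr M.gr N.gr) := by
  rw [isInternal_iff]
  refine ⟨fun t => ?_, Finsupp.lmapDomain (M.V ⊗[𝔽] N.V) 𝔽 (fun p : ℤ × ℤ => p.1 + p.2) ∘ₗ
    (finsuppTensorFinsupp 𝔽 𝔽 M.V N.V ℤ ℤ).toLinearMap ∘ₗ TensorProduct.map M.δ N.δ, ?_⟩
  · induction t with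
    | zero => exact zero_mem _
    | add s t hs ht => exact add_mem hs ht
    | tmul x y =>
      induction x using M.hom_induction with
      | add x x' hx hx' => rw [TensorProduct.add_tmul]; exact add_mem hx hx'
      | hom i x hx =>
        induction y using N.hom_induction with
        | add y y' hy hy' => rw [TensorProduct.tmul_add]; exact add_mem hy hy'
        | hom j y hy => exact Submodule.mem_iSup_of_mem (i + j) (tmul_mem hx hy rfl)
  · intro n t ht
    rw [← sub_eq_zero]
    refine (Submodule.mem_bot 𝔽).1 (map_mem_of_tmul
      (S := ⊥) (_ - Finsupp.lsingle n) (fun i j x y hn hx hy => ?_) t ht)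
    simp [M.δ_of_mem hx, N.δ_of_mem hy, hn, Finsupp.mapDomain_single]

/-- The tensor product over `𝔽` with the diagonal action. -/
noncomputable def tensor (M N : GrMod) : GrMod where
  V := M.V ⊗[𝔽] N.V
  ρ := tensorAct M.ρ N.ρ
  gr := tensorGr M.gr N.gr
  isInternal := tensor_isInternal M N
  act_mem := act_mem_of_gen
    (fun n => map_mem_of_tmul (n := n) (S := tensorGr M.gr N.gr (1 + n))
      (tensorAct M.ρ N.ρ (A1.gen 0)) fun i j x y hn hx hy => by
      rw [tensorAct_sq1]
      exact add_mem (tmul_mem (M.act_gen0 hx) hy (by lia))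
        (tmul_mem hx (N.act_gen0 hy) (by lia)))
    (fun n => map_mem_of_tmul (n := n) (S := tensorGr M.gr N.gr (2 + n))
      (tensorAct M.ρ N.ρ (A1.gen 1)) fun i j x y hn hx hy => by
      rw [tensorAct_sq2]
      exact add_mem (add_mem (tmul_mem (M.act_gen1 hx) hy (by lia))
        (tmul_mem (M.act_gen0 hx) (N.act_gen0 hy) (by lia)))
        (tmul_mem hx (N.act_gen1 hy) (by lia)))

/-- The action of `𝒜(1)` on `𝔽` through the counit. -/
noncomputable def unitAct : A1 →ₐ[𝔽] Module.End 𝔽 𝔽 :=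
  (Algebra.lsmul 𝔽 𝔽 𝔽).comp (Bialgebra.counitAlgHom 𝔽 A1)

@[simp] theorem unitAct_gen (i : Fin 2) : unitAct (A1.gen i) = 0 := by
  simp [unitAct]

/-- The grading of `𝔽` concentrated in degree zero. -/
def unitGr (n : ℤ) : Submodule 𝔽 𝔽 := if n = 0 then ⊤ else ⊥

/-- The unit: `𝔽` in degree zero, with `𝒜(1)` acting through the counit. -/
noncomputable def unit : GrMod where
  V := 𝔽
  ρ := unitAct
  gr := unitGr
  isInternal := by
    rw [isInternal_iff]
    refine ⟨fun x => Submodule.mem_iSup_of_mem 0 (by simp [unitGr]), Finsupp.lsingle 0, fun n x hx => ?_⟩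
    rw [unitGr] at hx
    split_ifs at hx with h
    · simp [h]
    · rw [Submodule.mem_bot] at hx
      simp [hx]
  act_mem := act_mem_of_gen (by intros; rw [unitAct_gen]; exact zero_mem _)
    (by intros; rw [unitAct_gen]; exact zero_mem _)

end GrMod

namespace GrMod

theorem δ_map {M N : GrMod} (f : M ⟶ N) (x : M.V) (n : ℤ) :
    N.δ (f.toLin x) n = f.toLin (M.δ x n) := by
  induction x using M.hom_induction with
  | hom m x hx =>
    rw [M.δ_of_mem hx, N.δ_of_mem (f.map_mem m x hx), Finsupp.single_apply, Finsupp.single_apply]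
    split_ifs <;> simp
  | add x y hx hy => simp [hx, hy]

/-- A bijective morphism of graded modules is an isomorphism. -/
@[simps] noncomputable def isoOfEquiv {M N : GrMod} (f : M ⟶ N) (e : M.V ≃ₗ[𝔽] N.V)
    (h : f.toLin = e.toLinearMap) : M ≅ N where
  hom := f
  inv :=
    { toLin := e.symm.toLinearMap
      map_act := fun a x => by
        obtain ⟨y, rfl⟩ := e.surjective x
        have := f.map_act a y
        rw [h] at this
        simpa [LinearEquiv.symm_apply_eq] using this.symm
      map_mem := fun n x hx => by
        obtain ⟨y, rfl⟩ := e.surjective x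
        have h1 := δ_map f y n
        have h2 : f.toLin y = e y := by rw [h]; rfl
        rw [h2, N.δ_of_mem hx, Finsupp.single_eq_same, h] at h1
        have h3 : y = M.δ y n := e.injective h1
        have h4 := M.δ_apply_mem y n
        rw [← h3] at h4
        simpa using h4 }
  hom_inv_id := hom_ext (by ext x; simp [h])
  inv_hom_id := hom_ext (by ext x; simp [h])

/-- The tensor product of two morphisms. -/
noncomputable def tensorMap {M M' N N' : GrMod} (f : M ⟶ M') (g : N ⟶ N') :
    tensor M N ⟶ tensor M' N' where
  toLin := TensorProduct.map f.toLin g.toLin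
  map_act := map_act_of_gen (ρ := tensorAct M.ρ N.ρ) (σ := tensorAct M'.ρ N'.ρ)
    (TensorProduct.map f.toLin g.toLin) fun i t => by
      induction t with
      | zero => simp
      | add s t hs ht => simp only [map_add, hs, ht]
      | tmul x y => fin_cases i <;> simp [f.map_act, g.map_act]
  map_mem n := map_mem_of_tmul (gr := M.gr) (gr' := N.gr) (S := tensorGr M'.gr N'.gr n) _
    fun i j x y hn hx hy => tmul_mem (f.map_mem i x hx) (g.map_mem j y hy) hn

/-- The associativity isomorphism. -/
noncomputable def assoc (M N P : GrMod) : tensor (tensor M N) P ≅ tensor M (tensor N P) :=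
  isoOfEquiv
    { toLin := (TensorProduct.assoc 𝔽 M.V N.V P.V).toLinearMap
      map_act := map_act_of_gen (ρ := tensorAct (tensorAct M.ρ N.ρ) P.ρ) (σ := tensorAct M.ρ (tensorAct N.ρ P.ρ))
        (TensorProduct.assoc 𝔽 M.V N.V P.V).toLinearMap fun i t => by
          have h : (TensorProduct.assoc 𝔽 M.V N.V P.V).toLinearMap ∘ₗ
              tensorAct (tensorAct M.ρ N.ρ) P.ρ (A1.gen i) = tensorAct M.ρ (tensorAct N.ρ P.ρ) (A1.gen i) ∘ₗ
              (TensorProduct.assoc 𝔽 M.V N.V P.V).toLinearMap := by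
            apply TensorProduct.ext_threefold
            intro x y z
            fin_cases i
            · simp [TensorProduct.add_tmul, TensorProduct.tmul_add]
              abel
            · simp [TensorProduct.add_tmul, TensorProduct.tmul_add]
              abel
          exact LinearMap.congr_fun h t
      map_mem := fun n => map_mem_of_tmul (gr := tensorGr M.gr N.gr) (gr' := P.gr)
        (S := tensorGr M.gr (tensorGr N.gr P.gr) n) _ fun i j x y hn hx hy => by
          refine map_mem_of_tmul (gr := M.gr) (gr' := N.gr)
            (S := tensorGr M.gr (tensorGr N.gr P.gr) n)
            ((TensorProduct.assoc 𝔽 M.V N.V P.V).toLinearMap ∘ₗ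
              (TensorProduct.mk 𝔽 (M.V ⊗[𝔽] N.V) P.V).flip y) ?_ x hx
          intro k l a b hi ha hb
          exact tmul_mem ha (tmul_mem hb hy rfl) (by lia) }
    (TensorProduct.assoc 𝔽 M.V N.V P.V) rfl

/-- The left unit isomorphism. -/
noncomputable def leftUnit (M : GrMod) : tensor unit M ≅ M :=
  isoOfEquiv
    { toLin := (TensorProduct.lid 𝔽 M.V).toLinearMap
      map_act := map_act_of_gen (ρ := tensorAct unitAct M.ρ) (σ := M.ρ)
        (TensorProduct.lid 𝔽 M.V).toLinearMap fun i t => by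
          have h : (TensorProduct.lid 𝔽 M.V).toLinearMap ∘ₗ tensorAct unitAct M.ρ (A1.gen i) =
              M.ρ (A1.gen i) ∘ₗ (TensorProduct.lid 𝔽 M.V).toLinearMap := by
            apply TensorProduct.ext'
            intro x y
            fin_cases i <;> simp
          exact LinearMap.congr_fun h t
      map_mem := fun n => map_mem_of_tmul (gr := unitGr) (gr' := M.gr) (S := M.gr n) _
        fun i j x y hn hx hy => by
          rw [unitGr] at hx
          split_ifs at hx with h
          · have : j = n := by lia
            exact Submodule.smul_mem _ _ (this ▸ hy)
          · rw [Submodule.mem_bot] at hx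
            simp [hx] }
    (TensorProduct.lid 𝔽 M.V) rfl

/-- The symmetry isomorphism. -/
noncomputable def swap (M N : GrMod) : tensor M N ≅ tensor N M :=
  isoOfEquiv
    { toLin := (TensorProduct.comm 𝔽 M.V N.V).toLinearMap
      map_act := map_act_of_gen (ρ := tensorAct M.ρ N.ρ) (σ := tensorAct N.ρ M.ρ)
        (TensorProduct.comm 𝔽 M.V N.V).toLinearMap fun i t => by
          have h : (TensorProduct.comm 𝔽 M.V N.V).toLinearMap ∘ₗ tensorAct M.ρ N.ρ (A1.gen i) =
              tensorAct N.ρ M.ρ (A1.gen i) ∘ₗ (TensorProduct.comm 𝔽 M.V N.V).toLinearMap := by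
            apply TensorProduct.ext'
            intro x y
            fin_cases i
            · simp
              abel
            · simp
              abel
          exact LinearMap.congr_fun h t
      map_mem := fun n => map_mem_of_tmul (gr := M.gr) (gr' := N.gr)
        (S := tensorGr N.gr M.gr n) _
        fun i j x y hn hx hy => tmul_mem hy hx (by lia) }
    (TensorProduct.comm 𝔽 M.V N.V) rfl

/-- The right unit isomorphism. -/
noncomputable def rightUnit (M : GrMod) : tensor M unit ≅ M :=
  isoOfEquiv ((swap M unit).hom ≫ (leftUnit M).hom) (TensorProduct.rid 𝔽 M.V)
    (TensorProduct.ext' fun _ _ => rfl)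

/-- The underlying vector space of a graded `𝒜(1)`-module. -/
def forget : GrMod ⥤ ModuleCat 𝔽 where
  obj M := ModuleCat.of 𝔽 M.V
  map f := ModuleCat.ofHom f.toLin

instance : forget.Faithful where
  map_injective h := hom_ext (congrArg ModuleCat.Hom.hom h)

noncomputable instance : MonoidalCategoryStruct GrMod where
  tensorObj := tensor
  tensorUnit := unit
  tensorHom := tensorMap
  whiskerLeft M _ _ f := tensorMap (𝟙 M) f
  whiskerRight f N := tensorMap f (𝟙 N)
  associator := assoc
  leftUnitor := leftUnit
  rightUnitor := rightUnit

/-- Graded `𝒜(1)`-modules form a monoidal category under `⊗` over `𝔽`. -/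
noncomputable instance : MonoidalCategory GrMod :=
  Monoidal.induced forget
    { μIso := fun _ _ => Iso.refl _
      εIso := Iso.refl _
      whiskerLeft_eq := fun X Y Z f => by
        apply ModuleCat.hom_ext
        apply TensorProduct.ext'
        intro x y
        rfl
      whiskerRight_eq := fun f Y => by
        apply ModuleCat.hom_ext
        apply TensorProduct.ext'
        intro x y
        rfl
      tensorHom_eq := fun f g => by
        apply ModuleCat.hom_ext
        apply TensorProduct.ext'
        intro x y
        rfl
      associator_eq := fun X Y Z => by
        apply ModuleCat.hom_ext
        apply TensorProduct.ext_threefold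
        intro x y z
        rfl
      leftUnitor_eq := fun X => by
        apply ModuleCat.hom_ext
        apply TensorProduct.ext'
        intro x y
        rfl
      rightUnitor_eq := fun X => by
        apply ModuleCat.hom_ext
        apply TensorProduct.ext'
        intro x y
        rfl }

end GrMod

namespace GrMod

/-- The shift `M[b]`, with `(M[b])_{k+b} = M_k`. -/
def shift (M : GrMod) (b : ℤ) : GrMod where
  V := M.V
  ρ := M.ρ
  gr n := M.gr (n - b)
  isInternal := by
    rw [isInternal_iff]
    refine ⟨fun x => ?_, Finsupp.lmapDomain M.V 𝔽 (fun n : ℤ => n + b) ∘ₗ M.δ, fun n x hx => ?_⟩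
    · induction x using M.hom_induction with
      | hom n x hx => exact Submodule.mem_iSup_of_mem (n + b) (by simpa using hx)
      | add x y hx hy => exact add_mem hx hy
    · simp [M.δ_of_mem hx, Finsupp.mapDomain_single]
  act_mem := fun {i j a x} ha hx => by
    have := M.act_mem ha hx
    rwa [← add_sub_assoc] at this

/-- The kernel of a morphism of graded modules. -/
noncomputable def ker {M N : GrMod} (f : M ⟶ N) : GrMod where
  V := LinearMap.ker f.toLin
  ρ := AlgHom.ofLinearMap
    { toFun := fun a => (M.ρ a).restrict (p := LinearMap.ker f.toLin) (q := LinearMap.ker f.toLin)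
        fun x hx => by
          rw [LinearMap.mem_ker] at hx ⊢
          rw [f.map_act, hx, map_zero]
      map_add' := fun a b => by ext x; simp
      map_smul' := fun r a => by ext x; simp }
    (by ext x; simp) (fun a b => by ext x; simp)
  gr n := (M.gr n).comap (LinearMap.ker f.toLin).subtype
  isInternal := by
    obtain ⟨π, hπ⟩ := (LinearMap.ker f.toLin).subtype.exists_leftInverse_of_injective
      (LinearMap.ker f.toLin).ker_subtype
    have hπ' : ∀ x : LinearMap.ker f.toLin, π x = x := LinearMap.congr_fun hπ
    rw [isInternal_iff]
    refine ⟨fun x => ?_, Finsupp.mapRange.linearMap π ∘ₗ M.δ ∘ₗ (LinearMap.ker f.toLin).subtype,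
      fun n x hx => ?_⟩
    · have h : ∀ y : M.V, π ((M.δ y).sum fun _ z => z) = π y := by
        intro y
        induction y using M.hom_induction with
        | hom m y hy => simp [M.δ_of_mem hy]
        | add y z hy hz =>
          rw [map_add, Finsupp.sum_add_index' (by simp) (by simp), map_add, map_add, hy, hz]
      have hk : ∀ n, M.δ x n ∈ LinearMap.ker f.toLin := fun n => by
        rw [LinearMap.mem_ker, ← δ_map, LinearMap.mem_ker.1 x.2]
        simp
      rw [← hπ' x, ← h x, Finsupp.sum, map_sum]
      refine sum_mem fun n _ => Submodule.mem_iSup_of_mem n ?_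
      have := hπ' ⟨M.δ x n, hk n⟩
      rw [this]
      exact M.δ_apply_mem x n
    · have : M.δ x = Finsupp.single n (x : M.V) := M.δ_of_mem hx
      simp [this, hπ']
  act_mem := fun ha hx => M.act_mem ha hx

/-- The cokernel of a morphism of graded modules. -/
noncomputable def coker {M N : GrMod} (f : M ⟶ N) : GrMod where
  V := N.V ⧸ LinearMap.range f.toLin
  ρ := AlgHom.ofLinearMap
    { toFun := fun a => (LinearMap.range f.toLin).mapQ (LinearMap.range f.toLin) (N.ρ a) (by
        rintro _ ⟨x, rfl⟩
        exact ⟨M.ρ a x, f.map_act a x⟩)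
      map_add' := fun a b => by ext x; simp
      map_smul' := fun r a => by ext x; simp }
    (by ext x; simp) (fun a b => by ext x; simp)
  gr n := (N.gr n).map (LinearMap.range f.toLin).mkQ
  isInternal := by
    rw [isInternal_iff]
    refine ⟨fun x => ?_, (LinearMap.range f.toLin).liftQ
      (Finsupp.mapRange.linearMap (LinearMap.range f.toLin).mkQ ∘ₗ N.δ) ?_, ?_⟩
    · obtain ⟨x, rfl⟩ := (LinearMap.range f.toLin).mkQ_surjective x
      rw [← Submodule.map_iSup]
      exact Submodule.mem_map_of_mem (N.iSup_gr x)
    · rintro _ ⟨x, rfl⟩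
      rw [LinearMap.mem_ker]
      ext n
      simp [δ_map]
    · rintro n _ ⟨x, hx, rfl⟩
      simp [N.δ_of_mem hx]
  act_mem := by
    rintro i j a _ ha ⟨x, hx, rfl⟩
    exact ⟨N.ρ a x, N.act_mem ha hx, rfl⟩

/-- Left multiplication by a generator, together with the shift of degrees. -/
noncomputable def degOp (i : Fin 2) : Module.End 𝔽 (ℤ →₀ A1) :=
  Finsupp.lmapDomain A1 𝔽 (fun n : ℤ => A1.deg i + n) ∘ₗ
    Finsupp.mapRange.linearMap (LinearMap.mulLeft 𝔽 (A1.gen i))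

@[simp] theorem degOp_single (i : Fin 2) (n : ℤ) (a : A1) :
    degOp i (Finsupp.single n a) = Finsupp.single (A1.deg i + n) (A1.gen i * a) := by
  rw [degOp, LinearMap.comp_apply, Finsupp.mapRange.linearMap_apply, Finsupp.mapRange_single,
    Finsupp.lmapDomain_apply, Finsupp.mapDomain_single, LinearMap.mulLeft_apply]

/-- The action of `𝒜(1)` on `ℤ →₀ 𝒜(1)` which keeps track of degrees. -/
noncomputable def degAct : A1 →ₐ[𝔽] Module.End 𝔽 (ℤ →₀ A1) :=
  A1.lift (degOp 0) (degOp 1)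
    (by
      apply Finsupp.lhom_ext
      intro n a
      rw [Module.End.mul_apply, degOp_single, degOp_single, ← mul_assoc, A1.sq1_sq1]
      simp)
    (by
      apply Finsupp.lhom_ext
      intro n a
      simp only [Module.End.mul_apply, degOp_single]
      rw [← mul_assoc, A1.sq2_sq2, mul_assoc, mul_assoc]
      simp [A1.deg, ← add_assoc])

theorem degAct_gen (i : Fin 2) : degAct (A1.gen i) = degOp i := by
  fin_cases i
  · exact A1.lift_sq1 _ _
  · exact A1.lift_sq2 _ _

/-- `𝒜(1)` as a graded module over itself, by left multiplication. -/
noncomputable def regular : GrMod where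
  V := A1
  ρ := Algebra.lmul 𝔽 A1
  gr := A1.gr
  isInternal := by
    rw [isInternal_iff]
    refine ⟨fun x => ?_, LinearMap.applyₗ (Finsupp.single 0 1) ∘ₗ degAct.toLinearMap, fun n => ?_⟩
    · induction x using A1.induction with
      | one => exact Submodule.mem_iSup_of_mem 0 A1.one_mem_gr
      | add a b ha hb => exact add_mem ha hb
      | smul r a ha => exact Submodule.smul_mem _ _ ha
      | gen_mul i a ha =>
        refine Submodule.iSup_induction A1.gr (motive := fun a => A1.gen i * a ∈ ⨆ n, A1.gr n) ha
          (fun n x hx => Submodule.mem_iSup_of_mem _ (A1.gen_mul_mem_gr i hx)) (by simp) ?_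
        intro x y hx hy
        rw [mul_add]
        exact add_mem hx hy
    · have : A1.gr n ≤ LinearMap.ker
          (LinearMap.applyₗ (Finsupp.single 0 1) ∘ₗ degAct.toLinearMap - Finsupp.lsingle n) := by
        rw [A1.gr, Submodule.span_le]
        rintro _ ⟨w, rfl, rfl⟩
        rw [SetLike.mem_coe, LinearMap.mem_ker, LinearMap.sub_apply, sub_eq_zero]
        induction w with
        | nil => simp
        | cons i w ih =>
          have : degAct (w.map A1.gen).prod (Finsupp.single 0 1) =
            Finsupp.single (w.map A1.deg).sum (w.map A1.gen).prod := ih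
          simp [degAct_gen, this]
      intro x hx
      exact sub_eq_zero.1 (this hx)
  act_mem := act_mem_of_gen (gr := A1.gr) (fun n x hx => A1.gen_mul_mem_gr 0 hx)
    (fun n x hx => A1.gen_mul_mem_gr 1 hx)

/-- The augmentation `𝒜(1) ⟶ 𝟙`. -/
noncomputable def augmentation : regular ⟶ unit where
  toLin := A1.counitHom.toLinearMap
  map_act := map_act_of_gen (ρ := Algebra.lmul 𝔽 A1) (σ := unitAct) A1.counitHom.toLinearMap
    (by simp)
  map_mem n := by
    have : A1.gr n ≤ (unitGr n).comap A1.counitHom.toLinearMap := by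
      rw [A1.gr, Submodule.span_le]
      rintro _ ⟨w, rfl, rfl⟩
      cases w with
      | nil => simp [unitGr]
      | cons i w => simp
    exact this

/-- The desuspension `Ω M = ker(𝒜(1) ⟶ 𝟙) ⊗ M`. -/
noncomputable def omega (M : GrMod) : GrMod := tensor (ker augmentation) M

theorem gen_mul_top (i : Fin 2) : A1.gen i * (A1.sq2 * A1.sq2 * A1.sq2) = 0 := by
  have a : ∀ x, A1.sq1 * (A1.sq1 * x) = 0 := fun x => by rw [← mul_assoc, A1.sq1_sq1, zero_mul]
  have b : ∀ x, A1.sq2 * (A1.sq2 * x) = A1.sq1 * (A1.sq2 * (A1.sq1 * x)) := fun x => by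
    rw [← mul_assoc, A1.sq2_sq2, mul_assoc, mul_assoc]
  fin_cases i
  · change A1.sq1 * (A1.sq2 * A1.sq2 * A1.sq2) = 0
    rw [A1.sq2_sq2, mul_assoc, mul_assoc, a]
  · change A1.sq2 * (A1.sq2 * A1.sq2 * A1.sq2) = 0
    rw [mul_assoc, b, A1.sq2_sq2, mul_assoc, a, mul_zero, mul_zero]

theorem smul_top_mem (n : ℤ) (x : 𝔽) (hx : x ∈ unitGr n) :
    x • (A1.sq2 * A1.sq2 * A1.sq2) ∈ A1.gr (n - -6) := by
  rw [unitGr] at hx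
  split_ifs at hx with h
  · subst h
    refine Submodule.smul_mem _ _ (Submodule.subset_span ⟨[1, 1, 1], ?_, ?_⟩)
    · simp [A1.deg]
    · simp [mul_assoc]
  · rw [Submodule.mem_bot] at hx
    simp [hx]

/-- The inclusion of the top class, `𝟙 ⟶ 𝒜(1)[-6]`, an embedding of the unit into a free module. The
top class `Sq² Sq² Sq²` of `𝒜(1)` has degree `6`. -/
noncomputable def topClass : unit ⟶ shift regular (-6) where
  toLin := LinearMap.toSpanSingleton 𝔽 A1 (A1.sq2 * A1.sq2 * A1.sq2)
  map_act := map_act_of_gen (ρ := unitAct) (σ := Algebra.lmul 𝔽 A1)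
    (LinearMap.toSpanSingleton 𝔽 A1 (A1.sq2 * A1.sq2 * A1.sq2)) fun i x => by
      have := gen_mul_top i
      simp [this]
  map_mem := smul_top_mem

/-- The suspension `Ω⁻¹ M = coker(𝟙 ⟶ 𝒜(1)[-6]) ⊗ M`, inverse to `Ω` in the stable category. -/
noncomputable def omegaInv (M : GrMod) : GrMod := tensor (coker topClass) M

/-- The iterates `Ω^a M`, for `a : ℤ`. -/
noncomputable def omegaPow : ℤ → GrMod → GrMod
  | Int.ofNat n, M => omega^[n] M
  | Int.negSucc n, M => omegaInv^[n + 1] M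

/-- The action of `Sq¹` on the joker. -/
def jokerSq1 : Module.End 𝔽 (Fin 5 → 𝔽) where
  toFun x := ![0, x 0, 0, 0, x 3]
  map_add' x y := by ext i; fin_cases i <;> simp
  map_smul' r x := by ext i; fin_cases i <;> simp

/-- The action of `Sq²` on the joker. -/
def jokerSq2 : Module.End 𝔽 (Fin 5 → 𝔽) where
  toFun x := ![0, 0, x 0, x 1, x 2]
  map_add' x y := by ext i; fin_cases i <;> simp
  map_smul' r x := by ext i; fin_cases i <;> simp

/-- The grading of the joker. -/
def jokerGr (n : ℤ) : Submodule 𝔽 (Fin 5 → 𝔽) where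
  carrier := {x | ∀ i : Fin 5, (i : ℤ) - 2 ≠ n → x i = 0}
  zero_mem' i _ := rfl
  add_mem' hx hy i h := by simp [hx i h, hy i h]
  smul_mem' r x hx i h := by simp [hx i h]

/-- The joker: the graded module with basis `e₀, …, e₄`, where `eᵢ` has degree `i - 2`, and
`Sq¹ e₀ = e₁`, `Sq¹ e₃ = e₄`, `Sq² e₀ = e₂`, `Sq² e₁ = e₃`, `Sq² e₂ = e₄`; all other values of `Sq¹`
and `Sq²` on the basis are zero. -/
noncomputable def joker : GrMod where
  V := Fin 5 → 𝔽
  ρ := A1.lift jokerSq1 jokerSq2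
    (by ext i j; fin_cases i <;> fin_cases j <;> simp [jokerSq1])
    (by
      refine LinearMap.ext fun x => ?_
      ext j
      fin_cases j <;> simp [jokerSq1, jokerSq2])
  gr := jokerGr
  isInternal := by
    rw [isInternal_iff]
    refine ⟨fun x => ?_, ∑ i : Fin 5, Finsupp.lsingle ((i : ℤ) - 2) ∘ₗ
      LinearMap.single 𝔽 (fun _ => 𝔽) i ∘ₗ LinearMap.proj i, fun n x hx => ?_⟩
    · rw [← Finset.univ_sum_single x]
      refine sum_mem fun i _ => Submodule.mem_iSup_of_mem ((i : ℤ) - 2) fun j hj => ?_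
      rw [Pi.single_eq_of_ne]
      rintro rfl
      exact hj rfl
    · rw [LinearMap.sum_apply]
      conv_rhs => rw [← Finset.univ_sum_single x, ← Finsupp.lsingle_apply (R := 𝔽), map_sum]
      refine Finset.sum_congr rfl fun i _ => ?_
      by_cases h : (i : ℤ) - 2 = n
      · simp [h]
      · simp [hx i h]
  act_mem := act_mem_of_gen
    (fun n x hx => by
      rw [A1.lift_sq1]
      intro i hi
      fin_cases i <;> first | rfl | exact hx _ (by simp at hi ⊢; lia))
    (fun n x hx => by
      rw [A1.lift_sq2]
      intro i hi
      fin_cases i <;> first | rfl | exact hx _ (by simp at hi ⊢; lia))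

/-- The tensor powers `M^{⊗ n}`. -/
noncomputable def tensorPow (M : GrMod) : ℕ → GrMod
  | 0 => unit
  | n + 1 => tensor M (tensorPow M n)

end GrMod

namespace GrMod

/-! ### Tensoring with a projective module gives a projective module -/

theorem surjective_of_epi {M N : GrMod} (f : M ⟶ N) [Epi f] : Function.Surjective f.toLin := by
  let π : N ⟶ coker f :=
    { toLin := (LinearMap.range f.toLin).mkQ
      map_act := fun a x => rfl
      map_mem := fun n x hx => ⟨x, hx, rfl⟩ }
  have h : π = 0 := by
    rw [← cancel_epi f]
    refine hom_ext (LinearMap.ext fun x => ?_)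
    exact (Submodule.Quotient.mk_eq_zero _).2 ⟨x, rfl⟩
  intro x
  have hx : π.toLin x = 0 := by rw [h]; rfl
  exact (Submodule.Quotient.mk_eq_zero _).1 hx

theorem epi_of_surjective {M N : GrMod} (f : M ⟶ N) (h : Function.Surjective f.toLin) : Epi f where
  left_cancellation g k e := by
    refine hom_ext (LinearMap.ext fun y => ?_)
    obtain ⟨x, rfl⟩ := h y
    exact LinearMap.congr_fun (congrArg Hom.toLin e) x

theorem δ_act (M : GrMod) (i : Fin 2) (x : M.V) (n : ℤ) :
    M.δ (M.ρ (A1.gen i) x) (A1.deg i + n) = M.ρ (A1.gen i) (M.δ x n) := by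
  induction x using M.hom_induction with
  | hom m x hx =>
    rw [M.δ_of_mem hx, M.δ_of_mem (M.act_mem (A1.gen_mem_gr i) hx), Finsupp.single_apply,
      Finsupp.single_apply]
    by_cases h : m = n
    · simp [h]
    · simp [h]
  | add x y hx hy => simp [hx, hy]

/-- The degree zero component of a linear map. -/
noncomputable def homPart {M N : GrMod} (h : M.V →ₗ[𝔽] N.V) : M.V →ₗ[𝔽] N.V :=
  Finsupp.lsum 𝔽 (fun n => Finsupp.lapply n ∘ₗ N.δ ∘ₗ h) ∘ₗ M.δ

theorem homPart_of_mem {M N : GrMod} (h : M.V →ₗ[𝔽] N.V) {n : ℤ} {x : M.V} (hx : x ∈ M.gr n) :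
    homPart h x = N.δ (h x) n := by
  simp [homPart, M.δ_of_mem hx]

/-- The degree zero component of an `𝒜(1)`-linear map. -/
noncomputable def homPartHom {M N : GrMod} (h : M.V →ₗ[𝔽] N.V)
    (hh : ∀ i x, h (M.ρ (A1.gen i) x) = N.ρ (A1.gen i) (h x)) : M ⟶ N where
  toLin := homPart h
  map_act := map_act_of_gen _ fun i x => by
    induction x using M.hom_induction with
    | hom n x hx =>
      rw [homPart_of_mem h hx, homPart_of_mem h (M.act_mem (A1.gen_mem_gr i) hx), hh, δ_act]
    | add x y hx hy => simp only [map_add, hx, hy]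
  map_mem n x hx := by
    rw [homPart_of_mem h hx]
    exact N.δ_apply_mem _ _

section extend

variable {V U W : Type*} [AddCommGroup V] [Module 𝔽 V] [AddCommGroup U] [Module 𝔽 U]
  [AddCommGroup W] [Module 𝔽 W] (ρ : A1 →ₐ[𝔽] Module.End 𝔽 V) (σ : A1 →ₐ[𝔽] Module.End 𝔽 U)

theorem conj_rel :
    (LinearMap.compRight 𝔽 (σ A1.sq1) + LinearMap.lcomp 𝔽 U (ρ A1.sq1) :
        Module.End 𝔽 (V →ₗ[𝔽] U)) *
      (LinearMap.compRight 𝔽 (σ A1.sq1) + LinearMap.lcomp 𝔽 U (ρ A1.sq1)) = 0 ∧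
    (LinearMap.compRight 𝔽 (σ A1.sq2) + LinearMap.compRight 𝔽 (σ A1.sq1) *
        LinearMap.lcomp 𝔽 U (ρ A1.sq1) + LinearMap.lcomp 𝔽 U (ρ A1.sq2) :
        Module.End 𝔽 (V →ₗ[𝔽] U)) *
      (LinearMap.compRight 𝔽 (σ A1.sq2) + LinearMap.compRight 𝔽 (σ A1.sq1) *
        LinearMap.lcomp 𝔽 U (ρ A1.sq1) + LinearMap.lcomp 𝔽 U (ρ A1.sq2)) =
      (LinearMap.compRight 𝔽 (σ A1.sq1) + LinearMap.lcomp 𝔽 U (ρ A1.sq1)) *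
      (LinearMap.compRight 𝔽 (σ A1.sq2) + LinearMap.compRight 𝔽 (σ A1.sq1) *
        LinearMap.lcomp 𝔽 U (ρ A1.sq1) + LinearMap.lcomp 𝔽 U (ρ A1.sq2)) *
      (LinearMap.compRight 𝔽 (σ A1.sq1) + LinearMap.lcomp 𝔽 U (ρ A1.sq1)) := by
  have r1 : ρ A1.sq1 * ρ A1.sq1 = 0 := by rw [← map_mul, A1.sq1_sq1, map_zero]
  have s1 : σ A1.sq1 * σ A1.sq1 = 0 := by rw [← map_mul, A1.sq1_sq1, map_zero]
  have r2 : ρ A1.sq2 * ρ A1.sq2 = ρ A1.sq1 * ρ A1.sq2 * ρ A1.sq1 := by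
    rw [← map_mul, A1.sq2_sq2, map_mul, map_mul]
  have s2 : σ A1.sq2 * σ A1.sq2 = σ A1.sq1 * σ A1.sq2 * σ A1.sq1 := by
    rw [← map_mul, A1.sq2_sq2, map_mul, map_mul]
  exact A1.cartan_rel (B := Module.End 𝔽 (V →ₗ[𝔽] U))
    (s := LinearMap.compRight 𝔽 (σ A1.sq1)) (t := LinearMap.compRight 𝔽 (σ A1.sq2))
    (s' := LinearMap.lcomp 𝔽 U (ρ A1.sq1)) (t' := LinearMap.lcomp 𝔽 U (ρ A1.sq2))
    (by ext f x; exact LinearMap.congr_fun s1 (f x))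
    (by ext f x; exact LinearMap.congr_fun s2 (f x))
    (by ext f x; exact (congrArg f (LinearMap.congr_fun r1 x)).trans (map_zero f))
    (by ext f x; exact congrArg f (LinearMap.congr_fun r2 x))
    rfl rfl rfl rfl

/-- The action of `𝒜(1)` on linear maps by conjugation. -/
noncomputable def conjAct : A1 →ₐ[𝔽] Module.End 𝔽 (V →ₗ[𝔽] U) :=
  A1.lift _ _ (conj_rel ρ σ).1 (conj_rel ρ σ).2

theorem conjAct_sq1 (f : V →ₗ[𝔽] U) (x : V) :
    conjAct ρ σ (A1.gen 0) f x = σ A1.sq1 (f x) + f (ρ A1.sq1 x) :=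
  LinearMap.congr_fun
    (LinearMap.congr_fun (A1.lift_sq1 (conj_rel ρ σ).1 (conj_rel ρ σ).2) f) x

theorem conjAct_sq2 (f : V →ₗ[𝔽] U) (x : V) :
    conjAct ρ σ (A1.gen 1) f x =
      σ A1.sq2 (f x) + σ A1.sq1 (f (ρ A1.sq1 x)) + f (ρ A1.sq2 x) :=
  LinearMap.congr_fun
    (LinearMap.congr_fun (A1.lift_sq2 (conj_rel ρ σ).1 (conj_rel ρ σ).2) f) x

variable (W) in
/-- The action of `𝒜(1)` on a vector space through the counit. -/
noncomputable def trivAct : A1 →ₐ[𝔽] Module.End 𝔽 W :=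
  (Algebra.lsmul 𝔽 𝔽 W).comp (Bialgebra.counitAlgHom 𝔽 A1)

@[simp] theorem trivAct_gen (i : Fin 2) : trivAct W (A1.gen i) = 0 := by
  simp [trivAct]

variable (W) in
/-- The action of `𝒜(1)` on the free module `𝒜(1) ⊗ W`. -/
noncomputable def freeAct : A1 →ₐ[𝔽] Module.End 𝔽 (A1 ⊗[𝔽] W) :=
  tensorAct (Algebra.lmul 𝔽 A1) (trivAct W)

@[simp] theorem freeAct_gen (i : Fin 2) (a : A1) (w : W) :
    freeAct W (A1.gen i) (a ⊗ₜ w) = (A1.gen i * a) ⊗ₜ w := by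
  fin_cases i <;> simp [freeAct]

/-- The `𝒜(1)`-linear extension of a linear map defined on `1 ⊗ W ⊗ V`. -/
noncomputable def extend (φ : W →ₗ[𝔽] V →ₗ[𝔽] U) : (A1 ⊗[𝔽] W) ⊗[𝔽] V →ₗ[𝔽] U :=
  TensorProduct.lift (TensorProduct.lift
    (LinearMap.lcomp 𝔽 (V →ₗ[𝔽] U) φ ∘ₗ (conjAct ρ σ).toLinearMap))

theorem extend_tmul (φ : W →ₗ[𝔽] V →ₗ[𝔽] U) (a : A1) (w : W) (m : V) :
    extend ρ σ φ ((a ⊗ₜ w) ⊗ₜ m) = conjAct ρ σ a (φ w) m := rfl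

theorem extend_act (φ : W →ₗ[𝔽] V →ₗ[𝔽] U) (i : Fin 2) (t : (A1 ⊗[𝔽] W) ⊗[𝔽] V) :
    extend ρ σ φ (tensorAct (freeAct W) ρ (A1.gen i) t) = σ (A1.gen i) (extend ρ σ φ t) := by
  have h : extend ρ σ φ ∘ₗ tensorAct (freeAct W) ρ (A1.gen i) =
      σ (A1.gen i) ∘ₗ extend ρ σ φ := by
    apply TensorProduct.ext_threefold
    intro a w m
    have e1 := ZModModule.add_self (conjAct ρ σ a (φ w) (ρ A1.sq1 m))
    have e2 := ZModModule.add_self (conjAct ρ σ a (φ w) (ρ A1.sq2 m))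
    have e3 := ZModModule.add_self (σ A1.sq1 (conjAct ρ σ a (φ w) (ρ A1.sq1 m)))
    have e4 : ρ A1.sq1 (ρ A1.sq1 m) = 0 := by
      rw [← Module.End.mul_apply, ← map_mul, A1.sq1_sq1, map_zero]
      rfl
    rw [LinearMap.comp_apply, LinearMap.comp_apply]
    fin_cases i
    · change extend ρ σ φ (tensorAct (freeAct W) ρ (A1.gen 0) _) = σ (A1.gen 0) _
      rw [tensorAct_sq1, freeAct_gen, map_add, extend_tmul, extend_tmul, extend_tmul, map_mul,
        Module.End.mul_apply, conjAct_sq1, add_assoc, e1, add_zero]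
    · change extend ρ σ φ (tensorAct (freeAct W) ρ (A1.gen 1) _) = σ (A1.gen 1) _
      rw [tensorAct_sq2, freeAct_gen, freeAct_gen, map_add, map_add, extend_tmul, extend_tmul,
        extend_tmul, extend_tmul, map_mul, map_mul, Module.End.mul_apply, Module.End.mul_apply,
        conjAct_sq1, conjAct_sq2, e4, map_zero, add_zero,
        add_right_comm _ (conjAct ρ σ a (φ w) (ρ A1.sq2 m)), add_assoc _ _ (σ A1.sq1 _),
        e3, add_zero, add_assoc, e2, add_zero]
  exact LinearMap.congr_fun h t

variable {σ ρ} in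
/-- An `𝒜(1)`-linear map on `(𝒜(1) ⊗ W) ⊗ V` is determined by its values on `1 ⊗ W ⊗ V`. -/
theorem free_tensor_ext {f g : (A1 ⊗[𝔽] W) ⊗[𝔽] V →ₗ[𝔽] U}
    (hf : ∀ i t, f (tensorAct (freeAct W) ρ (A1.gen i) t) = σ (A1.gen i) (f t))
    (hg : ∀ i t, g (tensorAct (freeAct W) ρ (A1.gen i) t) = σ (A1.gen i) (g t))
    (h : ∀ w m, f ((1 ⊗ₜ w) ⊗ₜ m) = g ((1 ⊗ₜ w) ⊗ₜ m)) : f = g := by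
  apply TensorProduct.ext_threefold
  intro a w m
  have h0 : ∀ a, (∀ m, f ((a ⊗ₜ w) ⊗ₜ m) = g ((a ⊗ₜ w) ⊗ₜ m)) →
      ∀ m, f (((A1.sq1 * a) ⊗ₜ w) ⊗ₜ m) = g (((A1.sq1 * a) ⊗ₜ w) ⊗ₜ m) := by
    intro a ha m
    have h1 := hf 0 ((a ⊗ₜ w) ⊗ₜ m)
    have h2 := hg 0 ((a ⊗ₜ w) ⊗ₜ m)
    rw [tensorAct_sq1, freeAct_gen, map_add] at h1 h2
    rw [ha, ha m, ← h2] at h1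
    exact add_right_cancel h1
  induction a using A1.induction generalizing m with
  | one => exact h w m
  | add a b ha hb => simp only [TensorProduct.add_tmul, map_add, ha, hb]
  | smul r a ha => simp only [← TensorProduct.smul_tmul', map_smul, ha]
  | gen_mul i a ha =>
    fin_cases i
    · exact h0 a ha m
    · have h1 := hf 1 ((a ⊗ₜ w) ⊗ₜ m)
      have h2 := hg 1 ((a ⊗ₜ w) ⊗ₜ m)
      rw [tensorAct_sq2, freeAct_gen, freeAct_gen, map_add, map_add] at h1 h2
      rw [ha, ha m, ← h2, h0 a ha] at h1
      exact add_right_cancel (add_right_cancel h1)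

end extend

/-- The graded vector space underlying `M`, with `𝒜(1)` acting through the counit. -/
noncomputable def triv (M : GrMod) : GrMod where
  V := M.V
  ρ := trivAct M.V
  gr := M.gr
  isInternal := M.isInternal
  act_mem := act_mem_of_gen (by intros; simp) (by intros; simp)

/-- The free graded module on the graded vector space underlying `M`. -/
noncomputable def freeMod (M : GrMod) : GrMod := tensor regular (triv M)

/-- The canonical morphism from the free module on `M` to `M`. -/
noncomputable def freeMap (M : GrMod) : freeMod M ⟶ M where
  toLin := (TensorProduct.lift M.ρ.toLinearMap : A1 ⊗[𝔽] M.V →ₗ[𝔽] M.V)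
  map_act := map_act_of_gen (ρ := freeAct M.V) (σ := M.ρ)
    (TensorProduct.lift M.ρ.toLinearMap) fun i t => by
      induction t with
      | zero => simp
      | add s t hs ht => simp only [map_add, hs, ht]
      | tmul a x => simp
  map_mem n := map_mem_of_tmul (gr := A1.gr) (gr' := M.gr) (S := M.gr n) _
    fun i j a x hn ha hx => by
      subst hn
      exact M.act_mem ha hx

theorem freeMap_surjective (M : GrMod) : Function.Surjective (freeMap M).toLin := fun x =>
  ⟨((1 : A1) ⊗ₜ[𝔽] x : A1 ⊗[𝔽] M.V),
    (LinearMap.congr_fun (map_one M.ρ) x : M.ρ 1 x = x)⟩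

theorem projective_free_tensor (W M : GrMod) : Projective (tensor (freeMod W) M) where
  factors {N N'} g f _ := by
    obtain ⟨s, hs⟩ := f.toLin.exists_rightInverse_of_surjective
      (LinearMap.range_eq_top.2 (surjective_of_epi f))
    have hs' : ∀ x, f.toLin (s x) = x := LinearMap.congr_fun hs
    let g' : (A1 ⊗[𝔽] W.V) ⊗[𝔽] M.V →ₗ[𝔽] N'.V := g.toLin
    let φ : W.V →ₗ[𝔽] M.V →ₗ[𝔽] N.V :=
      (TensorProduct.curry (s ∘ₗ g')).comp (TensorProduct.mk 𝔽 A1 W.V 1)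
    have hh : f.toLin ∘ₗ extend M.ρ N.ρ φ = g' := by
      apply free_tensor_ext (ρ := M.ρ) (σ := N'.ρ)
      · intro i t
        rw [LinearMap.comp_apply, extend_act, f.map_act, LinearMap.comp_apply]
      · intro i t
        exact g.map_act _ t
      · intro w m
        rw [LinearMap.comp_apply, extend_tmul, map_one]
        exact hs' _
    refine ⟨homPartHom (M := tensor (freeMod W) M) (extend M.ρ N.ρ φ)
      (extend_act M.ρ N.ρ φ), ?_⟩
    refine hom_ext (LinearMap.ext fun x => ?_)
    induction x using hom_induction with
    | hom n x hx =>
      refine (congrArg f.toLin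
        (homPart_of_mem (M := tensor (freeMod W) M) (extend M.ρ N.ρ φ) hx)).trans ?_
      rw [← δ_map]
      have : f.toLin (extend M.ρ N.ρ φ x) = g.toLin x := LinearMap.congr_fun hh x
      refine (congrArg (fun y => N'.δ y n) this).trans ?_
      rw [N'.δ_of_mem (g.map_mem n x hx), Finsupp.single_eq_same]
    | add x y hx hy => rw [map_add, map_add, hx, hy]

theorem projective_tensor_right (P M : GrMod) (hP : Projective P) : Projective (P ⊗ M) := by
  have : Epi (freeMap P) := epi_of_surjective _ (freeMap_surjective P)
  obtain ⟨s, hs⟩ := hP.factors (𝟙 P) (freeMap P)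
  have : Projective (freeMod P ⊗ M) := projective_free_tensor P M
  exact (Retract.mk (s ▷ M) (freeMap P ▷ M) (by
    rw [← comp_whiskerRight, hs, id_whiskerRight])).projective

theorem projective_tensor_left (M P : GrMod) (hP : Projective P) : Projective (M ⊗ P) :=
  Projective.of_iso (swap P M) (projective_tensor_right P M hP)

theorem sub_whiskerRight {M N : GrMod} (f g : M ⟶ N) (P : GrMod) :
    f ▷ P - g ▷ P = (f - g) ▷ P :=
  hom_ext (TensorProduct.ext' fun _ _ => (TensorProduct.sub_tmul _ _ _).symm)

theorem whiskerLeft_sub (P : GrMod) {M N : GrMod} (f g : M ⟶ N) :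
    P ◁ f - P ◁ g = P ◁ (f - g) :=
  hom_ext (TensorProduct.ext' fun _ _ => (TensorProduct.tmul_sub _ _ _).symm)

end GrMod

/-! ### The stable category -/

/-- Two morphisms are stably equal if their difference factors through a projective module. -/
def stableRel : HomRel GrMod := fun M N f g =>
  ∃ (P : GrMod) (u : M ⟶ P) (v : P ⟶ N), Projective P ∧ f - g = u ≫ v

theorem stableRel_whiskerLeft (P : GrMod) {M N : GrMod} {f g : M ⟶ N} (h : stableRel f g) :
    stableRel (P ◁ f) (P ◁ g) := by
  obtain ⟨Q, u, v, hQ, e⟩ := h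
  exact ⟨P ⊗ Q, P ◁ u, P ◁ v, GrMod.projective_tensor_left P Q hQ, by
    rw [GrMod.whiskerLeft_sub, e, MonoidalCategory.whiskerLeft_comp]⟩

theorem stableRel_whiskerRight {M N : GrMod} {f g : M ⟶ N} (h : stableRel f g) (P : GrMod) :
    stableRel (f ▷ P) (g ▷ P) := by
  obtain ⟨Q, u, v, hQ, e⟩ := h
  exact ⟨Q ⊗ P, u ▷ P, v ▷ P, GrMod.projective_tensor_right Q P hQ, by
    rw [GrMod.sub_whiskerRight, e, comp_whiskerRight]⟩

/-- The stable category `St(𝒜(1))`: its objects are the graded `𝒜(1)`-modules, and its morphisms are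
the morphisms of graded modules modulo those that factor through a projective module. -/
abbrev St : Type 1 := CategoryTheory.Quotient stableRel

/-- The functor from graded `𝒜(1)`-modules to the stable category. -/
abbrev toSt : GrMod ⥤ St := CategoryTheory.Quotient.functor stableRel

/-- The functor `M ⊗ -` on the stable category. -/
noncomputable def stTensorLeft (M : GrMod) : St ⥤ St :=
  CategoryTheory.Quotient.lift stableRel (tensorLeft M ⋙ toSt) fun _ _ _ _ h =>
    CategoryTheory.Quotient.sound _ (stableRel_whiskerLeft M h)

/-- The functor `- ⊗ M` on the stable category. -/
noncomputable def stTensorRight (M : GrMod) : St ⥤ St :=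
  CategoryTheory.Quotient.lift stableRel (tensorRight M ⋙ toSt) fun _ _ _ _ h =>
    CategoryTheory.Quotient.sound _ (stableRel_whiskerRight h M)

noncomputable instance : MonoidalCategoryStruct St where
  tensorObj X Y := toSt.obj (X.as ⊗ Y.as)
  tensorUnit := toSt.obj (𝟙_ GrMod)
  whiskerLeft X _ _ f := (stTensorLeft X.as).map f
  whiskerRight f Y := (stTensorRight Y.as).map f
  tensorHom {_ Y₁ X₂ _} f g := (stTensorRight X₂.as).map f ≫ (stTensorLeft Y₁.as).map g
  associator X Y Z := toSt.mapIso (α_ X.as Y.as Z.as)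
  leftUnitor X := toSt.mapIso (λ_ X.as)
  rightUnitor X := toSt.mapIso (ρ_ X.as)

theorem st_map_tensorHom {M M' N N' : GrMod} (f : M ⟶ M') (g : N ⟶ N') :
    toSt.map f ⊗ₘ toSt.map g = toSt.map (f ⊗ₘ g) :=
  congrArg toSt.map (MonoidalCategory.tensorHom_def f g).symm

/-- The tensor product of modules makes the stable category a monoidal category. -/
noncomputable instance : MonoidalCategory St where
  tensorHom_def _ _ := rfl
  id_tensorHom_id X Y :=
    (st_map_tensorHom (𝟙 X.as) (𝟙 Y.as)).trans (congrArg toSt.map (id_tensorHom_id X.as Y.as))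
  tensorHom_comp_tensorHom f₁ f₂ g₁ g₂ := by
    obtain ⟨f₁, rfl⟩ := Quot.exists_rep f₁
    obtain ⟨f₂, rfl⟩ := Quot.exists_rep f₂
    obtain ⟨g₁, rfl⟩ := Quot.exists_rep g₁
    obtain ⟨g₂, rfl⟩ := Quot.exists_rep g₂
    refine (congrArg₂ (· ≫ ·) (st_map_tensorHom f₁ f₂) (st_map_tensorHom g₁ g₂)).trans ?_
    refine Eq.trans ?_ (st_map_tensorHom (f₁ ≫ g₁) (f₂ ≫ g₂)).symm
    exact congrArg toSt.map (tensorHom_comp_tensorHom f₁ f₂ g₁ g₂)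
  whiskerLeft_id X Y := congrArg toSt.map (whiskerLeft_id X.as Y.as)
  id_whiskerRight X Y := congrArg toSt.map (id_whiskerRight X.as Y.as)
  associator_naturality f₁ f₂ f₃ := by
    obtain ⟨f₁, rfl⟩ := Quot.exists_rep f₁
    obtain ⟨f₂, rfl⟩ := Quot.exists_rep f₂
    obtain ⟨f₃, rfl⟩ := Quot.exists_rep f₃
    have h₁ := (congrArg (· ⊗ₘ toSt.map f₃) (st_map_tensorHom f₁ f₂)).trans
      (st_map_tensorHom (f₁ ⊗ₘ f₂) f₃)
    have h₂ := (congrArg (toSt.map f₁ ⊗ₘ ·) (st_map_tensorHom f₂ f₃)).trans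
      (st_map_tensorHom f₁ (f₂ ⊗ₘ f₃))
    refine (congrArg (· ≫ toSt.map (α_ _ _ _).hom) h₁).trans ?_
    refine Eq.trans ?_ (congrArg (toSt.map (α_ _ _ _).hom ≫ ·) h₂).symm
    exact congrArg toSt.map (associator_naturality f₁ f₂ f₃)
  leftUnitor_naturality f := by
    obtain ⟨f, rfl⟩ := Quot.exists_rep f
    exact congrArg toSt.map (leftUnitor_naturality f)
  rightUnitor_naturality f := by
    obtain ⟨f, rfl⟩ := Quot.exists_rep f
    exact congrArg toSt.map (rightUnitor_naturality f)
  pentagon W X Y Z := congrArg toSt.map (pentagon W.as X.as Y.as Z.as)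
  triangle X Y := congrArg toSt.map (triangle X.as Y.as)

/-- The Picard group of a monoidal category: the group of isomorphism classes of objects that are
invertible for the tensor product. -/
abbrev PicardGroup (C : Type*) [Category C] [MonoidalCategory C] : Type _ := (Skeleton C)ˣ

end SteenrodA1

namespace SteenrodA1

namespace GrMod

/-! ### Homogeneous components -/

/-! The invariants that detect the Picard group are the two Margolis homologies, for the primitive
square-zero elements Q₀ = `Sq¹` of degree 1 and Q₁ = `Sq¹Sq² + Sq²Sq¹` of degree 3. Homology of Q
vanishes on projective modules (`exists_act_eq_of_projective`), so it is a functor on the stable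
category. Since Q is primitive, it satisfies a Künneth formula over the field (`tmul_notMem_range`,
`mem_range_tensor`). Hence an invertible module has one-dimensional homology for each Q,
concentrated in a single degree, and these degrees define homomorphisms from the Picard group to ℤ
(`degree`). The pair of degrees is (1, 3) on Ω𝟙, (b, b) on 𝟙[b] and (0, 0) on J, so it is (a + b, 3a
+ b) on the class with parameters (a, b, c).

The classes really are invertible. Schanuel's lemma shows that the kernel of the augmentation and
the cokernel of the top class are mutually inverse. The unit splits off J ⊗ J through the invariant
form of the self-dual joker, and the complement is free of rank 3, because 25 = 1 + 3·8
(`projective_coker_jokerCoeval`).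

Injectivity: the degrees determine a and b, and J is not stably trivial, because there is no
non-zero map from the unit to J.

Surjectivity reduces to two statements about an invertible object whose Q₀-degree is 0: its
Q₁-degree d is even, and if d = 0 the object is 𝟙 or J. It is represented by a finite module M
(`exists_finite_iso`): the coevaluation involves only a finite submodule, so the object is a stable
retract of a finite module, and the resulting idempotent lifts because endomorphism monoids of
finite modules are finite. In a bounded module, zigzags between Q₀ and Q₁ show that away from the
homology degrees the kernel of Q₀Q₁ is im Q₀ + im Q₁ (`SplitsAt`), much as for a free module over
the exterior algebra on Q₀ and Q₁.

This yields a generator x of the Q₀-homology that is also a Q₁-cycle (`exists_cycle`) and does not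
lie in im Q₁. If d were odd, x would be a Q₁-boundary, a contradiction (`not_odd`). If d = 0, an
analysis of `Sq² x` produces either a class killed by `Sq¹` and `Sq²` that splits off the unit, or
an element of degree -2 that generates a joker summand (`exists_unit_or_joker_class`). An invertible
object that has the unit as a retract is the unit (`comp_eq_id_of_retract`); if J is a retract of M,
the same applies to J ⊗ M. -/

theorem δ_act_of_mem (M : GrMod) {a : A1} {i : ℤ} (ha : a ∈ A1.gr i) (x : M.V) (n : ℤ) :
    M.δ (M.ρ a x) (i + n) = M.ρ a (M.δ x n) := by
  induction x using M.hom_induction with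
  | hom m x hx =>
    rw [M.δ_of_mem hx, M.δ_of_mem (M.act_mem ha hx), Finsupp.single_apply, Finsupp.single_apply]
    by_cases h : m = n
    · simp [h]
    · simp [h]
  | add x y hx hy => simp [hx, hy]

theorem δ_self (M : GrMod) {n : ℤ} {x : M.V} (hx : x ∈ M.gr n) : M.δ x n = x := by
  rw [M.δ_of_mem hx, Finsupp.single_eq_same]

/-- A homogeneous operation commutes with taking components up to a shift of degree, so one
component of any preimage is already a preimage. -/
theorem exists_mem_act_eq (M : GrMod) {a : A1} {i : ℤ} (ha : a ∈ A1.gr i) {n : ℤ} {x : M.V}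
    (hx : x ∈ M.gr n) {y : M.V} (h : M.ρ a y = x) : ∃ z ∈ M.gr (n - i), M.ρ a z = x := by
  refine ⟨M.δ y (n - i), M.δ_apply_mem _ _, ?_⟩
  rw [← δ_act_of_mem M ha, h, add_sub_cancel, M.δ_self hx]

theorem sum_δ (M : GrMod) (x : M.V) : ((M.δ x).sum fun _ z => z) = x := by
  induction x using M.hom_induction with
  | hom m x hx => simp [M.δ_of_mem hx]
  | add x y hx hy => rw [map_add, Finsupp.sum_add_index' (by simp) (by simp), hx, hy]

theorem mem_gr_of_δ (M : GrMod) {n : ℤ} {x : M.V} (h : M.δ x n = x) : x ∈ M.gr n :=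
  h ▸ M.δ_apply_mem x n

theorem δ_eq_zero_of_mem (M : GrMod) {n m : ℤ} {x : M.V} (hx : x ∈ M.gr n) (h : m ≠ n) :
    M.δ x m = 0 := by
  rw [M.δ_of_mem hx, Finsupp.single_eq_of_ne h]

theorem ρ_mul (M : GrMod) (a b : A1) (x : M.V) : M.ρ (a * b) x = M.ρ a (M.ρ b x) := by
  rw [map_mul, Module.End.mul_apply]

/-! ### Modules with a homogeneous basis -/

/-- The graded vector space with basis `e₀, …, eₙ₋₁` and `|eᵢ| = d i`. -/
def basisGr {n : ℕ} (d : Fin n → ℤ) (m : ℤ) : Submodule 𝔽 (Fin n → 𝔽) where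
  carrier := {x | ∀ i, d i ≠ m → x i = 0}
  zero_mem' _ _ := rfl
  add_mem' hx hy i h := by simp [hx i h, hy i h]
  smul_mem' r x hx i h := by simp [hx i h]

theorem basisGr_isInternal {n : ℕ} (d : Fin n → ℤ) : DirectSum.IsInternal (basisGr d) := by
  rw [isInternal_iff]
  refine ⟨fun x => ?_, ∑ i : Fin n, Finsupp.lsingle (d i) ∘ₗ
    LinearMap.single 𝔽 (fun _ => 𝔽) i ∘ₗ LinearMap.proj i, fun m x hx => ?_⟩
  · rw [← Finset.univ_sum_single x]
    refine sum_mem fun i _ => Submodule.mem_iSup_of_mem (d i) fun j hj => ?_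
    rw [Pi.single_eq_of_ne]
    rintro rfl
    exact hj rfl
  · rw [LinearMap.sum_apply]
    conv_rhs => rw [← Finset.univ_sum_single x, ← Finsupp.lsingle_apply (R := 𝔽), map_sum]
    refine Finset.sum_congr rfl fun i _ => ?_
    by_cases h : d i = m
    · simp [h]
    · simp [hx i h]

/-- The action of `𝒜(1)` on the question mark. -/
noncomputable def questionMarkAct : A1 →ₐ[𝔽] Module.End 𝔽 (Fin 3 → 𝔽) :=
  A1.lift
    { toFun := fun x => ![0, x 0, 0]
      map_add' := fun x y => by ext i; fin_cases i <;> simp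
      map_smul' := fun r x => by ext i; fin_cases i <;> simp }
    { toFun := fun x => ![0, 0, x 1]
      map_add' := fun x y => by ext i; fin_cases i <;> simp
      map_smul' := fun r x => by ext i; fin_cases i <;> simp }
    (by refine LinearMap.ext fun x => ?_; ext j; fin_cases j <;> simp)
    (by refine LinearMap.ext fun x => ?_; ext j; fin_cases j <;> simp)

theorem questionMarkAct_sq1 (x : Fin 3 → 𝔽) : questionMarkAct A1.sq1 x = ![0, x 0, 0] :=
  LinearMap.congr_fun (A1.lift_sq1 _ _) x

theorem questionMarkAct_sq2 (x : Fin 3 → 𝔽) : questionMarkAct A1.sq2 x = ![0, 0, x 1] :=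
  LinearMap.congr_fun (A1.lift_sq2 _ _) x

/-- The question mark: the module with basis `e₀, e₁, e₂` in degrees `0, 1, 3` in which
`Sq¹ e₀ = e₁` and `Sq² e₁ = e₂`. -/
noncomputable def questionMark : GrMod where
  V := Fin 3 → 𝔽
  ρ := questionMarkAct
  gr := basisGr ![0, 1, 3]
  isInternal := basisGr_isInternal _
  act_mem := act_mem_of_gen
    (fun n x hx => by
      rw [questionMarkAct_sq1]
      intro i hi
      fin_cases i
      · rfl
      · exact hx 0 (by simp at hi ⊢; lia)
      · rfl)
    (fun n x hx => by
      rw [questionMarkAct_sq2]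
      intro i hi
      fin_cases i
      · rfl
      · rfl
      · exact hx 1 (by simp at hi ⊢; lia))

/-- The projection of the question mark onto its bottom class. -/
noncomputable def questionMarkToUnit : questionMark ⟶ unit where
  toLin := (LinearMap.proj 0 : (Fin 3 → 𝔽) →ₗ[𝔽] 𝔽)
  map_act := map_act_of_gen (ρ := questionMarkAct) (σ := unitAct)
    (LinearMap.proj 0 : (Fin 3 → 𝔽) →ₗ[𝔽] 𝔽) fun i x => by
      fin_cases i
      · exact (congrFun (questionMarkAct_sq1 x) 0).trans (by simp)
      · exact (congrFun (questionMarkAct_sq2 x) 0).trans (by simp)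
  map_mem n x hx := by
    change x ∈ basisGr _ n at hx
    change (x : Fin 3 → 𝔽) 0 ∈ unitGr n
    rw [unitGr]
    split_ifs with h
    · trivial
    · exact (Submodule.mem_bot 𝔽).2 (hx 0 (by simpa using Ne.symm h))

end GrMod

/-! ### Margolis homology -/

/-- A primitive element of square zero, such as `Q₀ = Sq¹` and `Q₁ = Sq¹ Sq² + Sq² Sq¹`, which acts
non-trivially on the bottom class of the question mark. -/
structure IsMargolis (Q : A1) (q : ℤ) : Prop where
  mem_gr : Q ∈ A1.gr q
  mul_self : Q * Q = 0
  comul : A1.comulHom Q = Q ⊗ₜ 1 + 1 ⊗ₜ Q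
  counit : A1.counitHom Q = 0
  exists_coord : ∃ i : Fin 3, ∀ x : Fin 3 → 𝔽, GrMod.questionMarkAct Q x i = x 0

/-- The first Milnor primitive after `Sq¹`. -/
noncomputable def A1.q1 : A1 := A1.sq1 * A1.sq2 + A1.sq2 * A1.sq1

theorem isMargolis_sq1 : IsMargolis A1.sq1 1 where
  mem_gr := A1.gen_mem_gr 0
  mul_self := A1.sq1_sq1
  comul := A1.comulHom_sq1
  counit := A1.counitHom_gen 0
  exists_coord := ⟨1, fun x => congrFun (GrMod.questionMarkAct_sq1 x) 1⟩

theorem A1.mul_mem_gr {a b : A1} {i j : ℤ} (ha : a ∈ A1.gr i) (hb : b ∈ A1.gr j) :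
    a * b ∈ A1.gr (i + j) := by
  have := GrMod.act_mem_of_gen (ρ := Algebra.lmul 𝔽 A1) (gr := A1.gr)
    (fun n x hx => A1.gen_mul_mem_gr 0 hx) (fun n x hx => A1.gen_mul_mem_gr 1 hx) ha hb
  exact this

theorem A1.q1_mul_q1 : A1.q1 * A1.q1 = 0 := by
  have h1 : ∀ x, A1.sq1 * (A1.sq1 * x) = 0 := fun x => by rw [← mul_assoc, A1.sq1_sq1, zero_mul]
  have h2 : ∀ x, A1.sq2 * (A1.sq2 * x) = A1.sq1 * (A1.sq2 * (A1.sq1 * x)) := fun x => by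
    rw [← mul_assoc, A1.sq2_sq2, mul_assoc, mul_assoc]
  -- Both sides are `(Sq²)³`, bracketed in the two possible ways.
  have h3 : A1.sq2 * (A1.sq1 * (A1.sq2 * A1.sq1)) = A1.sq1 * (A1.sq2 * (A1.sq1 * A1.sq2)) := by
    have e1 : A1.sq2 * A1.sq2 * A1.sq2 = A1.sq1 * (A1.sq2 * (A1.sq1 * A1.sq2)) := by
      rw [A1.sq2_sq2, mul_assoc, mul_assoc]
    rw [← e1, mul_assoc, A1.sq2_sq2, mul_assoc]
  rw [A1.q1]
  simp only [mul_add, add_mul, mul_assoc, h1, h2, A1.sq1_sq1, h3, mul_zero, add_zero, zero_add]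
  exact ZModModule.add_self _

theorem A1.q1_mem_gr : A1.q1 ∈ A1.gr 3 := by
  have h1 := A1.mul_mem_gr (A1.gen_mem_gr 0) (A1.gen_mem_gr 1)
  have h2 := A1.mul_mem_gr (A1.gen_mem_gr 1) (A1.gen_mem_gr 0)
  have e1 : A1.deg 0 + A1.deg 1 = 3 := by simp [A1.deg]
  have e2 : A1.deg 1 + A1.deg 0 = 3 := by simp [A1.deg]
  rw [e1] at h1
  rw [e2] at h2
  exact add_mem h1 h2

theorem A1.comulHom_q1 : A1.comulHom A1.q1 = A1.q1 ⊗ₜ 1 + 1 ⊗ₜ A1.q1 := by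
  have e := fun x : A1 ⊗[𝔽] A1 => ZModModule.add_self x
  rw [A1.q1, map_add, map_mul, map_mul, A1.comulHom_sq1, A1.comulHom_sq2, ← sub_eq_zero]
  simp only [mul_add, add_mul, Algebra.TensorProduct.tmul_mul_tmul, A1.sq1_sq1, mul_one, one_mul,
    TensorProduct.add_tmul, TensorProduct.tmul_add, TensorProduct.zero_tmul,
    TensorProduct.tmul_zero, ZModModule.sub_eq_add]
  abel_nf
  simp only [two_zsmul, e]

theorem isMargolis_q1 : IsMargolis A1.q1 3 where
  mem_gr := A1.q1_mem_gr
  mul_self := A1.q1_mul_q1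
  comul := A1.comulHom_q1
  counit := by simp [A1.q1]
  -- On the bottom class `Sq¹Sq²` vanishes, while `Sq²Sq¹ e₀ = e₂`.
  exists_coord := ⟨2, fun x => by
    rw [A1.q1, map_add, map_mul, map_mul]
    simp [GrMod.questionMarkAct_sq1, GrMod.questionMarkAct_sq2]⟩

namespace IsMargolis

open GrMod

variable {Q : A1} {q : ℤ}

theorem tensorAct_tmul (hQ : IsMargolis Q q) {V W : Type*} [AddCommGroup V] [Module 𝔽 V]
    [AddCommGroup W] [Module 𝔽 W] (ρ : A1 →ₐ[𝔽] Module.End 𝔽 V) (σ : A1 →ₐ[𝔽] Module.End 𝔽 W)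
    (x : V) (y : W) : tensorAct ρ σ Q (x ⊗ₜ y) = ρ Q x ⊗ₜ y + x ⊗ₜ σ Q y := by
  simp [tensorAct, Module.endTensorEndAlgHom_apply, hQ.comul]

theorem act_act (hQ : IsMargolis Q q) (M : GrMod) (x : M.V) : M.ρ Q (M.ρ Q x) = 0 := by
  rw [← ρ_mul, hQ.mul_self, map_zero, LinearMap.zero_apply]

theorem unit_act (hQ : IsMargolis Q q) (x : 𝔽) : unitAct Q x = 0 := by
  simp [unitAct, hQ.counit]

/-- Projective modules have no Margolis homology. -/
theorem exists_act_eq_of_projective (hQ : IsMargolis Q q) (P : GrMod) [Projective P] {p : P.V}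
    (hp : P.ρ Q p = 0) : ∃ r, P.ρ Q r = p := by
  obtain ⟨i, hi⟩ := hQ.exists_coord
  -- Projectivity of P splits the projection from question mark ⊗ P to P. On the question mark, Q
  -- carries the bottom class to coordinate `i`, so that coordinate of the splitting yields a
  -- preimage of every cycle.
  let π : tensor questionMark P ⟶ P := tensorMap questionMarkToUnit (𝟙 P) ≫ (leftUnit P).hom
  let c : Fin 3 → ((Fin 3 → 𝔽) ⊗[𝔽] P.V →ₗ[𝔽] P.V) := fun j =>
    (TensorProduct.lid 𝔽 P.V).toLinearMap ∘ₗ (LinearMap.proj j).rTensor P.V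
  have hπ : ∀ t, π.toLin t = c 0 t := fun t => rfl
  have : Epi π := epi_of_surjective _ fun x =>
    ⟨((Pi.single 0 1 : Fin 3 → 𝔽) ⊗ₜ[𝔽] x : (Fin 3 → 𝔽) ⊗[𝔽] P.V), by
      refine (hπ _).trans ?_
      simp [c]⟩
  obtain ⟨s, hs⟩ := Projective.factors (𝟙 P) π
  -- Leibniz rule for the primitive Q: the Q of the first factor turns coordinate `0` into
  -- coordinate `i`.
  have key : ∀ t, c i (tensorAct questionMarkAct P.ρ Q t) = c 0 t + P.ρ Q (c i t) := by
    intro t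
    induction t with
    | zero => simp
    | add x y hx hy =>
      simp only [map_add, hx, hy]
      abel
    | tmul x y =>
      rw [hQ.tensorAct_tmul]
      simp [c, hi]
  have h0 : c 0 (s.toLin p) = p := LinearMap.congr_fun (congrArg Hom.toLin hs) p
  have h1 : tensorAct questionMarkAct P.ρ Q (s.toLin p) = 0 := by
    refine (s.map_act Q p).symm.trans ?_
    rw [hp, map_zero]
    rfl
  have h2 := key (s.toLin p)
  rw [h1, h0, map_zero] at h2
  refine ⟨c i (s.toLin p), ?_⟩
  rw [← sub_eq_zero, ZModModule.sub_eq_add, add_comm]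
  exact h2.symm

end IsMargolis

/-- Two morphisms induce the same map in Margolis homology. -/
def homologyRel (Q : A1) : HomRel GrMod := fun M N f g =>
  ∀ x, M.ρ Q x = 0 → ∃ y, N.ρ Q y = f.toLin x - g.toLin x

instance (Q : A1) : HomRel.IsStableUnderPrecomp (homologyRel Q) where
  comp_left f g g' h x hx := by
    obtain ⟨y, hy⟩ := h (f.toLin x) (by rw [← f.map_act, hx, map_zero])
    exact ⟨y, hy⟩

instance (Q : A1) : HomRel.IsStableUnderPostcomp (homologyRel Q) where
  comp_right g h x hx := by
    obtain ⟨y, hy⟩ := h x hx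
    exact ⟨g.toLin y, by rw [← g.map_act, hy, map_sub]; rfl⟩

instance (Q : A1) : Congruence (homologyRel Q) where
  equivalence :=
    { refl := fun f x _ => ⟨0, by simp⟩
      symm := fun h x hx => by
        obtain ⟨y, hy⟩ := h x hx
        exact ⟨-y, by simp [hy]⟩
      trans := fun h h' x hx => by
        obtain ⟨y, hy⟩ := h x hx
        obtain ⟨y', hy'⟩ := h' x hx
        exact ⟨y + y', by simp [hy, hy']⟩ }

/-! ### Stable invariance of Margolis homology -/

namespace IsMargolis

open GrMod

variable {Q : A1} {q : ℤ}

/-- Stably equal morphisms induce the same map in Margolis homology. -/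
theorem homologyRel_of_map_eq (hQ : IsMargolis Q q) {M N : GrMod} {f g : M ⟶ N}
    (h : toSt.map f = toSt.map g) : homologyRel Q f g := by
  -- `homologyRel Q` is a congruence containing `stableRel`, so the quotient functor descends to the
  -- stable category; an equality there becomes an equality modulo the congruence.
  let L : St ⥤ CategoryTheory.Quotient (homologyRel Q) :=
    CategoryTheory.Quotient.lift stableRel (CategoryTheory.Quotient.functor (homologyRel Q))
      fun M N f g ⟨P, u, v, hP, e⟩ => CategoryTheory.Quotient.sound _ fun x hx => by
        obtain ⟨r, hr⟩ := hQ.exists_act_eq_of_projective P (p := u.toLin x)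
          (by rw [← u.map_act, hx, map_zero])
        refine ⟨v.toLin r, ?_⟩
        rw [← v.map_act, hr]
        exact (LinearMap.congr_fun (congrArg Hom.toLin e) x).symm
  exact (CategoryTheory.Quotient.functor_map_eq_iff _ f g).1 (congrArg L.map h)

/-- A morphism from the unit to itself is determined by its stable class. -/
theorem unit_hom_eq (hQ : IsMargolis Q q) {f g : unit ⟶ unit} (h : toSt.map f = toSt.map g) :
    f = g := by
  refine hom_ext (LinearMap.ext fun x => ?_)
  obtain ⟨y, hy⟩ := hQ.homologyRel_of_map_eq h x (hQ.unit_act x)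
  exact sub_eq_zero.1 (hy.symm.trans (hQ.unit_act y))

/-- A module stably isomorphic to the unit has one-dimensional Margolis homology. -/
theorem exists_generator (hQ : IsMargolis Q q) {X : GrMod} (e : toSt.obj X ≅ toSt.obj unit) :
    ∃ t, X.ρ Q t = 0 ∧ t ∉ LinearMap.range (X.ρ Q) ∧
      ∀ c, X.ρ Q c = 0 → c ∉ LinearMap.range (X.ρ Q) → c - t ∈ LinearMap.range (X.ρ Q) := by
  obtain ⟨f, hf⟩ := toSt.map_surjective e.inv
  obtain ⟨g, hg⟩ := toSt.map_surjective e.hom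
  have h1 : f ≫ g = 𝟙 unit := hQ.unit_hom_eq (by
    rw [Functor.map_comp, hf, hg, e.inv_hom_id, CategoryTheory.Functor.map_id])
  have h2 : toSt.map (g ≫ f) = toSt.map (𝟙 X) := by
    rw [Functor.map_comp, hf, hg, e.hom_inv_id, CategoryTheory.Functor.map_id]
  let t : X.V := f.toLin (1 : 𝔽)
  have ht : g.toLin t = (1 : 𝔽) := LinearMap.congr_fun (congrArg Hom.toLin h1) (1 : 𝔽)
  have ht' : X.ρ Q t = 0 := by
    refine (f.map_act Q (1 : 𝔽)).symm.trans ?_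
    exact (congrArg f.toLin (hQ.unit_act 1)).trans (map_zero f.toLin)
  refine ⟨t, ht', ?_, fun c hc hc' => ?_⟩
  · rintro ⟨y, hy⟩
    rw [← hy, g.map_act] at ht
    exact zero_ne_one ((hQ.unit_act (g.toLin y)).symm.trans ht)
  · obtain ⟨y, hy⟩ := hQ.homologyRel_of_map_eq h2 c hc
    have hy' : X.ρ Q y = f.toLin (g.toLin c) - c := hy
    have hz : ∀ z : 𝔽, z = 0 ∨ z = 1 := by decide
    obtain h | h := hz (g.toLin c)
    · refine absurd ⟨-y, ?_⟩ hc'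
      have h' : f.toLin (g.toLin c) = 0 := (congrArg f.toLin h).trans (map_zero _)
      rw [map_neg, hy', h']
      simp
    · refine ⟨-y, ?_⟩
      have h' : f.toLin (g.toLin c) = t := congrArg f.toLin h
      rw [map_neg, hy', h']
      simp

end IsMargolis

/-- There is a non-trivial Margolis homology class of degree `d`. -/
def HasClass (Q : A1) (M : GrMod) (d : ℤ) : Prop :=
  ∃ u ∈ M.gr d, M.ρ Q u = 0 ∧ u ∉ LinearMap.range (M.ρ Q)

/-! ### Künneth formula and homology of invertible modules -/

namespace IsMargolis

open GrMod

variable {Q : A1} {q : ℤ}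

/-- Choose functionals that vanish on the boundaries but not on u and v. By the Leibniz rule their
tensor product vanishes on all boundaries, but not on u ⊗ v. -/
theorem tmul_notMem_range (hQ : IsMargolis Q q) {M N : GrMod} {u : M.V} {v : N.V}
    (hu : u ∉ LinearMap.range (M.ρ Q)) (hv : v ∉ LinearMap.range (N.ρ Q)) :
    (u ⊗ₜ[𝔽] v : M.V ⊗[𝔽] N.V) ∉ LinearMap.range (tensorAct M.ρ N.ρ Q) := by
  obtain ⟨α, hα, hα'⟩ := Submodule.exists_le_ker_of_notMem hu
  obtain ⟨β, hβ, hβ'⟩ := Submodule.exists_le_ker_of_notMem hv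
  rintro ⟨t, ht⟩
  have key : ∀ t, LinearMap.mul' 𝔽 𝔽 (TensorProduct.map α β (tensorAct M.ρ N.ρ Q t)) = 0 := by
    intro t
    induction t with
    | zero => simp
    | add x y hx hy => rw [map_add, map_add, map_add, hx, hy, add_zero]
    | tmul x y =>
      have e1 : α (M.ρ Q x) = 0 := hα' ⟨x, rfl⟩
      have e2 : β (N.ρ Q y) = 0 := hβ' ⟨y, rfl⟩
      simp [hQ.tensorAct_tmul, e1, e2]
  have := key t
  rw [ht] at this
  simp at this
  exact this.elim hα hβ

theorem hasClass_tensor (hQ : IsMargolis Q q) {M N : GrMod} {d e : ℤ} (hM : HasClass Q M d)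
    (hN : HasClass Q N e) : HasClass Q (tensor M N) (d + e) := by
  obtain ⟨u, hu, hu', hu''⟩ := hM
  obtain ⟨v, hv, hv', hv''⟩ := hN
  refine ⟨(u ⊗ₜ[𝔽] v : M.V ⊗[𝔽] N.V), tmul_mem hu hv rfl, ?_, hQ.tmul_notMem_range hu'' hv''⟩
  refine (hQ.tensorAct_tmul M.ρ N.ρ u v).trans ?_
  rw [hu', hv', TensorProduct.zero_tmul, TensorProduct.tmul_zero, add_zero]
  rfl

/-- A boundary in N would be sent back by the retraction to a boundary that differs from u by a
boundary. Only a stable retraction is needed. -/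
theorem hasClass_of_map (hQ : IsMargolis Q q) {M N : GrMod} {d : ℤ} (hM : HasClass Q M d)
    (f : toSt.obj M ⟶ toSt.obj N) (g : toSt.obj N ⟶ toSt.obj M) (h : f ≫ g = 𝟙 _) :
    HasClass Q N d := by
  obtain ⟨f, rfl⟩ := toSt.map_surjective f
  obtain ⟨g, rfl⟩ := toSt.map_surjective g
  have h' : toSt.map (f ≫ g) = toSt.map (𝟙 M) := by
    rw [Functor.map_comp, h, CategoryTheory.Functor.map_id]
  obtain ⟨u, hu, hu', hu''⟩ := hM
  refine ⟨f.toLin u, f.map_mem d u hu, by rw [← f.map_act, hu', map_zero], ?_⟩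
  rintro ⟨y, hy⟩
  obtain ⟨z, hz⟩ := hQ.homologyRel_of_map_eq h' u hu'
  have hz' : M.ρ Q z = g.toLin (f.toLin u) - u := hz
  refine hu'' ⟨g.toLin y - z, ?_⟩
  rw [map_sub, hz', ← g.map_act, hy]
  simp

theorem hasClass_of_iso (hQ : IsMargolis Q q) {M N : GrMod} {d : ℤ} (hM : HasClass Q M d)
    (e : toSt.obj M ≅ toSt.obj N) : HasClass Q N d :=
  hQ.hasClass_of_map hM e.hom e.inv e.hom_inv_id

/-- If `M` has no Margolis homology, then neither does `M ⊗ N`. -/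
theorem mem_range_tensor (hQ : IsMargolis Q q) {M N : GrMod}
    (hM : ∀ x, M.ρ Q x = 0 → x ∈ LinearMap.range (M.ρ Q)) {t : M.V ⊗[𝔽] N.V}
    (ht : tensorAct M.ρ N.ρ Q t = 0) : t ∈ LinearMap.range (tensorAct M.ρ N.ρ Q) := by
  obtain ⟨p, hp⟩ := (LinearMap.range (M.ρ Q)).subtype.exists_leftInverse_of_injective
    (LinearMap.range (M.ρ Q)).ker_subtype
  obtain ⟨s, hs⟩ := (M.ρ Q).rangeRestrict.exists_rightInverse_of_surjective
    (LinearMap.range_rangeRestrict _)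
  let g : M.V →ₗ[𝔽] M.V := s ∘ₗ p
  have hg : ∀ x, M.ρ Q (g (M.ρ Q x)) = M.ρ Q x := fun x => by
    have e1 : p (M.ρ Q x) = ⟨M.ρ Q x, x, rfl⟩ := LinearMap.congr_fun hp ⟨M.ρ Q x, x, rfl⟩
    have e2 := LinearMap.congr_fun hs ⟨M.ρ Q x, x, rfl⟩
    have e3 := congrArg Subtype.val e2
    change M.ρ Q (s (p (M.ρ Q x))) = _
    rw [e1]
    exact e3
  -- `g` inverts Q on its image. The correction term makes h vanish suitably on boundaries, so that
  -- Qh + hQ = 1: acyclicity over a field gives a contracting homotopy.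
  let h : M.V →ₗ[𝔽] M.V := g - g ∘ₗ g ∘ₗ M.ρ Q
  have hh : ∀ x, M.ρ Q (h x) + h (M.ρ Q x) = x := fun x => by
    obtain ⟨w, hw⟩ := hM (x - g (M.ρ Q x)) (by rw [map_sub, hg, sub_self])
    have e1 : M.ρ Q (h x) = M.ρ Q (g (x - g (M.ρ Q x))) := by simp [h]
    have e2 : h (M.ρ Q x) = g (M.ρ Q x) := by simp [h, hQ.act_act]
    rw [e1, e2, ← hw, hg, hw, sub_add_cancel]
  -- h ⊗ 1 is a contracting homotopy of the tensor product; the two cross terms h ⊗ Q cancel in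
  -- characteristic 2.
  have key : ∀ t, tensorAct M.ρ N.ρ Q (h.rTensor N.V t) +
      h.rTensor N.V (tensorAct M.ρ N.ρ Q t) = t := by
    intro t
    induction t with
    | zero => simp
    | add x y hx hy =>
      rw [map_add, map_add, map_add, map_add, add_add_add_comm, hx, hy]
    | tmul x y =>
      have e := ZModModule.add_self (h x ⊗ₜ[𝔽] N.ρ Q y)
      rw [hQ.tensorAct_tmul, LinearMap.rTensor_tmul, hQ.tensorAct_tmul, map_add,
        LinearMap.rTensor_tmul, LinearMap.rTensor_tmul, add_add_add_comm, e, add_zero,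
        ← TensorProduct.add_tmul, hh]
  exact ⟨h.rTensor N.V t, by simpa [ht] using key t⟩

/-- A non-zero Margolis homology group contains a homogeneous class. -/
theorem exists_hasClass_of_notMem (hQ : IsMargolis Q q) {M : GrMod} {x : M.V}
    (hx : M.ρ Q x = 0) (hx' : x ∉ LinearMap.range (M.ρ Q)) : ∃ d, HasClass Q M d := by
  by_contra! hcon
  refine hx' ?_
  rw [← M.sum_δ x]
  refine Submodule.sum_mem _ fun n _ => ?_
  by_contra h
  refine hcon n ⟨M.δ x n, M.δ_apply_mem x n, ?_, h⟩
  rw [← M.δ_act_of_mem hQ.mem_gr, hx]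
  simp

/-- An invertible module has a non-trivial Margolis homology class. -/
theorem exists_hasClass (hQ : IsMargolis Q q) {M N : GrMod}
    (e : toSt.obj (tensor M N) ≅ toSt.obj unit) : ∃ d, HasClass Q M d := by
  by_contra! hcon
  obtain ⟨t, ht, ht', -⟩ := hQ.exists_generator e
  refine ht' (hQ.mem_range_tensor (fun x hx => ?_) ht)
  by_contra hx'
  obtain ⟨d, hd⟩ := hQ.exists_hasClass_of_notMem hx hx'
  exact hcon d hd

/-- The Margolis homology of an invertible module has only one non-zero class. -/
theorem sub_mem_range (hQ : IsMargolis Q q) {M N : GrMod}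
    (e : toSt.obj (tensor M N) ≅ toSt.obj unit) {u u' : M.V} (hu : M.ρ Q u = 0)
    (hu' : u ∉ LinearMap.range (M.ρ Q)) (hv : M.ρ Q u' = 0)
    (hv' : u' ∉ LinearMap.range (M.ρ Q)) : u - u' ∈ LinearMap.range (M.ρ Q) := by
  obtain ⟨d, v, -, h1, h2⟩ := hQ.exists_hasClass (toSt.mapIso (swap N M) ≪≫ e)
  obtain ⟨(t : M.V ⊗[𝔽] N.V), -, -, ht⟩ := hQ.exists_generator e
  by_contra hcon
  -- By Künneth, the product of any non-trivial class with v is homologous to the one generator t of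
  -- the homology of the unit. Subtracting for u and u' gives that (u - u') ⊗ v is a boundary.
  have key : ∀ x : M.V, M.ρ Q x = 0 → x ∉ LinearMap.range (M.ρ Q) →
      (x ⊗ₜ[𝔽] v - t : M.V ⊗[𝔽] N.V) ∈ LinearMap.range (tensorAct M.ρ N.ρ Q) := fun x hx hx' =>
    ht (x ⊗ₜ[𝔽] v : M.V ⊗[𝔽] N.V) ((hQ.tensorAct_tmul M.ρ N.ρ x v).trans (by
      rw [hx, h1, TensorProduct.zero_tmul, TensorProduct.tmul_zero, add_zero]
      rfl)) (hQ.tmul_notMem_range hx' h2)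
  refine hQ.tmul_notMem_range hcon h2 ?_
  have := sub_mem (key u hu hu') (key u' hv hv')
  rwa [sub_sub_sub_cancel_right, ← TensorProduct.sub_tmul] at this

/-- The Margolis homology of an invertible module is concentrated in one degree. -/
theorem hasClass_unique (hQ : IsMargolis Q q) {M N : GrMod}
    (e : toSt.obj (tensor M N) ≅ toSt.obj unit) {d d' : ℤ} (hd : HasClass Q M d)
    (hd' : HasClass Q M d') : d = d' := by
  obtain ⟨u, hu, hu', hu''⟩ := hd
  obtain ⟨v, hv, hv', hv''⟩ := hd'
  by_contra hne
  obtain ⟨y, hy⟩ := hQ.sub_mem_range e hu' hu'' hv' hv''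
  refine hu'' ⟨M.δ y (d - q), ?_⟩
  rw [← M.δ_act_of_mem hQ.mem_gr, hy, add_sub_cancel, map_sub, Finsupp.sub_apply, M.δ_self hu,
    M.δ_eq_zero_of_mem hv hne, sub_zero]

/-- The Margolis homology of an invertible module vanishes in all degrees but one. -/
theorem exists_mem_act_eq (hQ : IsMargolis Q q) {M N : GrMod}
    (e : toSt.obj (tensor M N) ≅ toSt.obj unit) {d n : ℤ} (hd : HasClass Q M d) (hn : n ≠ d)
    {x : M.V} (hx : x ∈ M.gr n) (hx' : M.ρ Q x = 0) : ∃ y ∈ M.gr (n - q), M.ρ Q y = x := by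
  by_contra hcon
  refine hn (hQ.hasClass_unique e ⟨x, hx, hx', ?_⟩ hd)
  rintro ⟨y, hy⟩
  exact hcon (M.exists_mem_act_eq hQ.mem_gr hx hy)

end IsMargolis

namespace GrMod

/-! ### Modules whose Margolis homology is concentrated in degree zero -/

/-! ### Relations of 𝒜(1) as identities of operations -/

section relations

variable (M : GrMod) (x : M.V)

theorem sq1_sq1_act : M.ρ A1.sq1 (M.ρ A1.sq1 x) = 0 := by
  rw [← ρ_mul, A1.sq1_sq1, map_zero, LinearMap.zero_apply]

theorem sq2_sq2_act :
    M.ρ A1.sq2 (M.ρ A1.sq2 x) = M.ρ A1.sq1 (M.ρ A1.sq2 (M.ρ A1.sq1 x)) := by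
  rw [← ρ_mul, A1.sq2_sq2, ρ_mul, ρ_mul]

/-- Two ways of reducing `(Sq²)³`. -/
theorem sq2_sq1_sq2_sq1_act :
    M.ρ A1.sq2 (M.ρ A1.sq1 (M.ρ A1.sq2 (M.ρ A1.sq1 x))) =
      M.ρ A1.sq1 (M.ρ A1.sq2 (M.ρ A1.sq1 (M.ρ A1.sq2 x))) := by
  rw [← sq2_sq2_act, sq2_sq2_act M (M.ρ A1.sq2 x)]

theorem q1_act : M.ρ A1.q1 x = M.ρ A1.sq1 (M.ρ A1.sq2 x) + M.ρ A1.sq2 (M.ρ A1.sq1 x) := by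
  rw [A1.q1, map_add, LinearMap.add_apply, ρ_mul, ρ_mul]

/-- Both sides equal `Sq¹Sq²Sq¹ x`, so Q₀ and Q₁ commute and generate an exterior action. -/
theorem sq1_q1_act : M.ρ A1.sq1 (M.ρ A1.q1 x) = M.ρ A1.q1 (M.ρ A1.sq1 x) := by
  simp only [q1_act, map_add, sq1_sq1_act, map_zero, zero_add, add_zero]

end relations

/-- The homology of `Q` vanishes in degree `n`, for `Q` of degree `q`. -/
def HomologyVanishes (Q : A1) (q : ℤ) (M : GrMod) (n : ℤ) : Prop :=
  ∀ x ∈ M.gr n, M.ρ Q x = 0 → ∃ y ∈ M.gr (n - q), M.ρ Q y = x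

/-- In degree `n` the kernel of `Q₀ Q₁` is the sum of the images of `Q₀` and `Q₁`. -/
def SplitsAt (M : GrMod) (n : ℤ) : Prop :=
  ∀ a ∈ M.gr n, M.ρ A1.sq1 (M.ρ A1.q1 a) = 0 →
    ∃ p ∈ M.gr (n - 1), ∃ r ∈ M.gr (n - 3), a = M.ρ A1.sq1 p + M.ρ A1.q1 r

theorem sq1_mem (M : GrMod) {n m : ℤ} (h : m = n + 1) {x : M.V} (hx : x ∈ M.gr n) :
    M.ρ A1.sq1 x ∈ M.gr m := by
  have := M.act_gen0 hx
  rwa [add_comm, ← h] at this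

theorem sq2_mem (M : GrMod) {n m : ℤ} (h : m = n + 2) {x : M.V} (hx : x ∈ M.gr n) :
    M.ρ A1.sq2 x ∈ M.gr m := by
  have := M.act_gen1 hx
  rwa [add_comm, ← h] at this

theorem q1_mem (M : GrMod) {n m : ℤ} (h : m = n + 3) {x : M.V} (hx : x ∈ M.gr n) :
    M.ρ A1.q1 x ∈ M.gr m := by
  have := M.act_mem A1.q1_mem_gr hx
  rwa [add_comm, ← h] at this

theorem mem_gr_congr (M : GrMod) {n m : ℤ} (h : n = m) {x : M.V} (hx : x ∈ M.gr n) :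
    x ∈ M.gr m := h ▸ hx

/-! ### Zigzags between Q₀ and Q₁ -/

variable {M : GrMod}

/-- One step of a zigzag: Q₁a is a Q₀-cycle, so Q₁a = Q₀c with c two degrees higher, and Q₀Q₁c =
Q₁Q₁a = 0. Splitting c as Q₀p + Q₁r makes a - Q₀r a Q₁-cycle, hence a Q₁-boundary. -/
theorem SplitsAt.of_add_two {n : ℤ} (h : SplitsAt M (n + 2))
    (h0 : HomologyVanishes A1.sq1 1 M (n + 3)) (h1 : HomologyVanishes A1.q1 3 M n) :
    SplitsAt M n := by
  intro a ha h
  obtain ⟨c, hc, hc'⟩ := h0 _ (M.q1_mem rfl ha) h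
  obtain ⟨p, -, r, hr, e⟩ := ‹SplitsAt M (n + 2)› c (M.mem_gr_congr (by ring) hc) (by
    rw [sq1_q1_act, hc', isMargolis_q1.act_act])
  have hr' : M.ρ A1.sq1 r ∈ M.gr n := M.sq1_mem (by ring) hr
  obtain ⟨w, hw, hw'⟩ := h1 (a - M.ρ A1.sq1 r) (sub_mem ha hr') (by
    rw [map_sub, ← hc', e, map_add, sq1_sq1_act, zero_add, sq1_q1_act, sub_self])
  refine ⟨r, M.mem_gr_congr (by ring) hr, w, hw, ?_⟩
  rw [hw']
  abel

/-- The same zigzag with Q₀ and Q₁ exchanged: Q₀a = Q₁c with c two degrees lower. -/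
theorem SplitsAt.of_sub_two {n : ℤ} (h : SplitsAt M (n - 2))
    (h1 : HomologyVanishes A1.q1 3 M (n + 1)) (h0 : HomologyVanishes A1.sq1 1 M n) :
    SplitsAt M n := by
  intro a ha h
  rw [sq1_q1_act] at h
  obtain ⟨c, hc, hc'⟩ := h1 _ (M.sq1_mem rfl ha) h
  obtain ⟨p, hp, r, -, e⟩ := ‹SplitsAt M (n - 2)› c (M.mem_gr_congr (by ring) hc) (by
    rw [hc', sq1_sq1_act])
  have hp' : M.ρ A1.q1 p ∈ M.gr n := M.q1_mem (by ring) hp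
  obtain ⟨w, hw, hw'⟩ := h0 (a - M.ρ A1.q1 p) (sub_mem ha hp') (by
    rw [map_sub, ← hc', e, map_add, isMargolis_q1.act_act, add_zero, sq1_q1_act, sub_self])
  refine ⟨w, hw, p, M.mem_gr_congr (by ring) hp, ?_⟩
  rw [hw']
  abel

theorem splitsAt_of_eq_bot {n : ℤ} (h : M.gr n = ⊥) : SplitsAt M n := by
  intro a ha _
  rw [h, Submodule.mem_bot] at ha
  exact ⟨0, zero_mem _, 0, zero_mem _, by simp [ha]⟩

/-- The zigzag climbs by two degrees until the module is zero, where the splitting is trivial. Only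
one parity of degrees is used for each homology, which is what permits odd d in the applications. -/
theorem splitsAt_of_bounded_above {B : ℤ} (hB : ∀ n, B < n → M.gr n = ⊥) {n : ℤ}
    (h0 : ∀ i : ℕ, HomologyVanishes A1.sq1 1 M (n + 2 * i + 3))
    (h1 : ∀ i : ℕ, HomologyVanishes A1.q1 3 M (n + 2 * i)) : SplitsAt M n := by
  obtain ⟨k, hk⟩ : ∃ k : ℕ, B < n + 2 * k := ⟨(B - n + 1).toNat, by lia⟩
  induction k generalizing n with
  | zero => exact splitsAt_of_eq_bot (hB n (by simpa using hk))
  | succ k ih =>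
    refine SplitsAt.of_add_two (ih (fun i => ?_) (fun i => ?_) (by push_cast at hk; lia))
      (by simpa using h0 0) (by simpa using h1 0)
    · have := h0 (i + 1)
      push_cast at this
      rwa [show n + 2 + 2 * (i : ℤ) + 3 = n + 2 * (i + 1) + 3 by ring]
    · have := h1 (i + 1)
      push_cast at this
      rwa [show n + 2 + 2 * (i : ℤ) = n + 2 * (i + 1) by ring]

theorem splitsAt_of_bounded_below {B : ℤ} (hB : ∀ n, n < B → M.gr n = ⊥) {n : ℤ}
    (h1 : ∀ i : ℕ, HomologyVanishes A1.q1 3 M (n - 2 * i + 1))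
    (h0 : ∀ i : ℕ, HomologyVanishes A1.sq1 1 M (n - 2 * i)) : SplitsAt M n := by
  obtain ⟨k, hk⟩ : ∃ k : ℕ, n - 2 * k < B := ⟨(n - B + 1).toNat, by lia⟩
  induction k generalizing n with
  | zero => exact splitsAt_of_eq_bot (hB n (by simpa using hk))
  | succ k ih =>
    refine SplitsAt.of_sub_two (ih (fun i => ?_) (fun i => ?_) (by push_cast at hk; lia))
      (by simpa using h1 0) (by simpa using h0 0)
    · have := h1 (i + 1)
      push_cast at this
      rwa [show n - 2 - 2 * (i : ℤ) + 1 = n - 2 * (i + 1) + 1 by ring]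
    · have := h0 (i + 1)
      push_cast at this
      rwa [show n - 2 - 2 * (i : ℤ) = n - 2 * (i + 1) by ring]

theorem exists_bound (M : GrMod) [Finite M.V] :
    ∃ B : ℤ, ∀ n, M.gr n ≠ ⊥ → -B ≤ n ∧ n ≤ B := by
  have hf : {n | M.gr n ≠ ⊥}.Finite := by
    refine (Set.finite_iUnion fun x : M.V => (M.δ x).support.finite_toSet).subset fun n hn => ?_
    obtain ⟨x, hx, hx'⟩ := Submodule.exists_mem_ne_zero_of_ne_bot hn
    exact Set.mem_iUnion.2 ⟨x, by simpa [M.δ_of_mem hx] using hx'⟩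
  obtain ⟨b, hb⟩ := hf.bddAbove
  obtain ⟨c, hc⟩ := hf.bddBelow
  refine ⟨max b (-c), fun n hn => ⟨?_, ?_⟩⟩
  · have := hc hn
    have := le_max_right b (-c)
    lia
  · exact (hb hn).trans (le_max_left _ _)

/-- If the homology of `Q₀` is concentrated in degree `0`, and that of `Q₁` in a degree which is
`0` or odd, then every generator of the homology of `Q₀` may be corrected to a class which is also
annihilated by `Q₁` and does not lie in the sum of the images of `Q₀` and `Q₁`. -/
theorem exists_cycle [Finite M.V] {d : ℤ} (hd : d = 0 ∨ Odd d)
    (h0 : ∀ n ≠ 0, HomologyVanishes A1.sq1 1 M n) (h1 : ∀ n ≠ d, HomologyVanishes A1.q1 3 M n)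
    (hc : HasClass A1.sq1 M 0) :
    ∃ x ∈ M.gr 0, M.ρ A1.sq1 x = 0 ∧ M.ρ A1.q1 x = 0 ∧ x ∉ LinearMap.range (M.ρ A1.sq1) := by
  obtain ⟨B, hB⟩ := M.exists_bound
  obtain ⟨x, hx, hx', hx''⟩ := hc
  have h2 : SplitsAt M 2 := by
    refine splitsAt_of_bounded_above (B := B) (fun n hn => ?_) (fun i => h0 _ (by lia))
      (fun i => h1 _ ?_)
    · by_contra h
      exact absurd (hB n h).2 (by lia)
    · obtain rfl | ⟨k, rfl⟩ := hd <;> lia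
  -- Q₁x is a Q₀-boundary Q₀y with y in degree 2. Splitting y as Q₀p + Q₁r gives Q₁x = Q₁Q₀r, so x -
  -- Q₀r is the corrected class.
  obtain ⟨y, hy, hy'⟩ := h0 3 (by norm_num) _ (M.q1_mem rfl hx)
    (by rw [sq1_q1_act, hx', map_zero])
  obtain ⟨p, -, r, hr, rfl⟩ := h2 y hy (by rw [sq1_q1_act, hy', isMargolis_q1.act_act])
  refine ⟨x - M.ρ A1.sq1 r, sub_mem hx (M.sq1_mem (by norm_num) hr), ?_, ?_, fun h => hx'' ?_⟩
  · rw [map_sub, hx', sq1_sq1_act, sub_zero]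
  · rw [map_sub, ← hy', map_add, sq1_sq1_act, zero_add, sq1_q1_act, sub_self]
  · simpa using add_mem h (⟨r, rfl⟩ : M.ρ A1.sq1 r ∈ LinearMap.range (M.ρ A1.sq1))

theorem splitsAt_neg_three [Finite M.V] {d : ℤ} (hd : d = 0 ∨ Odd d)
    (h0 : ∀ n ≠ 0, HomologyVanishes A1.sq1 1 M n) (h1 : ∀ n ≠ d, HomologyVanishes A1.q1 3 M n) :
    SplitsAt M (-3) := by
  obtain ⟨B, hB⟩ := M.exists_bound
  refine splitsAt_of_bounded_below (B := -B) (fun n hn => ?_) (fun i => h1 _ ?_)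
    (fun i => h0 _ (by lia))
  · by_contra h
    exact absurd (hB n h).1 (by lia)
  · obtain rfl | ⟨k, rfl⟩ := hd <;> lia

/-- If x = Q₀p + Q₁r, then Q₀Q₁r = 0. The splitting in degree -3 gives r = Q₀p' + Q₁r', so Q₁r =
Q₀Q₁p' and x would lie in im Q₀. -/
theorem ne_add_of_notMem_range [Finite M.V] {d : ℤ} (hd : d = 0 ∨ Odd d)
    (h0 : ∀ n ≠ 0, HomologyVanishes A1.sq1 1 M n) (h1 : ∀ n ≠ d, HomologyVanishes A1.q1 3 M n)
    {x : M.V} (hx : M.ρ A1.sq1 x = 0) (hx' : x ∉ LinearMap.range (M.ρ A1.sq1)) {p r : M.V}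
    (hr : r ∈ M.gr (-3)) : x ≠ M.ρ A1.sq1 p + M.ρ A1.q1 r := by
  intro h
  obtain ⟨p', -, r', -, rfl⟩ := splitsAt_neg_three hd h0 h1 r hr (by
    rwa [h, map_add, sq1_sq1_act, zero_add] at hx)
  refine hx' ⟨p + M.ρ A1.q1 p', ?_⟩
  rw [h, map_add, map_add, isMargolis_q1.act_act, add_zero, sq1_q1_act]

/-- For odd d the Q₁-homology vanishes in degree 0, so the common cycle x is a Q₁-boundary, which
the preceding lemma forbids. -/
theorem not_odd [Finite M.V] {d : ℤ} (hd : Odd d)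
    (h0 : ∀ n ≠ 0, HomologyVanishes A1.sq1 1 M n) (h1 : ∀ n ≠ d, HomologyVanishes A1.q1 3 M n)
    (hc : HasClass A1.sq1 M 0) : False := by
  obtain ⟨x, hx, hx0, hx1, hx'⟩ := exists_cycle (.inr hd) h0 h1 hc
  obtain ⟨r, hr, rfl⟩ := h1 0 (by rintro rfl; exact absurd hd (by decide)) x hx hx1
  exact ne_add_of_notMem_range (.inr hd) h0 h1 hx0 hx' (p := 0) hr (by simp)

/-- From a positive degree the zigzag goes upwards, from a degree below -1 it goes downwards, and
neither meets the homology in degree 0. Degree -1 needs one upward step, to degree 1. -/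
theorem splitsAt_of_ne_zero [Finite M.V]
    (h0 : ∀ n ≠ 0, HomologyVanishes A1.sq1 1 M n) (h1 : ∀ n ≠ 0, HomologyVanishes A1.q1 3 M n)
    {n : ℤ} (hn : n ≠ 0) : SplitsAt M n := by
  obtain ⟨B, hB⟩ := M.exists_bound
  have hpos : ∀ n, 0 < n → SplitsAt M n := fun n hn =>
    splitsAt_of_bounded_above (B := B) (fun m hm => by
      by_contra h
      exact absurd (hB m h).2 (by lia)) (fun i => h0 _ (by lia)) (fun i => h1 _ (by lia))
  have hneg : ∀ n, n < -1 → SplitsAt M n := fun n hn =>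
    splitsAt_of_bounded_below (B := -B) (fun m hm => by
      by_contra h
      exact absurd (hB m h).1 (by lia)) (fun i => h1 _ (by lia)) (fun i => h0 _ (by lia))
  obtain h | rfl | h := lt_trichotomy n (-1)
  · exact hneg n h
  · exact SplitsAt.of_add_two (hpos _ (by norm_num)) (h0 _ (by norm_num)) (h1 _ (by norm_num))
  · exact hpos n (by lia)

/-- Away from degree 0 a common cycle is divisible by the socle Q₀Q₁ of the exterior algebra: write
it as a boundary for one operator and split the preimage. -/
theorem exists_sq1_q1_eq [Finite M.V]
    (h0 : ∀ n ≠ 0, HomologyVanishes A1.sq1 1 M n) (h1 : ∀ n ≠ 0, HomologyVanishes A1.q1 3 M n)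
    {n : ℤ} (hn : n ≠ 0) {a : M.V} (ha : a ∈ M.gr n) (ha0 : M.ρ A1.sq1 a = 0)
    (ha1 : M.ρ A1.q1 a = 0) : ∃ c ∈ M.gr (n - 4), M.ρ A1.sq1 (M.ρ A1.q1 c) = a := by
  -- In degree 1 a Q₀-preimage would lie in degree 0, where splitting is not available; a
  -- Q₁-preimage in degree -2 is used instead.
  by_cases hn1 : n = 1
  · obtain ⟨b, hb, rfl⟩ := h1 n hn a ha ha1
    obtain ⟨p, hp, r, -, rfl⟩ := splitsAt_of_ne_zero h0 h1 (by lia : n - 3 ≠ 0) b hb ha0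
    refine ⟨p, M.mem_gr_congr (by ring) hp, ?_⟩
    rw [map_add, isMargolis_q1.act_act, add_zero, sq1_q1_act]
  · obtain ⟨b, hb, rfl⟩ := h0 n hn a ha ha0
    obtain ⟨p, -, r, hr, rfl⟩ := splitsAt_of_ne_zero h0 h1 (by lia : n - 1 ≠ 0) b hb
      (by rw [sq1_q1_act, ha1])
    refine ⟨r, M.mem_gr_congr (by ring) hr, ?_⟩
    rw [map_add, sq1_sq1_act, zero_add]

/-- A class annihilated by `Sq¹` and `Sq²` which generates the homology of `Sq¹` is not
decomposable. -/
theorem ne_sq1_add_sq2 [Finite M.V]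
    (h0 : ∀ n ≠ 0, HomologyVanishes A1.sq1 1 M n) (h1 : ∀ n ≠ 0, HomologyVanishes A1.q1 3 M n)
    {x : M.V} (hx0 : M.ρ A1.sq1 x = 0) (hx2 : M.ρ A1.sq2 x = 0)
    (hx' : x ∉ LinearMap.range (M.ρ A1.sq1)) {a b : M.V} (ha : a ∈ M.gr (-1))
    (hb : b ∈ M.gr (-2)) : x ≠ M.ρ A1.sq1 a + M.ρ A1.sq2 b := by
  intro h
  have ch := fun y : M.V => ZModModule.add_self y
  have hb' : M.ρ A1.sq1 (M.ρ A1.sq2 b) = 0 := by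
    rwa [h, map_add, sq1_sq1_act, zero_add] at hx0
  -- From `Sq² x = 0`. It makes Q₀Q₁a vanish, so a splits as Q₀p + Q₁f, and Q₀p does not contribute
  -- to `Sq¹ a`.
  have e1 : M.ρ A1.sq2 (M.ρ A1.sq1 a) = M.ρ A1.sq1 (M.ρ A1.sq2 (M.ρ A1.sq1 b)) := by
    rw [h, map_add, sq2_sq2_act] at hx2
    rw [← sub_eq_zero, ZModModule.sub_eq_add, hx2]
  obtain ⟨p, -, f, hf, rfl⟩ := splitsAt_of_ne_zero h0 h1 (by norm_num) a ha (by
    rw [q1_act, map_add, sq1_sq1_act, e1, sq1_sq1_act, add_zero])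
  -- With a in this form, the relation reads `Sq¹Sq²Sq¹ b = (Sq²)³ f`, so b - `Sq² f` also splits.
  have e2 : M.ρ A1.sq1 (M.ρ A1.q1 (b - M.ρ A1.sq2 f)) = 0 := by
    simp only [q1_act, map_add, map_sub, sq1_sq1_act, sq2_sq2_act, zero_add,
      sq2_sq1_sq2_sq1_act] at e1 ⊢
    rw [← e1]
    exact sub_self _
  have hf' : M.ρ A1.sq2 f ∈ M.gr (-2) := M.sq2_mem (by norm_num) hf
  obtain ⟨g, hg, k, hk, e3⟩ := splitsAt_of_ne_zero h0 h1 (by norm_num) _ (sub_mem hb hf') e2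
  have e4 : b = M.ρ A1.sq2 f + M.ρ A1.sq1 g + M.ρ A1.q1 k := by
    rw [add_assoc, ← e3]
    abel
  -- After substitution the two terms `Sq¹Sq²Sq¹ f` cancel. The rest, `Sq²Sq¹ g + Sq²Sq¹Sq² k`,
  -- equals Q₀(`Sq² g`) + Q₁(g + `Sq² k`).
  refine ne_add_of_notMem_range (.inl rfl) h0 h1 hx0 hx' (p := M.ρ A1.sq2 g)
    (r := g + M.ρ A1.sq2 k) (add_mem (M.mem_gr_congr (by norm_num) hg)
      (M.sq2_mem (by norm_num) hk)) ?_
  rw [h, e4, ← sub_eq_zero]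
  simp only [q1_act, map_add, sq1_sq1_act, sq2_sq2_act, map_zero, zero_add, add_zero,
    ZModModule.sub_eq_add]
  abel_nf
  simp only [two_zsmul, ch]

/-- If the homologies of `Q₀` and `Q₁` are one-dimensional and concentrated in degree `0`, then
the generator is hit either by the unit, or by the joker. -/
theorem exists_unit_or_joker_class [Finite M.V]
    (h0 : ∀ n ≠ 0, HomologyVanishes A1.sq1 1 M n) (h1 : ∀ n ≠ 0, HomologyVanishes A1.q1 3 M n)
    (hc : HasClass A1.sq1 M 0)
    (hu : ∀ u v : M.V, M.ρ A1.q1 u = 0 → u ∉ LinearMap.range (M.ρ A1.q1) → M.ρ A1.q1 v = 0 →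
      v ∉ LinearMap.range (M.ρ A1.q1) → u - v ∈ LinearMap.range (M.ρ A1.q1)) :
    (∃ x ∈ M.gr 0, M.ρ A1.sq1 x = 0 ∧ M.ρ A1.sq2 x = 0 ∧ x ∉ LinearMap.range (M.ρ A1.sq1)) ∨
      ∃ b ∈ M.gr (-2), M.ρ A1.sq1 (M.ρ A1.sq2 b) = 0 ∧ ∀ a ∈ M.gr (-1),
        M.ρ A1.sq2 (M.ρ A1.sq2 b) ≠ M.ρ A1.sq2 (M.ρ A1.sq1 a) := by
  obtain ⟨x, hx, hx0, hx1, hx'⟩ := exists_cycle (.inl rfl) h0 h1 hc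
  have hxr : x ∉ LinearMap.range (M.ρ A1.q1) := by
    rintro ⟨r, hr⟩
    obtain ⟨r', hr', e⟩ := M.exists_mem_act_eq A1.q1_mem_gr hx hr
    exact ne_add_of_notMem_range (.inl rfl) h0 h1 hx0 hx' (p := 0) hr' (by simp [e])
  have hy1 : M.ρ A1.sq1 (M.ρ A1.sq2 x) = 0 := by
    rwa [q1_act, hx0, map_zero, add_zero] at hx1
  -- `Sq² x` is a common cycle in degree 2, so it equals Q₀Q₁w = `Sq²Sq² w`. The candidate x - `Sq²
  -- w` is then killed by `Sq²`; the obstruction to its being killed by `Sq¹` is `Sq¹Sq² w`, which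
  -- the next steps remove.
  obtain ⟨w, hw, hw'⟩ := exists_sq1_q1_eq h0 h1 (by norm_num) (M.sq2_mem (n := 0) rfl hx) hy1
    (by rw [q1_act, hy1, sq2_sq2_act, hx0, map_zero, map_zero, map_zero, zero_add])
  have hw2 : M.ρ A1.sq1 (M.ρ A1.sq2 (M.ρ A1.sq1 w)) = M.ρ A1.sq2 x := by
    rw [← hw', q1_act, map_add, sq1_sq1_act, zero_add]
  have hT : M.ρ A1.sq1 (M.ρ A1.sq2 (M.ρ A1.sq1 (M.ρ A1.sq2 w))) = 0 := by
    rw [← sq2_sq1_sq2_sq1_act, hw2, sq2_sq2_act, hx0, map_zero, map_zero]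
  have hq : M.ρ A1.q1 (M.ρ A1.sq2 w) = M.ρ A1.sq2 (M.ρ A1.sq1 (M.ρ A1.sq2 w)) := by
    rw [q1_act, sq2_sq2_act, sq1_sq1_act, zero_add]
  have hwm : M.ρ A1.sq2 w ∈ M.gr 0 := M.sq2_mem (by norm_num) hw
  -- Q₁`Sq² w` is a common cycle in degree 3, hence Q₀Q₁v, so `Sq² w - Sq¹ v` is a Q₁-cycle in
  -- degree 0.
  obtain ⟨v, hv, hv'⟩ := exists_sq1_q1_eq h0 h1 (n := 3) (by norm_num)
    (M.q1_mem (n := 0) (by norm_num) hwm) (by rw [hq, hT]) (isMargolis_q1.act_act _ _)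
  have hvm : M.ρ A1.sq1 v ∈ M.gr 0 := M.sq1_mem (by norm_num) hv
  have hr : M.ρ A1.q1 (M.ρ A1.sq2 w - M.ρ A1.sq1 v) = 0 := by
    rw [map_sub, ← hv', sq1_q1_act, sub_self]
  obtain ⟨σ, hσ, hσ'⟩ : ∃ σ ∈ M.gr (-3), M.ρ A1.sq1 (M.ρ A1.sq2 w) =
      M.ρ A1.sq1 (M.ρ A1.q1 σ) := by
    have e : M.ρ A1.sq1 (M.ρ A1.sq2 w) = M.ρ A1.sq1 (M.ρ A1.sq2 w - M.ρ A1.sq1 v) := by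
      rw [map_sub, sq1_sq1_act, sub_zero]
    -- This Q₁-cycle is a boundary or, the homology being one-dimensional, homologous to x. Since
    -- `Sq¹ x = 0`, applying `Sq¹` gives the same conclusion in both cases.
    by_cases hr' : M.ρ A1.sq2 w - M.ρ A1.sq1 v ∈ LinearMap.range (M.ρ A1.q1)
    · obtain ⟨σ, hσ⟩ := hr'
      obtain ⟨σ', h, hσ'⟩ := M.exists_mem_act_eq A1.q1_mem_gr (sub_mem hwm hvm) hσ
      exact ⟨σ', h, by rw [e, hσ']⟩
    · obtain ⟨σ, hσ⟩ := hu _ _ hr hr' hx1 hxr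
      obtain ⟨σ', h, hσ'⟩ := M.exists_mem_act_eq A1.q1_mem_gr (sub_mem (sub_mem hwm hvm) hx) hσ
      exact ⟨σ', h, by rw [e, hσ', map_sub _ _ x, hx0, sub_zero]⟩
  have hσ2 : M.ρ A1.sq1 σ ∈ M.gr (-2) := M.sq1_mem (by norm_num) hσ
  obtain ⟨b, hb, hb1, hb2⟩ : ∃ b ∈ M.gr (-2), M.ρ A1.sq1 (M.ρ A1.sq2 b) = 0 ∧
      M.ρ A1.sq2 (M.ρ A1.sq2 b) = M.ρ A1.sq2 x := by
    -- Subtracting `Sq¹ σ` cancels `Sq¹Sq² w` and leaves `Sq²Sq² w` unchanged, because `Sq²Sq²Sq¹ =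
    -- 0`.
    refine ⟨w - M.ρ A1.sq1 σ, sub_mem hw hσ2, ?_, ?_⟩
    · rw [map_sub, map_sub, hσ', q1_act, map_add, sq1_sq1_act, zero_add, sub_self]
    · rw [map_sub, map_sub, sq2_sq2_act, hw2, sq2_sq2_act, sq1_sq1_act, map_zero, map_zero,
        sub_zero]
  have hbm : M.ρ A1.sq2 b ∈ M.gr 0 := M.sq2_mem (by norm_num) hb
  -- x - `Sq² b` is killed by both squares. Either it is a non-trivial class and gives the unit, or
  -- `Sq² b` represents the class of x; then b gives a joker unless a correction by some `Sq¹ a`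
  -- makes `Sq² b` a unit class.
  by_cases hA : x - M.ρ A1.sq2 b ∈ LinearMap.range (M.ρ A1.sq1)
  · have hB : M.ρ A1.sq2 b ∉ LinearMap.range (M.ρ A1.sq1) := fun h =>
      hx' (by simpa using add_mem hA h)
    by_cases hB' : ∃ a ∈ M.gr (-1), M.ρ A1.sq2 (M.ρ A1.sq2 b) = M.ρ A1.sq2 (M.ρ A1.sq1 a)
    · obtain ⟨a, ha, e⟩ := hB'
      have ham : M.ρ A1.sq1 a ∈ M.gr 0 := M.sq1_mem (by norm_num) ha
      refine .inl ⟨M.ρ A1.sq2 b - M.ρ A1.sq1 a, sub_mem hbm ham, ?_, ?_, fun h => hB ?_⟩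
      · rw [map_sub, hb1, sq1_sq1_act, sub_zero]
      · rw [map_sub, e, sub_self]
      · simpa using add_mem h (⟨a, rfl⟩ : M.ρ A1.sq1 a ∈ LinearMap.range (M.ρ A1.sq1))
    · push Not at hB'
      exact .inr ⟨b, hb, hb1, hB'⟩
  · refine .inl ⟨x - M.ρ A1.sq2 b, sub_mem hx hbm, ?_, ?_, hA⟩
    · rw [map_sub, hx0, hb1, sub_zero]
    · rw [map_sub, hb2, sub_self]

end GrMod

namespace GrMod

/-! ### Splitting off the unit and the joker -/

variable {M : GrMod}

theorem exists_mem_of_mem_sup {a b : A1} {i j n : ℤ} (ha : a ∈ A1.gr i) (hb : b ∈ A1.gr j)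
    {x : M.V} (hx : x ∈ M.gr n)
    (h : x ∈ LinearMap.range (M.ρ a) ⊔ LinearMap.range (M.ρ b)) :
    ∃ y ∈ M.gr (n - i), ∃ z ∈ M.gr (n - j), x = M.ρ a y + M.ρ b z := by
  obtain ⟨_, ⟨y, rfl⟩, _, ⟨z, rfl⟩, h⟩ := Submodule.mem_sup.1 h
  refine ⟨M.δ y (n - i), M.δ_apply_mem _ _, M.δ z (n - j), M.δ_apply_mem _ _, ?_⟩
  rw [← M.δ_act_of_mem ha, ← M.δ_act_of_mem hb, add_sub_cancel, add_sub_cancel,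
    ← Finsupp.add_apply, ← map_add, h, M.δ_self hx]

/-- The morphism from the unit given by an element of degree zero annihilated by `Sq¹` and `Sq²`. -/
noncomputable def homOfUnit (x : M.V) (hx : x ∈ M.gr 0) (h1 : M.ρ A1.sq1 x = 0)
    (h2 : M.ρ A1.sq2 x = 0) : unit ⟶ M where
  toLin := LinearMap.toSpanSingleton 𝔽 M.V x
  map_act := map_act_of_gen (ρ := unitAct) (σ := M.ρ) (LinearMap.toSpanSingleton 𝔽 M.V x)
    fun i r => by fin_cases i <;> simp [h1, h2]
  map_mem n := fun (r : 𝔽) (hr : r ∈ unitGr n) => by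
    change r • x ∈ M.gr n
    rw [unitGr] at hr
    split_ifs at hr with h
    · exact Submodule.smul_mem _ _ (h ▸ hx)
    · rw [(Submodule.mem_bot 𝔽).1 hr, zero_smul]
      exact zero_mem _

/-- A map to the unit is a degree-zero functional that vanishes on the images of `Sq¹` and `Sq²`;
indecomposability of x allows one with value 1 at x. -/
theorem exists_unit_retraction {x : M.V} (hx : x ∈ M.gr 0) (h1 : M.ρ A1.sq1 x = 0)
    (h2 : M.ρ A1.sq2 x = 0)
    (h : ∀ a ∈ M.gr (-1), ∀ b ∈ M.gr (-2), x ≠ M.ρ A1.sq1 a + M.ρ A1.sq2 b) :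
    ∃ (f : unit ⟶ M) (g : M ⟶ unit), f ≫ g = 𝟙 unit := by
  have hx' : x ∉ LinearMap.range (M.ρ A1.sq1) ⊔ LinearMap.range (M.ρ A1.sq2) := fun hx' => by
    obtain ⟨y, hy, z, hz, e⟩ :=
      exists_mem_of_mem_sup (A1.gen_mem_gr 0) (A1.gen_mem_gr 1) hx hx'
    exact h y (M.mem_gr_congr (by simp [A1.deg]) hy) z (M.mem_gr_congr (by simp [A1.deg]) hz) e
  obtain ⟨ξ, hξ, hξ'⟩ := Submodule.exists_le_ker_of_notMem hx'
  have hξ1 : ξ x = 1 := by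
    have hz : ∀ z : 𝔽, z ≠ 0 → z = 1 := by decide
    exact hz _ hξ
  rw [sup_le_iff] at hξ'
  refine ⟨homOfUnit x hx h1 h2, homPartHom (M := M) (N := unit) (ξ : M.V →ₗ[𝔽] 𝔽) ?_, ?_⟩
  · intro i y
    refine Eq.trans ?_ (LinearMap.congr_fun (unitAct_gen i) (ξ y)).symm
    fin_cases i
    · exact hξ'.1 ⟨y, rfl⟩
    · exact hξ'.2 ⟨y, rfl⟩
  · refine hom_ext (LinearMap.ext_ring ?_)
    change homPart (M := M) (N := unit) ξ ((1 : 𝔽) • x) = (1 : 𝔽)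
    rw [one_smul]
    refine (homPart_of_mem (M := M) (N := unit) ξ hx).trans ?_
    refine (unit.δ_self ?_).trans hξ1
    exact (by simp [unitGr] : ξ x ∈ unitGr 0)

/-! ### Maps into and out of the joker -/

theorem jokerSq1_mul_self : jokerSq1 * jokerSq1 = 0 := by
  refine LinearMap.ext fun x => ?_
  ext j
  fin_cases j <;> simp [jokerSq1]

theorem jokerSq2_mul_self : jokerSq2 * jokerSq2 = jokerSq1 * jokerSq2 * jokerSq1 := by
  refine LinearMap.ext fun x => ?_
  ext j
  fin_cases j <;> simp [jokerSq1, jokerSq2]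

theorem joker_sq1 (x : Fin 5 → 𝔽) : joker.ρ A1.sq1 x = ![0, x 0, 0, 0, x 3] :=
  LinearMap.congr_fun (A1.lift_sq1 jokerSq1_mul_self jokerSq2_mul_self) x

theorem joker_sq2 (x : Fin 5 → 𝔽) : joker.ρ A1.sq2 x = ![0, 0, x 0, x 1, x 2] :=
  LinearMap.congr_fun (A1.lift_sq2 jokerSq1_mul_self jokerSq2_mul_self) x

/-- The images of the basis of the joker under the morphism sending `e₀` to `b`. -/
noncomputable def jokerVec (M : GrMod) (b : M.V) : Fin 5 → M.V :=
  ![b, M.ρ A1.sq1 b, M.ρ A1.sq2 b, M.ρ A1.sq2 (M.ρ A1.sq1 b), M.ρ A1.sq2 (M.ρ A1.sq2 b)]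

theorem jokerVec_mem {b : M.V} (hb : b ∈ M.gr (-2)) (i : Fin 5) :
    jokerVec M b i ∈ M.gr ((i : ℤ) - 2) := by
  have h1 : M.ρ A1.sq1 b ∈ M.gr (-1) := M.sq1_mem (by norm_num) hb
  have h2 : M.ρ A1.sq2 b ∈ M.gr 0 := M.sq2_mem (by norm_num) hb
  fin_cases i
  · exact hb
  · exact h1
  · exact h2
  · exact M.sq2_mem (by norm_num) h1
  · exact M.sq2_mem (by norm_num) h2

/-- The linear map from the joker given by the images of the basis. -/
noncomputable def jokerLin (b : M.V) : (Fin 5 → 𝔽) →ₗ[𝔽] M.V :=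
  Fintype.linearCombination 𝔽 (jokerVec M b)

theorem jokerLin_apply (b : M.V) (x : Fin 5 → 𝔽) : jokerLin b x =
    x 0 • b + x 1 • M.ρ A1.sq1 b + x 2 • M.ρ A1.sq2 b + x 3 • M.ρ A1.sq2 (M.ρ A1.sq1 b) +
      x 4 • M.ρ A1.sq2 (M.ρ A1.sq2 b) := by
  rw [jokerLin, Fintype.linearCombination_apply]
  simp only [Fin.sum_univ_five]
  rfl

/-- The morphism from the joker given by an element of degree `-2` annihilated by `Sq¹ Sq²`. -/
noncomputable def homOfJoker (b : M.V) (hb : b ∈ M.gr (-2))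
    (h : M.ρ A1.sq1 (M.ρ A1.sq2 b) = 0) : joker ⟶ M where
  toLin := jokerLin b
  map_act := map_act_of_gen (ρ := joker.ρ) (σ := M.ρ) (jokerLin b) fun i x => by
    -- The joker is cyclic on its bottom class with the single relation `Sq¹Sq² e₀ = 0`; these are
    -- the consequences of that relation.
    have h1 : M.ρ A1.sq1 (M.ρ A1.sq2 (M.ρ A1.sq1 b)) = M.ρ A1.sq2 (M.ρ A1.sq2 b) :=
      (sq2_sq2_act M b).symm
    have h4 : M.ρ A1.sq1 (M.ρ A1.sq2 (M.ρ A1.sq2 b)) = 0 := by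
      rw [sq2_sq2_act, sq1_sq1_act]
    have h5 : M.ρ A1.sq2 (M.ρ A1.sq2 (M.ρ A1.sq2 b)) = 0 := by
      rw [sq2_sq2_act M (M.ρ A1.sq2 b), h, map_zero, map_zero]
    have h6 : M.ρ A1.sq2 (M.ρ A1.sq2 (M.ρ A1.sq1 b)) = 0 := by
      rw [sq2_sq2_act, sq1_sq1_act, map_zero, map_zero]
    fin_cases i
    · refine (congrArg (jokerLin b) (joker_sq1 x)).trans ?_
      refine Eq.trans ?_ (congrArg (M.ρ A1.sq1) (jokerLin_apply b x)).symm
      simp only [jokerLin_apply, map_add, map_smul, sq1_sq1_act, h, h1, h4]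
      simp
    · refine (congrArg (jokerLin b) (joker_sq2 x)).trans ?_
      refine Eq.trans ?_ (congrArg (M.ρ A1.sq2) (jokerLin_apply b x)).symm
      simp only [jokerLin_apply, map_add, map_smul, h5, h6]
      simp
  map_mem n x hx := by
    refine (Fintype.linearCombination_apply 𝔽 (jokerVec M b) x) ▸ sum_mem fun i _ => ?_
    by_cases hi : (i : ℤ) - 2 = n
    · exact Submodule.smul_mem _ _ (hi ▸ jokerVec_mem hb i)
    · have : (x : Fin 5 → 𝔽) i = 0 := hx i hi
      rw [this, zero_smul]
      exact zero_mem _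

theorem homOfJoker_apply {b : M.V} (hb : b ∈ M.gr (-2))
    (h : M.ρ A1.sq1 (M.ρ A1.sq2 b) = 0) :
    (homOfJoker b hb h).toLin (Pi.single 0 1 : Fin 5 → 𝔽) = b := by
  refine (Fintype.linearCombination_apply_single (R := 𝔽) (v := jokerVec M b) 0 1).trans ?_
  simp [jokerVec]

/-- A morphism from the joker is determined by its value on the bottom class. -/
theorem joker_hom_ext {f g : joker ⟶ M} (h : f.toLin (Pi.single 0 1 : Fin 5 → 𝔽) =
    g.toLin (Pi.single 0 1 : Fin 5 → 𝔽)) : f = g := by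
  let E : LinearMap.ker (f.toLin - g.toLin) = ⊤ → f = g := fun h =>
    hom_ext (sub_eq_zero.1 (LinearMap.ker_eq_top.1 h))
  refine E ?_
  have hk : ∀ a (x : joker.V), x ∈ LinearMap.ker (f.toLin - g.toLin) →
      joker.ρ a x ∈ LinearMap.ker (f.toLin - g.toLin) := by
    intro a x hx
    rw [LinearMap.mem_ker, LinearMap.sub_apply, sub_eq_zero] at hx ⊢
    rw [f.map_act, g.map_act, hx]
  let e : Fin 5 → joker.V := fun i => (Pi.single i 1 : Fin 5 → 𝔽)
  have h0 : e 0 ∈ LinearMap.ker (f.toLin - g.toLin) := by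
    rw [LinearMap.mem_ker, LinearMap.sub_apply, sub_eq_zero]
    exact h
  have h1 : e 1 ∈ LinearMap.ker (f.toLin - g.toLin) := by
    have := hk A1.sq1 _ h0
    rwa [show joker.ρ A1.sq1 (e 0) = e 1 from (joker_sq1 _).trans
      (funext fun i : Fin 5 => by fin_cases i <;> rfl)] at this
  have h2 : e 2 ∈ LinearMap.ker (f.toLin - g.toLin) := by
    have := hk A1.sq2 _ h0
    rwa [show joker.ρ A1.sq2 (e 0) = e 2 from (joker_sq2 _).trans
      (funext fun i : Fin 5 => by fin_cases i <;> rfl)] at this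
  have h3 : e 3 ∈ LinearMap.ker (f.toLin - g.toLin) := by
    have := hk A1.sq2 _ h1
    rwa [show joker.ρ A1.sq2 (e 1) = e 3 from (joker_sq2 _).trans
      (funext fun i : Fin 5 => by fin_cases i <;> rfl)] at this
  have h4 : e 4 ∈ LinearMap.ker (f.toLin - g.toLin) := by
    have := hk A1.sq2 _ h2
    rwa [show joker.ρ A1.sq2 (e 2) = e 4 from (joker_sq2 _).trans
      (funext fun i : Fin 5 => by fin_cases i <;> rfl)] at this
  refine Submodule.eq_top_iff'.2 fun (x : Fin 5 → 𝔽) => ?_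
  have hx : x = ∑ i, x i • (Pi.single i 1 : Fin 5 → 𝔽) := by
    ext j
    simp [Finset.sum_apply, Pi.single_apply]
  rw [hx]
  refine Submodule.sum_mem _ fun i _ => Submodule.smul_mem _ _ ?_
  have he : ∀ i, e i ∈ LinearMap.ker (f.toLin - g.toLin) := by
    intro i
    fin_cases i <;> assumption
  exact he i

/-- Dually to its being cyclic, the joker is cogenerated by its top class: a map M → J amounts to a
functional on degree 2 that vanishes on the image of `Sq²Sq¹`. The hypothesis on b allows one with
value 1 at `Sq²Sq² b`. -/
theorem exists_joker_retraction {b : M.V} (hb : b ∈ M.gr (-2))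
    (h1 : M.ρ A1.sq1 (M.ρ A1.sq2 b) = 0)
    (h : ∀ a ∈ M.gr (-1), M.ρ A1.sq2 (M.ρ A1.sq2 b) ≠ M.ρ A1.sq2 (M.ρ A1.sq1 a)) :
    ∃ (f : joker ⟶ M) (g : M ⟶ joker), f ≫ g = 𝟙 joker := by
  have hy : M.ρ A1.sq2 (M.ρ A1.sq2 b) ∈ M.gr 2 :=
    M.sq2_mem (by norm_num) (M.sq2_mem (m := 0) (by norm_num) hb)
  have hy' : M.ρ A1.sq2 (M.ρ A1.sq2 b) ∉ LinearMap.range (M.ρ (A1.sq2 * A1.sq1)) := by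
    rintro ⟨a, ha⟩
    obtain ⟨a', ha', e⟩ := M.exists_mem_act_eq
      (A1.mul_mem_gr (A1.gen_mem_gr 1) (A1.gen_mem_gr 0)) hy ha
    refine h a' (M.mem_gr_congr (by simp [A1.deg]) ha') ?_
    rw [← e, ρ_mul]
  obtain ⟨ξ₀, hξ, hξ'⟩ := Submodule.exists_le_ker_of_notMem hy'
  let ξ : M.V →ₗ[𝔽] 𝔽 := ξ₀ ∘ₗ Finsupp.lapply 2 ∘ₗ M.δ
  have hξa : ∀ x, ξ x = ξ₀ (M.δ x 2) := fun x => rfl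
  have hξ0 : ∀ {n : ℤ} {x : M.V}, x ∈ M.gr n → n ≠ 2 → ξ x = 0 := fun hx hn => by
    rw [hξa, M.δ_eq_zero_of_mem hx hn.symm, map_zero]
  have hξ1 : ξ (M.ρ A1.sq2 (M.ρ A1.sq2 b)) = 1 := by
    have hz : ∀ z : 𝔽, z ≠ 0 → z = 1 := by decide
    rw [hξa, M.δ_self hy]
    exact hz _ hξ
  have hξ2 : ∀ y, ξ (M.ρ A1.sq2 (M.ρ A1.sq1 y)) = 0 := fun y => by
    have e := M.δ_act_of_mem (A1.mul_mem_gr (A1.gen_mem_gr 1) (A1.gen_mem_gr 0)) y (-1)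
    rw [show A1.deg 1 + A1.deg 0 + -1 = 2 by simp [A1.deg], ρ_mul] at e
    rw [hξa, e]
    exact hξ' ⟨M.δ y (-1), rfl⟩
  -- Each coordinate is ξ after the operation that carries the corresponding basis vector of the
  -- joker to the top class.
  let g : M.V →ₗ[𝔽] (Fin 5 → 𝔽) := LinearMap.pi
    ![ξ ∘ₗ M.ρ A1.sq2 ∘ₗ M.ρ A1.sq2, ξ ∘ₗ M.ρ A1.sq1 ∘ₗ M.ρ A1.sq2, ξ ∘ₗ M.ρ A1.sq2,
      ξ ∘ₗ M.ρ A1.sq1, ξ]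
  have hg : ∀ x, g x = ![ξ (M.ρ A1.sq2 (M.ρ A1.sq2 x)), ξ (M.ρ A1.sq1 (M.ρ A1.sq2 x)),
      ξ (M.ρ A1.sq2 x), ξ (M.ρ A1.sq1 x), ξ x] := by
    intro x
    ext i
    fin_cases i <;> rfl
  have hg' : ∀ i x, g (M.ρ (A1.gen i) x) = joker.ρ (A1.gen i) (g x) := by
    intro i x
    fin_cases i
    · refine Eq.trans ?_ (joker_sq1 (g x)).symm
      change g (M.ρ A1.sq1 x) = _
      rw [hg, hg, ← sq2_sq2_act, sq2_sq2_act M (M.ρ A1.sq1 x), sq1_sq1_act, hξ2]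
      simp
    · refine Eq.trans ?_ (joker_sq2 (g x)).symm
      change g (M.ρ A1.sq2 x) = _
      have e1 : ξ (M.ρ A1.sq2 (M.ρ A1.sq2 (M.ρ A1.sq2 x))) = 0 := by
        rw [sq2_sq2_act M x, sq2_sq1_sq2_sq1_act, ← sq2_sq1_sq2_sq1_act, hξ2]
      have e2 : M.ρ A1.sq1 (M.ρ A1.sq2 (M.ρ A1.sq2 x)) = 0 := by
        rw [sq2_sq2_act, sq1_sq1_act]
      rw [hg, hg, e1, e2, map_zero]
      simp
  have hgm : ∀ n, ∀ x ∈ M.gr n, g x ∈ jokerGr n := by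
    intro n x hx i hi
    rw [hg]
    fin_cases i
    · exact hξ0 (M.sq2_mem rfl (M.sq2_mem rfl hx)) (by simp at hi; lia)
    · exact hξ0 (M.sq1_mem rfl (M.sq2_mem rfl hx)) (by simp at hi; lia)
    · exact hξ0 (M.sq2_mem rfl hx) (by simp at hi; lia)
    · exact hξ0 (M.sq1_mem rfl hx) (by simp at hi; lia)
    · exact hξ0 hx (by simp at hi; lia)
  refine ⟨homOfJoker b hb h1, ⟨g, map_act_of_gen (ρ := M.ρ) (σ := joker.ρ) g hg', hgm⟩,
    joker_hom_ext ?_⟩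
  refine (congrArg g (homOfJoker_apply hb h1)).trans ?_
  change g b = Pi.single 0 1
  ext i
  by_cases hi : i = 0
  · subst hi
    rw [hg, hξ1]
    simp
  · rw [Pi.single_eq_of_ne hi]
    refine hgm _ b hb i fun h => hi (Fin.ext ?_)
    simp at h ⊢
    exact h

end GrMod

/-! ### Finiteness of `𝒜(1)` -/

/-- The monomial basis of `𝒜(1)`. -/
noncomputable def A1.monomial : Fin 8 → A1 :=
  ![1, sq1, sq2, sq1 * sq2, sq2 * sq1, sq1 * (sq2 * sq1), sq2 * (sq1 * sq2),
    sq1 * (sq2 * (sq1 * sq2))]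

theorem A1.span_monomial : Submodule.span 𝔽 (Set.range A1.monomial) = ⊤ := by
  have h1 : ∀ x, A1.sq1 * (A1.sq1 * x) = 0 := fun x => by rw [← mul_assoc, A1.sq1_sq1, zero_mul]
  have h2 : ∀ x, A1.sq2 * (A1.sq2 * x) = A1.sq1 * (A1.sq2 * (A1.sq1 * x)) := fun x => by
    rw [← mul_assoc, A1.sq2_sq2, mul_assoc, mul_assoc]
  have h3 : A1.sq2 * A1.sq2 = A1.sq1 * (A1.sq2 * A1.sq1) := by rw [A1.sq2_sq2, mul_assoc]
  -- With `h1`–`h3`, this and `h5` reduce every product of a generator with a listed monomial to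
  -- another listed monomial or to zero.
  have h4 : A1.sq2 * (A1.sq1 * (A1.sq2 * A1.sq1)) = A1.sq1 * (A1.sq2 * (A1.sq1 * A1.sq2)) := by
    rw [← h3, h2]
  have h5 : A1.sq2 * (A1.sq1 * (A1.sq2 * (A1.sq1 * A1.sq2))) = 0 := by
    rw [← h2, h2, h3, h1, mul_zero, mul_zero]
  have hm : ∀ j, A1.monomial j ∈ Submodule.span 𝔽 (Set.range A1.monomial) := fun j =>
    Submodule.subset_span ⟨j, rfl⟩
  have key : ∀ (i : Fin 2) (j : Fin 8),
      A1.gen i * A1.monomial j ∈ Submodule.span 𝔽 (Set.range A1.monomial) := by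
    intro i j
    fin_cases i <;> fin_cases j <;>
      simp [A1.monomial, h1, h2, h3, h4, h5, A1.sq1_sq1, -Matrix.range_cons]
    · exact hm 1
    · exact hm 3
    · exact hm 5
    · exact hm 7
    · exact hm 2
    · exact hm 4
    · exact hm 5
    · exact hm 6
    · exact hm 7
  refine Submodule.eq_top_iff'.2 fun a => ?_
  induction a using A1.induction with
  | one => exact hm 0
  | add a b ha hb => exact add_mem ha hb
  | smul r a ha => exact Submodule.smul_mem _ _ ha
  | gen_mul i a ha =>
    have : Submodule.span 𝔽 (Set.range A1.monomial) ≤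
        (Submodule.span 𝔽 (Set.range A1.monomial)).comap (LinearMap.mulLeft 𝔽 (A1.gen i)) := by
      rw [Submodule.span_le]
      rintro _ ⟨j, rfl⟩
      exact key i j
    exact this ha

instance : Module.Finite 𝔽 A1 :=
  ⟨A1.span_monomial ▸ Submodule.fg_span (Set.finite_range _)⟩

instance : Finite A1 := Module.finite_of_finite 𝔽

/-- The upper bound suffices: it is compared with the dimension 24 = 3·8 of the complement of the
unit in J ⊗ J. -/
theorem A1.finrank_le : Module.finrank 𝔽 A1 ≤ 8 := by
  have := finrank_range_le_card (R := 𝔽) A1.monomial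
  rw [Set.finrank, A1.span_monomial, finrank_top] at this
  simpa using this

namespace GrMod

/-! ### Graded submodules -/

/-- A homogeneous subspace which is closed under the action. -/
structure IsSub (M : GrMod) (S : Submodule 𝔽 M.V) : Prop where
  act_mem : ∀ (i : Fin 2), ∀ x ∈ S, M.ρ (A1.gen i) x ∈ S
  δ_mem : ∀ x ∈ S, ∀ n, M.δ x n ∈ S

theorem IsSub.ρ_mem {M : GrMod} {S : Submodule 𝔽 M.V} (h : IsSub M S) (a : A1) {x : M.V}
    (hx : x ∈ S) : M.ρ a x ∈ S := by
  induction a using A1.induction with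
  | one => simpa using hx
  | add a b ha hb =>
    rw [map_add]
    exact add_mem ha hb
  | smul r a ha =>
    rw [map_smul]
    exact S.smul_mem r ha
  | gen_mul i a ha =>
    rw [ρ_mul]
    exact h.act_mem i _ ha

/-- A graded submodule, as a graded module. -/
noncomputable def sub (M : GrMod) (S : Submodule 𝔽 M.V) (h : IsSub M S) : GrMod where
  V := S
  ρ := AlgHom.ofLinearMap
    { toFun := fun a => (M.ρ a).restrict (p := S) (q := S) fun x hx => h.ρ_mem a hx
      map_add' := fun a b => by ext x; simp
      map_smul' := fun r a => by ext x; simp }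
    (by ext x; simp) (fun a b => by ext x; simp)
  gr n := (M.gr n).comap S.subtype
  isInternal := by
    obtain ⟨π, hπ⟩ := S.subtype.exists_leftInverse_of_injective S.ker_subtype
    have hπ' : ∀ x : S, π x = x := LinearMap.congr_fun hπ
    rw [isInternal_iff]
    refine ⟨fun x => ?_, Finsupp.mapRange.linearMap π ∘ₗ M.δ ∘ₗ S.subtype, fun n x hx => ?_⟩
    · have e : x = (M.δ x).sum fun _ z => π z := by
        rw [← hπ' x]
        conv_lhs => rw [← M.sum_δ x, Finsupp.sum, map_sum]
        rw [hπ' x]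
        rfl
      rw [e]
      refine sum_mem fun n _ => Submodule.mem_iSup_of_mem n ?_
      have := hπ' ⟨M.δ x n, h.δ_mem x x.2 n⟩
      change π (M.δ x n) ∈ _
      rw [this]
      exact M.δ_apply_mem x n
    · have : M.δ x = Finsupp.single n (x : M.V) := M.δ_of_mem hx
      simp [this, hπ']
  act_mem := fun ha hx => M.act_mem ha hx

/-- The inclusion of a graded submodule. -/
noncomputable def subι (M : GrMod) (S : Submodule 𝔽 M.V) (h : IsSub M S) : sub M S h ⟶ M where
  toLin := S.subtype
  map_act _ _ := rfl
  map_mem _ _ hx := hx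

theorem mem_gr_of_injective {M N : GrMod} (f : M ⟶ N) (hf : Function.Injective f.toLin) {n : ℤ}
    {x : M.V} (hx : f.toLin x ∈ N.gr n) : x ∈ M.gr n :=
  M.mem_gr_of_δ (hf (by rw [← δ_map, N.δ_self hx]))

/-- Every tensor comes from a finite graded submodule of the first factor. -/
theorem exists_finite_sub (M N : GrMod) (t : M.V ⊗[𝔽] N.V) :
    ∃ (M' : GrMod) (ι : M' ⟶ M), Finite M'.V ∧ Function.Injective ι.toLin ∧
      t ∈ LinearMap.range (ι.toLin.rTensor N.V) := by
  obtain ⟨U, hU, ht⟩ :=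
    TensorProduct.exists_finite_submodule_left_of_setFinite {t} (Set.finite_singleton t)
  have : Finite U := Module.finite_of_finite 𝔽
  let X : Set M.V := ⋃ u : U, Set.range (M.δ u)
  have hX : X.Finite := Set.finite_iUnion fun u => by
    refine ((((M.δ u).support.finite_toSet.image (M.δ u))).insert 0).subset ?_
    rintro _ ⟨n, rfl⟩
    by_cases h : M.δ (u : M.V) n = 0
    · exact .inl h
    · exact .inr ⟨n, by simpa using h, rfl⟩
  -- All homogeneous elements of 𝒜(1) applied to all components of elements of U. Homogeneity makes
  -- the span closed under components, and finiteness of 𝒜(1) makes Z finite.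
  let Z : Set M.V := {z | ∃ a : A1, (∃ i, a ∈ A1.gr i) ∧ ∃ x ∈ X, M.ρ a x = z}
  have hZ : Z.Finite := by
    have := hX.to_subtype
    refine (Set.finite_range fun p : A1 × X => M.ρ p.1 (p.2 : M.V)).subset ?_
    rintro _ ⟨a, -, x, hx, rfl⟩
    exact ⟨(a, ⟨x, hx⟩), rfl⟩
  have hS : IsSub M (Submodule.span 𝔽 Z) := by
    constructor
    · intro i x hx
      have : Submodule.span 𝔽 Z ≤ (Submodule.span 𝔽 Z).comap (M.ρ (A1.gen i)) := by
        rw [Submodule.span_le]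
        rintro _ ⟨a, ⟨j, ha⟩, x, hx, rfl⟩
        exact Submodule.subset_span ⟨A1.gen i * a, ⟨_, A1.gen_mul_mem_gr i ha⟩, x, hx,
          ρ_mul _ _ _ _⟩
      exact this hx
    · intro x hx n
      have : Submodule.span 𝔽 Z ≤
          (Submodule.span 𝔽 Z).comap (Finsupp.lapply n ∘ₗ M.δ) := by
        rw [Submodule.span_le]
        rintro z ⟨a, ⟨j, ha⟩, x, hx, rfl⟩
        obtain ⟨u, m, rfl⟩ := Set.mem_iUnion.1 hx
        have e := M.δ_of_mem (M.act_mem ha (M.δ_apply_mem (u : M.V) m))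
        change M.δ (M.ρ a (M.δ (u : M.V) m)) n ∈ Submodule.span 𝔽 Z
        rw [e, Finsupp.single_apply]
        split_ifs
        · exact Submodule.subset_span ⟨a, ⟨j, ha⟩, _, hx, rfl⟩
        · exact zero_mem _
      exact this hx
  have hUS : U ≤ Submodule.span 𝔽 Z := by
    intro u hu
    rw [← M.sum_δ u]
    exact Submodule.sum_mem _ fun n _ => Submodule.subset_span
      ⟨1, ⟨0, A1.one_mem_gr⟩, _, Set.mem_iUnion.2 ⟨⟨u, hu⟩, n, rfl⟩, by simp⟩
  refine ⟨sub M _ hS, subι M _ hS, ?_, Subtype.val_injective, ?_⟩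
  · have : Module.Finite 𝔽 (Submodule.span 𝔽 Z) := Module.Finite.span_of_finite 𝔽 hZ
    exact (Module.finite_of_finite 𝔽 : Finite (Submodule.span 𝔽 Z))
  · obtain ⟨t', ht'⟩ := ht rfl
    refine ⟨(Submodule.inclusion hUS).rTensor N.V t', ?_⟩
    rw [← ht']
    exact (LinearMap.rTensor_comp_apply N.V (Submodule.span 𝔽 Z).subtype
      (Submodule.inclusion hUS) t').symm

/-- A morphism from the unit to a tensor product factors through a finite submodule of the first
factor. -/
theorem exists_finite_factorization {M N : GrMod} (f : unit ⟶ tensor M N) :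
    ∃ (M' : GrMod) (ι : M' ⟶ M) (f' : unit ⟶ tensor M' N), Finite M'.V ∧
      f' ≫ tensorMap ι (𝟙 N) = f := by
  obtain ⟨M', ι, hfin, hι, ht⟩ := exists_finite_sub M N (f.toLin (1 : 𝔽))
  have hinj : Function.Injective (tensorMap ι (𝟙 N)).toLin :=
    Module.Flat.rTensor_preserves_injective_linearMap ι.toLin hι
  obtain ⟨t, ht⟩ : ∃ t, (tensorMap ι (𝟙 N)).toLin t = f.toLin (1 : 𝔽) := ht
  have h1 : ∀ i, (tensor M' N).ρ (A1.gen i) t = 0 := fun i => hinj (by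
    rw [map_zero, (tensorMap ι (𝟙 N)).map_act, ht]
    refine (f.map_act (A1.gen i) (1 : 𝔽)).symm.trans ?_
    refine (congrArg f.toLin (LinearMap.congr_fun (unitAct_gen i) (1 : 𝔽))).trans ?_
    exact map_zero f.toLin)
  have hm : t ∈ (tensor M' N).gr 0 := mem_gr_of_injective _ hinj (by
    rw [ht]
    exact f.map_mem 0 _ (by simp [unitGr] : (1 : 𝔽) ∈ unitGr 0))
  refine ⟨M', ι, homOfUnit t hm (h1 0) (h1 1), hfin, hom_ext (LinearMap.ext_ring ?_)⟩
  refine Eq.trans ?_ ht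
  exact congrArg (tensorMap ι (𝟙 N)).toLin (one_smul 𝔽 t)

end GrMod

/-! ### Invertible modules are stably finite -/

/-- If the coevaluation of an invertible object `X` factors through `X' ⊗ Y`, then `X` is a retract
of `X'`. -/
theorem exists_section_of_factorization {C : Type*} [Category C] [MonoidalCategory C] {X X' Y : C}
    (e : X ⊗ Y ≅ 𝟙_ C) (e' : Y ⊗ X ≅ 𝟙_ C) (ι : X' ⟶ X) (φ : 𝟙_ C ⟶ X' ⊗ Y)
    (h : φ ≫ ι ▷ Y = e.inv) : ∃ r : X ⟶ X', r ≫ ι = 𝟙 X := by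
  -- `e` and `e'` need not satisfy the triangle identities, so θ is only an automorphism. It factors
  -- through ι after the coevaluation is replaced by φ, and composing with θ⁻¹ gives the section.
  let θ : X ≅ X := (λ_ X).symm ≪≫ whiskerRightIso e.symm X ≪≫ α_ X Y X ≪≫ whiskerLeftIso X e' ≪≫
    ρ_ X
  refine ⟨θ.inv ≫ (λ_ X).inv ≫ φ ▷ X ≫ (α_ X' Y X).hom ≫ X' ◁ e'.hom ≫ (ρ_ X').hom, ?_⟩
  have : θ.hom = (λ_ X).inv ≫ φ ▷ X ≫ (α_ X' Y X).hom ≫ X' ◁ e'.hom ≫ (ρ_ X').hom ≫ ι := by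
    simp only [θ, Iso.trans_hom, Iso.symm_hom, whiskerRightIso_hom, whiskerLeftIso_hom, ← h,
      comp_whiskerRight, Category.assoc]
    rw [← rightUnitor_naturality, whisker_exchange_assoc, ← associator_naturality_left_assoc]
  simp only [Category.assoc]
  rw [← this, Iso.inv_hom_id]

/-- Some positive power of an element of a finite monoid is idempotent. -/
theorem exists_isIdempotentElem_pow {R : Type*} [Monoid R] [Finite R] (x : R) :
    ∃ n, n ≠ 0 ∧ IsIdempotentElem (x ^ n) := by
  obtain ⟨i, j, hij, h⟩ := Finite.exists_ne_map_eq_of_infinite fun n : ℕ => x ^ n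
  wlog hlt : i < j generalizing i j
  · exact this j i hij.symm h.symm (by lia)
  obtain ⟨p, rfl⟩ := Nat.exists_eq_add_of_lt hlt
  have h1 : ∀ m k, x ^ (i + k + m * (p + 1)) = x ^ (i + k) := by
    intro m k
    induction m with
    | zero => simp
    | succ m ih =>
      rw [show i + k + (m + 1) * (p + 1) = (i + p + 1) + (k + m * (p + 1)) by ring, pow_add]
      rw [← show x ^ i = x ^ (i + p + 1) from h, ← pow_add, ← ih]
      congr 1
      ring
  -- The powers have period p + 1 from exponent i on; this exponent is a positive multiple of the
  -- period and at least i.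
  refine ⟨(i + 1) * (p + 1), by positivity, ?_⟩
  have h2 := h1 (i + 1) (i * p + p + 1)
  rw [show i + (i * p + p + 1) = (i + 1) * (p + 1) by ring] at h2
  rw [IsIdempotentElem, ← pow_add]
  exact h2

namespace GrMod

instance (M N : GrMod) [Finite M.V] [Finite N.V] : Finite (M ⟶ N) :=
  Finite.of_injective (fun f : M ⟶ N => (f.toLin : M.V → N.V)) fun _ _ h =>
    hom_ext (DFunLike.coe_injective h)

theorem toSt_map_pow {M : GrMod} (f : End M) (n : ℕ) :
    toSt.map (f ^ n) = Functor.mapEnd M toSt f ^ n :=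
  map_pow (Functor.mapEnd M toSt) f n

/-- An idempotent endomorphism of a module splits. -/
theorem exists_splitting {M : GrMod} (η : M ⟶ M) (h : η ≫ η = η) [Finite M.V] :
    ∃ (K : GrMod) (k : K ⟶ M) (p : M ⟶ K), Finite K.V ∧ k ≫ p = 𝟙 K ∧ p ≫ k = η := by
  have hS : IsSub M (LinearMap.range η.toLin) := by
    constructor
    · rintro i _ ⟨x, rfl⟩
      exact ⟨M.ρ (A1.gen i) x, η.map_act _ _⟩
    · rintro _ ⟨x, rfl⟩ n
      exact ⟨M.δ x n, (δ_map η x n).symm⟩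
  let p : M ⟶ sub M _ hS :=
    { toLin := η.toLin.rangeRestrict
      map_act := fun a x => Subtype.ext (η.map_act a x)
      map_mem := fun n x hx => η.map_mem n x hx }
  refine ⟨sub M _ hS, subι M _ hS, p, ?_, ?_, rfl⟩
  · exact (inferInstance : Finite (LinearMap.range η.toLin))
  · refine hom_ext (LinearMap.ext ?_)
    rintro ⟨_, x, rfl⟩
    exact Subtype.ext (LinearMap.congr_fun (congrArg Hom.toLin h) x)

/-- Every invertible module is stably isomorphic to a finite one. -/
theorem exists_finite_iso {M N : GrMod} (e : toSt.obj (tensor M N) ≅ toSt.obj unit) :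
    ∃ K : GrMod, Finite K.V ∧ Nonempty (toSt.obj K ≅ toSt.obj M) := by
  obtain ⟨f, hf⟩ := toSt.map_surjective e.inv
  obtain ⟨M', ι, f', hfin, h⟩ := exists_finite_factorization f
  obtain ⟨r, hr⟩ := exists_section_of_factorization (C := St) (X := toSt.obj M) (Y := toSt.obj N)
    (X' := toSt.obj M') e (toSt.mapIso (swap N M) ≪≫ e) (toSt.map ι) (toSt.map f') (by
      rw [← hf, ← h, Functor.map_comp]
      rfl)
  -- ι followed by r is idempotent only stably. Some positive power of a lift ε is idempotent on the
  -- nose, since End M' is finite, and it still represents the same stable idempotent; its image is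
  -- K.
  obtain ⟨(ε : End M'), hε⟩ := toSt.map_surjective (toSt.map ι ≫ r)
  have : Finite (End M') := inferInstanceAs (Finite (M' ⟶ M'))
  obtain ⟨n, hn, hn'⟩ := exists_isIdempotentElem_pow ε
  obtain ⟨K, k, p, hK, hk, hp⟩ := exists_splitting (ε ^ n) hn'
  have hid : IsIdempotentElem (Functor.mapEnd M' toSt ε) := by
    change toSt.map ε ≫ toSt.map ε = toSt.map ε
    rw [hε, Category.assoc, reassoc_of% hr]
  have hpk : toSt.map p ≫ toSt.map k = toSt.map ι ≫ r := by
    rw [← Functor.map_comp, hp, toSt_map_pow, hid.pow_eq hn, ← hε]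
    rfl
  refine ⟨K, hK, ⟨⟨toSt.map k ≫ toSt.map ι, r ≫ toSt.map p, ?_, ?_⟩⟩⟩
  · have e1 : toSt.map k ≫ toSt.map p = 𝟙 _ := by
      rw [← Functor.map_comp, hk, CategoryTheory.Functor.map_id]
    simp only [Category.assoc]
    rw [← Category.assoc (toSt.map ι), ← hpk, Category.assoc, e1, Category.comp_id, e1]
  · rw [Category.assoc, reassoc_of% hpk, hr, Category.comp_id, hr]

end GrMod

/-! ### Retracts of invertible modules -/

/-- Tensoring with an object which has an inverse is faithful. -/
theorem eq_of_whiskerRight_eq {C : Type*} [Category C] [MonoidalCategory C] {Y Y' : C}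
    (e : Y ⊗ Y' ≅ 𝟙_ C) {X Z : C} {a b : X ⟶ Z} (h : a ▷ Y = b ▷ Y) : a = b := by
  have h1 : a ▷ (Y ⊗ Y') = b ▷ (Y ⊗ Y') := by
    rw [whiskerRight_tensor, whiskerRight_tensor, h]
  have h2 : a ▷ 𝟙_ C = b ▷ 𝟙_ C := by
    rw [← cancel_epi (X ◁ e.hom), whisker_exchange, whisker_exchange, h1]
  simpa using h2

namespace GrMod

theorem unit_hom_eq_zero_or (f : unit ⟶ unit) : f = 0 ∨ f = 𝟙 unit := by
  have hz : ∀ z : 𝔽, z = 0 ∨ z = 1 := by decide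
  exact (hz (f.toLin (1 : 𝔽))).imp (fun h => hom_ext (LinearMap.ext_ring h))
    fun h => hom_ext (LinearMap.ext_ring h)

theorem zero_whiskerRight (M N P : GrMod) : (0 : M ⟶ N) ▷ P = 0 :=
  hom_ext (TensorProduct.ext' fun _ _ => TensorProduct.zero_tmul _ _)

/-- If the unit is a retract of an invertible module, then the two are isomorphic. -/
theorem comp_eq_id_of_retract {Z N : GrMod} (e : toSt.obj (tensor Z N) ≅ toSt.obj unit)
    (f : toSt.obj unit ⟶ toSt.obj Z) (g : toSt.obj Z ⟶ toSt.obj unit) (h : f ≫ g = 𝟙 _) :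
    g ≫ f = 𝟙 _ := by
  have e' : toSt.obj (tensor N Z) ≅ toSt.obj unit := toSt.mapIso (swap N Z) ≪≫ e
  obtain ⟨E, hE⟩ := toSt.map_surjective (g ≫ f)
  obtain ⟨u, hu⟩ := toSt.map_surjective (e.inv ≫ toSt.map (E ▷ N) ≫ e.hom)
  have hu' : toSt.map (E ▷ N) = e.hom ≫ toSt.map u ≫ e.inv := by simp [hu]
  -- Tensoring with N is faithful and turns stable endomorphisms of Z into stable endomorphisms of
  -- the unit, of which only 0 and 1 exist.
  have key : ∀ E' : Z ⟶ Z, toSt.map (E ▷ N) = toSt.map (E' ▷ N) → g ≫ f = toSt.map E' :=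
    fun E' h => hE ▸ eq_of_whiskerRight_eq (C := St) (Y := toSt.obj N) (Y' := toSt.obj Z) e' h
  obtain rfl | rfl := unit_hom_eq_zero_or u
  · obtain ⟨a, ha⟩ := toSt.map_surjective e.hom
    obtain ⟨b, hb⟩ := toSt.map_surjective e.inv
    obtain ⟨f', rfl⟩ := toSt.map_surjective f
    obtain ⟨g', rfl⟩ := toSt.map_surjective g
    have h0 := key 0 (by
      rw [hu', ← ha, ← hb, ← Functor.map_comp, ← Functor.map_comp, zero_whiskerRight]
      simp)
    -- If the idempotent were zero, then 1 = (fg)(fg) = f(gf)g would vanish on the unit, whose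
    -- homology is not zero.
    have h1 : toSt.map (𝟙 unit) = toSt.map (0 : unit ⟶ unit) := by
      calc toSt.map (𝟙 unit) = (toSt.map f' ≫ toSt.map g') ≫ toSt.map f' ≫ toSt.map g' := by
            rw [h, Category.comp_id]
            exact CategoryTheory.Functor.map_id _ _
        _ = toSt.map f' ≫ (toSt.map g' ≫ toSt.map f') ≫ toSt.map g' := by
            simp only [Category.assoc]
        _ = toSt.map (f' ≫ 0 ≫ g') := by rw [h0, Functor.map_comp, Functor.map_comp]
        _ = toSt.map 0 := by simp
    have h2 := isMargolis_sq1.unit_hom_eq h1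
    exact absurd (LinearMap.congr_fun (congrArg Hom.toLin h2) (1 : 𝔽)) (one_ne_zero (α := 𝔽))
  · refine (key (𝟙 Z) ?_).trans (CategoryTheory.Functor.map_id _ _)
    rw [hu', CategoryTheory.Functor.map_id, Category.id_comp, e.hom_inv_id, id_whiskerRight,
      CategoryTheory.Functor.map_id]
    rfl

/-! ### Schanuel's lemma -/

theorem exists_lift {X Y P : GrMod} (i : X ⟶ P) (hi : Function.Injective i.toLin) (h : Y ⟶ P)
    (hh : ∀ y, h.toLin y ∈ LinearMap.range i.toLin) : ∃ h' : Y ⟶ X, h' ≫ i = h := by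
  let l : Y.V →ₗ[𝔽] X.V := (LinearEquiv.ofInjective i.toLin hi).symm.toLinearMap ∘ₗ
    h.toLin.codRestrict _ hh
  have hl : ∀ y, i.toLin (l y) = h.toLin y := fun y => by
    have := (LinearEquiv.ofInjective i.toLin hi).apply_symm_apply (h.toLin.codRestrict _ hh y)
    exact congrArg Subtype.val this
  refine ⟨⟨l, fun a y => hi ?_, fun n y hy => mem_gr_of_injective i hi ?_⟩,
    hom_ext (LinearMap.ext hl)⟩
  · rw [hl, h.map_act, i.map_act, hl]
  · rw [hl]
    exact h.map_mem n y hy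

/-- The difference between the induced endomorphism of P and the identity has values in ker p = X.
It gives k : P → X, and the difference fg - 1 on X is ik, which factors through P. -/
theorem toSt_map_comp_eq_id {X P Q X' P' : GrMod} (i : X ⟶ P) (p : P ⟶ Q)
    (hi : Function.Injective i.toLin) (hip : Function.Exact i.toLin p.toLin) (hP : Projective P)
    {i' : X' ⟶ P'} {f : X ⟶ X'} {g : X' ⟶ X} {f' : P ⟶ P'} {g' : P' ⟶ P}
    (hf : f ≫ i' = i ≫ f') (hg : g ≫ i = i' ≫ g') (h : (f' ≫ g') ≫ p = p) :
    toSt.map f ≫ toSt.map g = 𝟙 _ := by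
  obtain ⟨k, hk⟩ := exists_lift i hi (f' ≫ g' - 𝟙 P) fun y => (hip _).1 (by
    have e := LinearMap.congr_fun (congrArg Hom.toLin h) y
    have e' : p.toLin ((f' ≫ g').toLin y) = p.toLin y := e
    rw [sub_toLin, LinearMap.sub_apply, map_sub, e', id_toLin, LinearMap.id_apply, sub_self])
  rw [← Functor.map_comp, ← CategoryTheory.Functor.map_id]
  refine CategoryTheory.Quotient.sound _ ⟨P, i, k, hP, hom_ext (LinearMap.ext fun x => hi ?_)⟩
  have e : (f ≫ g - 𝟙 X) ≫ i = (i ≫ k) ≫ i := by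
    rw [Category.assoc, hk, Preadditive.sub_comp, Preadditive.comp_sub, Category.assoc, hg,
      reassoc_of% hf, Category.id_comp, Category.comp_id]
  exact LinearMap.congr_fun (congrArg Hom.toLin e) x

/-- Projectivity lifts each cover of Q through the other. The lifts restrict to the kernels, and
there they are mutually inverse stably by the preceding lemma. -/
theorem schanuel {X P Q X' P' : GrMod} (i : X ⟶ P) (p : P ⟶ Q) (i' : X' ⟶ P') (p' : P' ⟶ Q)
    (hi : Function.Injective i.toLin) (hi' : Function.Injective i'.toLin)
    (hip : Function.Exact i.toLin p.toLin) (hip' : Function.Exact i'.toLin p'.toLin)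
    (hp : Function.Surjective p.toLin) (hp' : Function.Surjective p'.toLin)
    (hP : Projective P) (hP' : Projective P') : Nonempty (toSt.obj X ≅ toSt.obj X') := by
  have : Epi p := epi_of_surjective p hp
  have : Epi p' := epi_of_surjective p' hp'
  obtain ⟨f', hf'⟩ := hP.factors p p'
  obtain ⟨g', hg'⟩ := hP'.factors p' p
  obtain ⟨f, hf⟩ := exists_lift i' hi' (i ≫ f') fun y => (hip' _).1 (by
    have e := LinearMap.congr_fun (congrArg Hom.toLin hf') (i.toLin y)
    exact e.trans (hip.apply_apply_eq_zero y))
  obtain ⟨g, hg⟩ := exists_lift i hi (i' ≫ g') fun y => (hip _).1 (by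
    have e := LinearMap.congr_fun (congrArg Hom.toLin hg') (i'.toLin y)
    exact e.trans (hip'.apply_apply_eq_zero y))
  exact ⟨⟨toSt.map f, toSt.map g,
    toSt_map_comp_eq_id i p hi hip hP hf hg (by rw [Category.assoc, hg', hf']),
    toSt_map_comp_eq_id i' p' hi' hip' hP' hg hf (by rw [Category.assoc, hf', hg'])⟩⟩

/-- If a split monomorphism has a projective cokernel, then it is a stable isomorphism. -/
theorem nonempty_iso_of_projective_coker {X M : GrMod} (f : X ⟶ M) (g : M ⟶ X) (h : f ≫ g = 𝟙 X)
    (hC : Projective (coker f)) : Nonempty (toSt.obj X ≅ toSt.obj M) := by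
  let π : M ⟶ coker f :=
    { toLin := (LinearMap.range f.toLin).mkQ
      map_act := fun _ _ => rfl
      map_mem := fun _ _ hx => ⟨_, hx, rfl⟩ }
  have hk : LinearMap.range f.toLin ≤ LinearMap.ker (g ≫ f - 𝟙 M).toLin := by
    rintro _ ⟨x, rfl⟩
    have e : f ≫ (g ≫ f - 𝟙 M) = 0 := by
      rw [Preadditive.comp_sub, reassoc_of% h, Category.comp_id, sub_self]
    exact LinearMap.congr_fun (congrArg Hom.toLin e) x
  -- gf - 1 vanishes on the image of f, so it factors through the projective cokernel.
  let d : coker f ⟶ M :=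
    { toLin := (LinearMap.range f.toLin).liftQ _ hk
      map_act := fun a x => by
        obtain ⟨x, rfl⟩ := (LinearMap.range f.toLin).mkQ_surjective x
        exact (g ≫ f - 𝟙 M).map_act a x
      map_mem := by
        rintro n _ ⟨x, hx, rfl⟩
        exact (g ≫ f - 𝟙 M).map_mem n x hx }
  refine ⟨⟨toSt.map f, toSt.map g, ?_, ?_⟩⟩
  · rw [← Functor.map_comp, h, CategoryTheory.Functor.map_id]
  · rw [← Functor.map_comp, ← CategoryTheory.Functor.map_id]
    exact CategoryTheory.Quotient.sound _ ⟨coker f, π, d, hC, rfl⟩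

/-! ### Shifts and the loop functor -/

/-- Shifting is tensoring with the shifted unit. -/
noncomputable def shiftIso (M : GrMod) (b : ℤ) : tensor (shift unit b) M ≅ shift M b :=
  isoOfEquiv
    { toLin := (TensorProduct.lid 𝔽 M.V).toLinearMap
      map_act := (leftUnit M).hom.map_act
      map_mem := fun n => map_mem_of_tmul (gr := fun n => unitGr (n - b)) (gr' := M.gr)
        (S := M.gr (n - b)) _ fun i j x y hn hx hy => by
          rw [unitGr] at hx
          split_ifs at hx with h
          · have : j = n - b := by lia
            exact Submodule.smul_mem _ _ (this ▸ hy)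
          · rw [Submodule.mem_bot] at hx
            simp [hx] }
    (TensorProduct.lid 𝔽 M.V) rfl

/-- Shifting by zero does nothing. -/
noncomputable def shiftZeroIso (M : GrMod) : shift M 0 ≅ M :=
  isoOfEquiv ⟨LinearMap.id, fun _ _ => rfl, fun n _ hx => M.mem_gr_congr (sub_zero n) hx⟩
    (LinearEquiv.refl 𝔽 M.V) rfl

/-- Shifts compose additively. -/
noncomputable def shiftAddIso (M : GrMod) (a b : ℤ) : shift M (a + b) ≅ shift (shift M b) a :=
  isoOfEquiv ⟨LinearMap.id, fun _ _ => rfl, fun n x hx => M.mem_gr_congr (by ring) hx⟩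
    (LinearEquiv.refl 𝔽 M.V) rfl

theorem projective_freeMod (W : GrMod) : Projective (freeMod W) :=
  Projective.of_iso (rightUnit (freeMod W)) (projective_free_tensor W unit)

theorem projective_regular : Projective regular :=
  Projective.of_iso (rightUnit regular) (projective_freeMod unit)

theorem projective_shift (P : GrMod) (hP : Projective P) (b : ℤ) : Projective (shift P b) :=
  Projective.of_iso (shiftIso P b) (projective_tensor_left _ P hP)

theorem augmentation_surjective : Function.Surjective augmentation.toLin := fun x =>
  ⟨algebraMap 𝔽 A1 x, A1.counitHom.commutes x⟩

/-- `Ω` and `Ω⁻¹` are mutually inverse. -/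
theorem nonempty_iso_ker_tensor_coker (hT : A1.sq2 * A1.sq2 * A1.sq2 ≠ 0) :
    Nonempty (toSt.obj (tensor (ker augmentation) (coker topClass)) ≅ toSt.obj unit) := by
  let Q := coker topClass
  let ι : ker augmentation ⟶ regular :=
    ⟨(LinearMap.ker augmentation.toLin).subtype, fun _ _ => rfl, fun _ _ h => h⟩
  let π : shift regular (-6) ⟶ Q :=
    ⟨(LinearMap.range topClass.toLin).mkQ, fun _ _ => rfl, fun _ _ hx => ⟨_, hx, rfl⟩⟩
  have h1 : Function.Exact (tensorMap ι (𝟙 Q)).toLin (tensorMap augmentation (𝟙 Q)).toLin :=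
    rTensor_exact Q.V (f := (LinearMap.ker augmentation.toLin).subtype) (g := augmentation.toLin)
      (LinearMap.exact_subtype_ker_map _) augmentation_surjective
  -- Both modules are kernels of projective covers of the same Q: the augmentation sequence tensored
  -- with Q, and the sequence that defines Q as the cokernel of the top class.
  refine schanuel (tensorMap ι (𝟙 Q)) (tensorMap augmentation (𝟙 Q) ≫ (leftUnit Q).hom)
    topClass π ?_ ?_ ?_ ?_ ?_ ?_ (projective_tensor_right _ _ projective_regular)
    (projective_shift _ projective_regular _)
  · exact Module.Flat.rTensor_preserves_injective_linearMap
      (LinearMap.ker augmentation.toLin).subtype Subtype.val_injective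
  · exact LinearMap.ker_eq_bot.1 (LinearMap.ker_toSpanSingleton 𝔽 hT)
  · intro y
    refine Iff.trans ?_ (h1 y)
    exact (TensorProduct.lid 𝔽 Q.V).map_eq_zero_iff
  · exact LinearMap.exact_map_mkQ_range topClass.toLin
  · exact (TensorProduct.lid 𝔽 Q.V).surjective.comp
      (LinearMap.rTensor_surjective Q.V augmentation_surjective)
  · exact (LinearMap.range topClass.toLin).mkQ_surjective

end GrMod

namespace GrMod

/-! ### The square of the joker -/

/-- The basis of the joker. -/
noncomputable def jokerBasis (i : Fin 5) : Fin 5 → 𝔽 := Pi.single i 1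

/-- The basis of the square of the joker. -/
noncomputable def jokerSqBasis (i j : Fin 5) : (Fin 5 → 𝔽) ⊗[𝔽] (Fin 5 → 𝔽) :=
  jokerBasis i ⊗ₜ jokerBasis j

/-- The action on the square of the joker. -/
noncomputable def jokerSqAct :
    A1 →ₐ[𝔽] Module.End 𝔽 ((Fin 5 → 𝔽) ⊗[𝔽] (Fin 5 → 𝔽)) :=
  tensorAct joker.ρ joker.ρ

theorem jokerSqAct_sq1 (x y : Fin 5 → 𝔽) : jokerSqAct A1.sq1 (x ⊗ₜ y) =
    (![0, x 0, 0, 0, x 3] : Fin 5 → 𝔽) ⊗ₜ y + x ⊗ₜ ![0, y 0, 0, 0, y 3] := by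
  rw [← joker_sq1, ← joker_sq1]
  exact tensorAct_sq1 joker.ρ joker.ρ x y

theorem jokerSqAct_sq2 (x y : Fin 5 → 𝔽) : jokerSqAct A1.sq2 (x ⊗ₜ y) =
    (![0, 0, x 0, x 1, x 2] : Fin 5 → 𝔽) ⊗ₜ y +
      (![0, x 0, 0, 0, x 3] : Fin 5 → 𝔽) ⊗ₜ ![0, y 0, 0, 0, y 3] +
      x ⊗ₜ ![0, 0, y 0, y 1, y 2] := by
  rw [← joker_sq1, ← joker_sq1, ← joker_sq2, ← joker_sq2]
  exact tensorAct_sq2 joker.ρ joker.ρ x y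

/-- `Sq¹` on the basis of the joker, where `none` stands for zero. -/
def sq1Index : Fin 5 → Option (Fin 5) := ![some 1, none, none, some 4, none]

/-- `Sq²` on the basis of the joker, where `none` stands for zero. -/
def sq2Index : Fin 5 → Option (Fin 5) := ![some 2, some 3, some 4, none, none]

/-- The basis of the square of the joker, extended by zero. -/
noncomputable def jokerSqBasis' (i j : Option (Fin 5)) : (Fin 5 → 𝔽) ⊗[𝔽] (Fin 5 → 𝔽) :=
  (i.elim 0 jokerBasis) ⊗ₜ (j.elim 0 jokerBasis)

theorem jokerBasis_sq1 (i : Fin 5) : (![0, jokerBasis i 0, 0, 0, jokerBasis i 3] : Fin 5 → 𝔽) =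
    (sq1Index i).elim 0 jokerBasis := by
  fin_cases i <;> ext j <;> fin_cases j <;> simp [jokerBasis, sq1Index]

theorem jokerBasis_sq2 (i : Fin 5) :
    (![0, 0, jokerBasis i 0, jokerBasis i 1, jokerBasis i 2] : Fin 5 → 𝔽) =
      (sq2Index i).elim 0 jokerBasis := by
  fin_cases i <;> ext j <;> fin_cases j <;> simp [jokerBasis, sq2Index]

theorem jokerSqAct_sq1_basis (i j : Fin 5) : jokerSqAct A1.sq1 (jokerSqBasis i j) =
    jokerSqBasis' (sq1Index i) (some j) + jokerSqBasis' (some i) (sq1Index j) := by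
  rw [jokerSqBasis, jokerSqAct_sq1, jokerBasis_sq1, jokerBasis_sq1]
  rfl

theorem jokerSqAct_sq2_basis (i j : Fin 5) : jokerSqAct A1.sq2 (jokerSqBasis i j) =
    jokerSqBasis' (sq2Index i) (some j) + jokerSqBasis' (sq1Index i) (sq1Index j) +
      jokerSqBasis' (some i) (sq2Index j) := by
  rw [jokerSqBasis, jokerSqAct_sq2, jokerBasis_sq1, jokerBasis_sq1, jokerBasis_sq2, jokerBasis_sq2]
  rfl

@[simp] theorem jokerSqBasis'_some (i j : Fin 5) :
    jokerSqBasis' (some i) (some j) = jokerSqBasis i j := rfl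

@[simp] theorem jokerSqBasis'_none_left (j : Option (Fin 5)) : jokerSqBasis' none j = 0 :=
  TensorProduct.zero_tmul _ _

@[simp] theorem jokerSqBasis'_none_right (i : Option (Fin 5)) : jokerSqBasis' i none = 0 :=
  TensorProduct.tmul_zero _ _

/-- It acts non-trivially on J ⊗ J: `(Sq²)³` sends e₀ ⊗ e₀ to e₄ ⊗ e₂ + e₂ ⊗ e₄. -/
theorem A1_top_ne_zero : A1.sq2 * A1.sq2 * A1.sq2 ≠ 0 := by
  intro h
  have e : jokerSqAct (A1.sq2 * A1.sq2 * A1.sq2) (jokerSqBasis 0 0) = 0 := by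
    rw [h, map_zero, LinearMap.zero_apply]
  have ch := ZModModule.add_self (jokerSqBasis 3 3)
  simp [map_mul, jokerSqAct_sq2_basis, sq1Index, sq2Index] at e
  have e' := congrArg (LinearMap.mul' 𝔽 𝔽 ∘ₗ
    TensorProduct.map (LinearMap.proj (R := 𝔽) (φ := fun _ : Fin 5 => 𝔽) 4)
      (LinearMap.proj (R := 𝔽) (φ := fun _ : Fin 5 => 𝔽) 2)) e
  simp [jokerSqBasis, jokerBasis] at e'
  exact absurd e' (by decide)

/-- The bilinear form on the joker pairing dual basis vectors. -/
noncomputable def jokerForm : (Fin 5 → 𝔽) →ₗ[𝔽] (Fin 5 → 𝔽) →ₗ[𝔽] 𝔽 :=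
  LinearMap.mk₂ 𝔽 (fun x y => x 0 * y 4 + x 1 * y 3 + x 2 * y 2 + x 3 * y 1 + x 4 * y 0)
    (fun x x' y => by simp; ring) (fun r x y => by simp; ring)
    (fun x y y' => by simp; ring) (fun r x y => by simp; ring)

theorem jokerForm_apply (x y : Fin 5 → 𝔽) :
    jokerForm x y = x 0 * y 4 + x 1 * y 3 + x 2 * y 2 + x 3 * y 1 + x 4 * y 0 := rfl

/-- The evaluation of the self-dual joker. -/
noncomputable def jokerEval : tensor joker joker ⟶ unit where
  toLin := TensorProduct.lift jokerForm
  map_act := map_act_of_gen (ρ := jokerSqAct) (σ := unitAct) (TensorProduct.lift jokerForm)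
    fun i t => by
      have ch := fun z : 𝔽 => ZModModule.add_self z
      rw [unitAct_gen, LinearMap.zero_apply]
      induction t with
      | zero => simp
      | add x y hx hy => rw [map_add, map_add, hx, hy, add_zero]
      | tmul x y =>
        fin_cases i
        · change TensorProduct.lift jokerForm (jokerSqAct A1.sq1 (x ⊗ₜ y)) = 0
          rw [jokerSqAct_sq1, map_add, TensorProduct.lift.tmul, TensorProduct.lift.tmul,
            jokerForm_apply, jokerForm_apply]
          refine Eq.trans ?_ (ch (x 0 * y 3 + x 3 * y 0))
          simp
        · change TensorProduct.lift jokerForm (jokerSqAct A1.sq2 (x ⊗ₜ y)) = 0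
          rw [jokerSqAct_sq2, map_add, map_add, TensorProduct.lift.tmul, TensorProduct.lift.tmul,
            TensorProduct.lift.tmul, jokerForm_apply, jokerForm_apply, jokerForm_apply]
          refine Eq.trans ?_ (ch (x 0 * y 2 + x 1 * y 1 + x 2 * y 0))
          simp
  map_mem n := map_mem_of_tmul (gr := jokerGr) (gr' := jokerGr) (S := unitGr n)
    (TensorProduct.lift jokerForm) fun i j x y hn hx hy => by
      rw [unitGr]
      split_ifs with h
      · trivial
      · rw [Submodule.mem_bot, TensorProduct.lift.tmul, jokerForm_apply]
        have key : ∀ k l : Fin 5, (k : ℤ) + l = 4 → x k * y l = 0 := by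
          intro k l hkl
          by_cases hk : (k : ℤ) - 2 = i
          · rw [hy l (by lia), mul_zero]
          · rw [hx k hk, zero_mul]
        rw [key 0 4 (by norm_num), key 1 3 (by norm_num), key 2 2 (by norm_num),
          key 3 1 (by norm_num), key 4 0 (by norm_num)]
        simp

/-- The element of the square of the joker which corresponds to the identity. -/
noncomputable def jokerCasimir : (Fin 5 → 𝔽) ⊗[𝔽] (Fin 5 → 𝔽) :=
  jokerSqBasis 0 4 + jokerSqBasis 1 3 + jokerSqBasis 2 2 + jokerSqBasis 3 1 + jokerSqBasis 4 0

theorem jokerBasis_mem (i : Fin 5) : jokerBasis i ∈ jokerGr ((i : ℤ) - 2) := fun j hj => by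
  rw [jokerBasis, Pi.single_eq_of_ne]
  rintro rfl
  exact hj rfl

theorem jokerSqBasis_mem (i j : Fin 5) {n : ℤ} (h : (i : ℤ) + j - 4 = n) :
    jokerSqBasis i j ∈ tensorGr jokerGr jokerGr n :=
  tmul_mem (jokerBasis_mem i) (jokerBasis_mem j) (by lia)

theorem jokerCasimir_sq1 : jokerSqAct A1.sq1 jokerCasimir = 0 := by
  have ch := fun t : (Fin 5 → 𝔽) ⊗[𝔽] (Fin 5 → 𝔽) => ZModModule.add_self t
  simp only [jokerCasimir, map_add, jokerSqAct_sq1_basis]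
  simp [sq1Index]
  abel_nf
  simp only [two_zsmul, ch]

theorem jokerCasimir_sq2 : jokerSqAct A1.sq2 jokerCasimir = 0 := by
  have ch := fun t : (Fin 5 → 𝔽) ⊗[𝔽] (Fin 5 → 𝔽) => ZModModule.add_self t
  simp only [jokerCasimir, map_add, jokerSqAct_sq2_basis]
  simp [sq1Index, sq2Index]
  abel_nf
  simp only [two_zsmul, ch]

/-- The coevaluation of the self-dual joker. -/
noncomputable def jokerCoeval : unit ⟶ tensor joker joker :=
  homOfUnit (M := tensor joker joker) jokerCasimir
    (add_mem (add_mem (add_mem (add_mem (jokerSqBasis_mem 0 4 (by norm_num))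
      (jokerSqBasis_mem 1 3 (by norm_num))) (jokerSqBasis_mem 2 2 (by norm_num)))
      (jokerSqBasis_mem 3 1 (by norm_num))) (jokerSqBasis_mem 4 0 (by norm_num)))
    jokerCasimir_sq1 jokerCasimir_sq2

/-- The value is the dimension 5 of the joker, which is odd; this is what splits the unit off the
square. -/
theorem jokerEval_casimir : TensorProduct.lift jokerForm jokerCasimir = 1 := by
  simp [jokerCasimir, jokerSqBasis, jokerForm_apply, jokerBasis]
  decide

theorem jokerCoeval_comp_jokerEval : jokerCoeval ≫ jokerEval = 𝟙 unit := by
  refine hom_ext (LinearMap.ext_ring ?_)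
  change TensorProduct.lift jokerForm ((1 : 𝔽) • jokerCasimir) = 1
  rw [one_smul, jokerEval_casimir]

/-- The square of the joker is generated by `e₀ ⊗ e₀`, `e₀ ⊗ e₁`, `e₀ ⊗ e₂` and the invariant
element. -/
theorem jokerSq_eq_top {R : Submodule 𝔽 ((Fin 5 → 𝔽) ⊗[𝔽] (Fin 5 → 𝔽))}
    (h1 : ∀ t ∈ R, jokerSqAct A1.sq1 t ∈ R) (h2 : ∀ t ∈ R, jokerSqAct A1.sq2 t ∈ R)
    (hc : jokerCasimir ∈ R) (h00 : jokerSqBasis 0 0 ∈ R) (h01 : jokerSqBasis 0 1 ∈ R)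
    (h02 : jokerSqBasis 0 2 ∈ R) : R = ⊤ := by
  have s1 : ∀ i j, jokerSqBasis i j ∈ R →
      jokerSqBasis' (sq1Index i) (some j) + jokerSqBasis' (some i) (sq1Index j) ∈ R :=
    fun i j h => jokerSqAct_sq1_basis i j ▸ h1 _ h
  have s2 : ∀ i j, jokerSqBasis i j ∈ R →
      jokerSqBasis' (sq2Index i) (some j) + jokerSqBasis' (sq1Index i) (sq1Index j) +
        jokerSqBasis' (some i) (sq2Index j) ∈ R :=
    fun i j h => jokerSqAct_sq2_basis i j ▸ h2 _ h
  have h11 : jokerSqBasis 1 1 ∈ R := by simpa [sq1Index] using s1 0 1 h01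
  have h10 : jokerSqBasis 1 0 ∈ R := by
    have := s1 0 0 h00
    simp only [sq1Index, Matrix.cons_val_zero, jokerSqBasis'_some] at this
    exact (R.add_mem_iff_left h01).1 this
  have h12 : jokerSqBasis 1 2 ∈ R := by simpa [sq1Index] using s1 0 2 h02
  have h20 : jokerSqBasis 2 0 ∈ R := by
    have := s2 0 0 h00
    simp only [sq1Index, sq2Index, Matrix.cons_val_zero, jokerSqBasis'_some] at this
    exact (R.add_mem_iff_left h11).1 ((R.add_mem_iff_left h02).1 this)
  have h21 : jokerSqBasis 2 1 ∈ R := by simpa [sq1Index] using s1 2 0 h20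
  have h03 : jokerSqBasis 0 3 ∈ R := by
    have := s2 0 1 h01
    simp [sq1Index, sq2Index] at this
    exact (R.add_mem_iff_right h21).1 this
  have h30 : jokerSqBasis 3 0 ∈ R := by
    have := s2 1 0 h10
    simp [sq1Index, sq2Index] at this
    exact (R.add_mem_iff_left h12).1 this
  -- In degree 0 the generators reach only sums of two basis vectors. The invariant element has five
  -- terms, so it supplies the missing direction.
  have a1 : jokerSqBasis 1 3 + jokerSqBasis 0 4 ∈ R := by simpa [sq1Index] using s1 0 3 h03
  have a2 : jokerSqBasis 3 1 + jokerSqBasis 1 3 ∈ R := by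
    simpa [sq1Index, sq2Index] using s2 1 1 h11
  have a3 : jokerSqBasis 2 2 + jokerSqBasis 0 4 ∈ R := by
    simpa [sq1Index, sq2Index] using s2 0 2 h02
  have a4 : jokerSqBasis 4 0 + jokerSqBasis 2 2 ∈ R := by
    simpa [sq1Index, sq2Index] using s2 2 0 h20
  have h31 : jokerSqBasis 3 1 ∈ R := by
    have e1 := add_mem a1 a4
    have e2 : jokerCasimir = jokerSqBasis 1 3 + jokerSqBasis 0 4 +
      (jokerSqBasis 4 0 + jokerSqBasis 2 2) + jokerSqBasis 3 1 := by
        rw [jokerCasimir]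
        abel
    rw [e2] at hc
    exact (R.add_mem_iff_right e1).1 hc
  have h13 : jokerSqBasis 1 3 ∈ R := (R.add_mem_iff_right h31).1 a2
  have h04 : jokerSqBasis 0 4 ∈ R := (R.add_mem_iff_right h13).1 a1
  have h22 : jokerSqBasis 2 2 ∈ R := (R.add_mem_iff_left h04).1 a3
  have h40 : jokerSqBasis 4 0 ∈ R := (R.add_mem_iff_left h22).1 a4
  have h14 : jokerSqBasis 1 4 ∈ R := by simpa [sq1Index] using s1 0 4 h04
  have h41 : jokerSqBasis 4 1 ∈ R := by simpa [sq1Index] using s1 4 0 h40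
  have h32 : jokerSqBasis 3 2 ∈ R := by
    have := s2 1 2 h12
    simp [sq1Index, sq2Index] at this
    exact (R.add_mem_iff_left h14).1 this
  have h23 : jokerSqBasis 2 3 ∈ R := by
    have := s2 2 1 h21
    simp [sq1Index, sq2Index] at this
    exact (R.add_mem_iff_right h41).1 this
  have h24 : jokerSqBasis 2 4 ∈ R := by simpa [sq1Index, sq2Index] using s2 0 4 h04
  have h42 : jokerSqBasis 4 2 ∈ R := by simpa [sq1Index, sq2Index] using s2 4 0 h40
  have h33 : jokerSqBasis 3 3 ∈ R := by simpa [sq1Index, sq2Index] using s2 3 1 h31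
  have h34 : jokerSqBasis 3 4 ∈ R := by simpa [sq1Index, sq2Index] using s2 1 4 h14
  have h43 : jokerSqBasis 4 3 ∈ R := by simpa [sq1Index, sq2Index] using s2 4 1 h41
  have h44 : jokerSqBasis 4 4 ∈ R := by simpa [sq1Index, sq2Index] using s2 2 4 h24
  have hall : ∀ i j, jokerSqBasis i j ∈ R := by
    intro i j
    fin_cases i <;> fin_cases j <;> assumption
  rw [eq_top_iff, ← ((Pi.basisFun 𝔽 (Fin 5)).tensorProduct (Pi.basisFun 𝔽 (Fin 5))).span_eq,
    Submodule.span_le]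
  rintro _ ⟨⟨i, j⟩, rfl⟩
  rw [Module.Basis.tensorProduct_apply, Pi.basisFun_apply, Pi.basisFun_apply]
  exact hall i j

/-- The graded vector space spanned by the generators of the free part of the square of the
joker, with the trivial action. -/
noncomputable def jokerSqGens : GrMod where
  V := Fin 3 → 𝔽
  ρ := trivAct (Fin 3 → 𝔽)
  gr := basisGr ![-4, -3, -2]
  isInternal := basisGr_isInternal _
  act_mem := act_mem_of_gen (by intros; simp) (by intros; simp)

/-- The inclusion of the generators, as linear map. -/
noncomputable def jokerSqGensLin : (Fin 3 → 𝔽) →ₗ[𝔽] (Fin 5 → 𝔽) ⊗[𝔽] (Fin 5 → 𝔽) :=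
  Fintype.linearCombination 𝔽 ![jokerSqBasis 0 0, jokerSqBasis 0 1, jokerSqBasis 0 2]

theorem jokerSqGensLin_single (i : Fin 3) : jokerSqGensLin (Pi.single i 1) =
    ![jokerSqBasis 0 0, jokerSqBasis 0 1, jokerSqBasis 0 2] i := by
  rw [jokerSqGensLin, Fintype.linearCombination_apply_single, one_smul]

/-- The inclusion of the generators, as a morphism of graded vector spaces. -/
noncomputable def jokerSqGensMap : triv jokerSqGens ⟶ triv (tensor joker joker) where
  toLin := jokerSqGensLin
  map_act := map_act_of_gen (ρ := trivAct (Fin 3 → 𝔽))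
    (σ := trivAct ((Fin 5 → 𝔽) ⊗[𝔽] (Fin 5 → 𝔽))) jokerSqGensLin (by simp)
  map_mem n := fun (x : Fin 3 → 𝔽) hx => by
    have hx' : x ∈ basisGr ![-4, -3, -2] n := hx
    change jokerSqGensLin x ∈ tensorGr jokerGr jokerGr n
    rw [jokerSqGensLin, Fintype.linearCombination_apply]
    refine sum_mem fun i _ => ?_
    by_cases hi : (![-4, -3, -2] : Fin 3 → ℤ) i = n
    · refine Submodule.smul_mem _ _ ?_
      subst hi
      fin_cases i
      · exact jokerSqBasis_mem 0 0 (by simp)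
      · exact jokerSqBasis_mem 0 1 (by simp)
      · exact jokerSqBasis_mem 0 2 (by simp)
    · rw [hx' i hi, zero_smul]
      exact zero_mem _

/-- The map from the free module on the generators to the square of the joker. -/
noncomputable def jokerSqCover : freeMod jokerSqGens ⟶ tensor joker joker :=
  tensorMap (𝟙 regular) jokerSqGensMap ≫ freeMap (tensor joker joker)

theorem jokerSqCover_gen (i : Fin 3) :
    jokerSqCover.toLin ((1 : A1) ⊗ₜ[𝔽] (Pi.single i 1 : Fin 3 → 𝔽) : A1 ⊗[𝔽] (Fin 3 → 𝔽)) =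
      ![jokerSqBasis 0 0, jokerSqBasis 0 1, jokerSqBasis 0 2] i := by
  rw [← jokerSqGensLin_single]
  exact LinearMap.congr_fun (map_one jokerSqAct) _

theorem range_jokerSqCover_sup :
    (LinearMap.range jokerSqCover.toLin ⊔ LinearMap.range jokerCoeval.toLin :
      Submodule 𝔽 ((Fin 5 → 𝔽) ⊗[𝔽] (Fin 5 → 𝔽))) = ⊤ := by
  have key : ∀ (a : A1), ∀ t ∈ (LinearMap.range jokerSqCover.toLin ⊔
      LinearMap.range jokerCoeval.toLin : Submodule 𝔽 ((Fin 5 → 𝔽) ⊗[𝔽] (Fin 5 → 𝔽))),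
      jokerSqAct a t ∈ (LinearMap.range jokerSqCover.toLin ⊔
      LinearMap.range jokerCoeval.toLin : Submodule 𝔽 ((Fin 5 → 𝔽) ⊗[𝔽] (Fin 5 → 𝔽))) := by
    intro a t ht
    obtain ⟨_, ⟨x, rfl⟩, _, ⟨y, rfl⟩, rfl⟩ := Submodule.mem_sup.1 ht
    rw [map_add]
    exact Submodule.add_mem_sup ⟨_, jokerSqCover.map_act a x⟩ ⟨_, jokerCoeval.map_act a y⟩
  refine jokerSq_eq_top (key _) (key _) ?_ ?_ ?_ ?_
  · exact Submodule.mem_sup_right ⟨(1 : 𝔽), one_smul 𝔽 jokerCasimir⟩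
  · exact Submodule.mem_sup_left ⟨_, jokerSqCover_gen 0⟩
  · exact Submodule.mem_sup_left ⟨_, jokerSqCover_gen 1⟩
  · exact Submodule.mem_sup_left ⟨_, jokerSqCover_gen 2⟩

theorem finrank_range_jokerCoeval :
    Module.finrank 𝔽 (LinearMap.range jokerCoeval.toLin) = 1 := by
  have hi : Function.Injective (jokerCoeval.toLin : 𝔽 →ₗ[𝔽] (Fin 5 → 𝔽) ⊗[𝔽] (Fin 5 → 𝔽)) :=
    Function.LeftInverse.injective (g := jokerEval.toLin) fun x =>
      LinearMap.congr_fun (congrArg Hom.toLin jokerCoeval_comp_jokerEval) x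
  exact (LinearMap.finrank_range_of_inj hi).trans (Module.finrank_self 𝔽)

theorem finrank_coker_jokerCoeval : Module.finrank 𝔽 (coker jokerCoeval).V = 24 := by
  have h1 : Module.finrank 𝔽 (((Fin 5 → 𝔽) ⊗[𝔽] (Fin 5 → 𝔽)) ⧸
      (LinearMap.range jokerCoeval.toLin : Submodule 𝔽 ((Fin 5 → 𝔽) ⊗[𝔽] (Fin 5 → 𝔽)))) +
      Module.finrank 𝔽 (LinearMap.range jokerCoeval.toLin :
        Submodule 𝔽 ((Fin 5 → 𝔽) ⊗[𝔽] (Fin 5 → 𝔽))) = _ :=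
    Submodule.finrank_quotient_add_finrank _
  have h2 : Module.finrank 𝔽 (LinearMap.range jokerCoeval.toLin :
        Submodule 𝔽 ((Fin 5 → 𝔽) ⊗[𝔽] (Fin 5 → 𝔽))) = 1 := finrank_range_jokerCoeval
  rw [h2, Module.finrank_tensorProduct, Module.finrank_fin_fun] at h1
  exact Nat.succ.inj h1

/-- The map from the free module on the generators to the cokernel of the coevaluation. -/
noncomputable def cokerCover : freeMod jokerSqGens ⟶ coker jokerCoeval where
  toLin := (LinearMap.range jokerCoeval.toLin).mkQ ∘ₗ jokerSqCover.toLin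
  map_act a x := congrArg (LinearMap.range jokerCoeval.toLin).mkQ (jokerSqCover.map_act a x)
  map_mem n x hx := ⟨_, jokerSqCover.map_mem n x hx, rfl⟩

theorem cokerCover_surjective : Function.Surjective cokerCover.toLin := by
  have key : ∀ R S : Submodule 𝔽 ((Fin 5 → 𝔽) ⊗[𝔽] (Fin 5 → 𝔽)), R ⊔ S = ⊤ →
      ∀ y, ∃ x ∈ R, S.mkQ x = y := by
    intro R S h y
    obtain ⟨t, rfl⟩ := S.mkQ_surjective y
    obtain ⟨x, hx, z, hz, rfl⟩ := Submodule.mem_sup.1 (h ▸ Submodule.mem_top : t ∈ R ⊔ S)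
    refine ⟨x, hx, ?_⟩
    rw [map_add, Submodule.mkQ_apply _ z, (Submodule.Quotient.mk_eq_zero _).2 hz, add_zero]
  intro y
  obtain ⟨_, ⟨x, rfl⟩, hx⟩ := key _ _ range_jokerSqCover_sup y
  exact ⟨x, hx⟩

/-- Dimension count: the source has dimension at most 3·8, the target has dimension 24, and the map
is onto. -/
theorem cokerCover_injective : Function.Injective cokerCover.toLin := by
  have : FiniteDimensional 𝔽 (freeMod jokerSqGens).V :=
    inferInstanceAs (Module.Finite 𝔽 (A1 ⊗[𝔽] (Fin 3 → 𝔽)))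
  have h1 : Module.finrank 𝔽 (freeMod jokerSqGens).V ≤ 24 := by
    have : Module.finrank 𝔽 (A1 ⊗[𝔽] (Fin 3 → 𝔽)) ≤ 24 := by
      rw [Module.finrank_tensorProduct, Module.finrank_fin_fun]
      exact Nat.mul_le_mul_right 3 A1.finrank_le
    exact this
  have h2 := LinearMap.finrank_range_add_finrank_ker cokerCover.toLin
  rw [LinearMap.range_eq_top.2 cokerCover_surjective, finrank_top, finrank_coker_jokerCoeval] at h2
  rw [← LinearMap.ker_eq_bot, ← Submodule.finrank_eq_zero (R := 𝔽)]
  lia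

theorem projective_coker_jokerCoeval : Projective (coker jokerCoeval) :=
  Projective.of_iso (isoOfEquiv cokerCover (LinearEquiv.ofBijective cokerCover.toLin
    ⟨cokerCover_injective, cokerCover_surjective⟩) rfl) (projective_freeMod jokerSqGens)

/-- The joker is its own inverse in the stable category. -/
theorem nonempty_iso_joker_tensor_joker :
    Nonempty (toSt.obj unit ≅ toSt.obj (tensor joker joker)) :=
  nonempty_iso_of_projective_coker jokerCoeval jokerEval jokerCoeval_comp_jokerEval
    projective_coker_jokerCoeval

end GrMod

open GrMod

/-! ### Classes in the Picard group -/

/-- The stable isomorphism class of a module. -/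
noncomputable def stClass (M : GrMod) : Skeleton St := toSkeleton (toSt.obj M)

theorem stClass_eq_iff {M N : GrMod} :
    stClass M = stClass N ↔ Nonempty (toSt.obj M ≅ toSt.obj N) :=
  toSkeleton_eq_toSkeleton_iff

theorem stClass_eq_of_iso {M N : GrMod} (e : M ≅ N) : stClass M = stClass N :=
  stClass_eq_iff.2 ⟨toSt.mapIso e⟩

theorem stClass_tensor (M N : GrMod) : stClass (tensor M N) = stClass M * stClass N :=
  Skeleton.toSkeleton_tensorObj (toSt.obj M) (toSt.obj N)

theorem stClass_unit : stClass unit = 1 := rfl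

theorem exists_stClass_eq (p : Skeleton St) : ∃ M, stClass M = p :=
  ⟨((fromSkeleton St).obj p).as, toSkeleton_fromSkeleton_obj p⟩

theorem stClass_mul_comm (p p' : Skeleton St) : p * p' = p' * p := by
  obtain ⟨M, rfl⟩ := exists_stClass_eq p
  obtain ⟨N, rfl⟩ := exists_stClass_eq p'
  rw [← stClass_tensor, ← stClass_tensor]
  exact stClass_eq_of_iso (swap M N)

noncomputable instance : CommGroup (PicardGroup St) :=
  { (inferInstance : Group (PicardGroup St)) with
    mul_comm := fun p p' => Units.ext (stClass_mul_comm p p') }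

theorem exists_tensor_iso (p : PicardGroup St) {M : GrMod} (hM : stClass M = p) :
    ∃ N, Nonempty (toSt.obj (tensor M N) ≅ toSt.obj unit) := by
  obtain ⟨N, hN⟩ := exists_stClass_eq ((p⁻¹ : PicardGroup St) : Skeleton St)
  exact ⟨N, stClass_eq_iff.1 (by rw [stClass_tensor, hM, hN, stClass_unit, Units.mul_inv])⟩

/-- Every invertible object is the class of a finite module. -/
theorem exists_finite_stClass_eq (p : PicardGroup St) : ∃ M, Finite M.V ∧ stClass M = p := by
  obtain ⟨M, hM⟩ := exists_stClass_eq p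
  obtain ⟨N, ⟨e⟩⟩ := exists_tensor_iso p hM
  obtain ⟨K, hK, h⟩ := exists_finite_iso e
  exact ⟨K, hK, (stClass_eq_iff.2 h).trans hM⟩

/-! ### The degree of Margolis homology -/

/-- There is a module in the class `p` with a non-trivial Margolis homology class of degree `d`. -/
def HasDegree (Q : A1) (p : PicardGroup St) (d : ℤ) : Prop :=
  ∃ M, stClass M = p ∧ HasClass Q M d

namespace IsMargolis

variable {Q : A1} {q : ℤ}

theorem hasClass_of_stClass_eq (hQ : IsMargolis Q q) {M N : GrMod} (h : stClass M = stClass N)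
    {d : ℤ} (hM : HasClass Q M d) : HasClass Q N d := by
  obtain ⟨e⟩ := stClass_eq_iff.1 h
  exact hQ.hasClass_of_iso hM e

theorem exists_hasDegree (hQ : IsMargolis Q q) (p : PicardGroup St) : ∃ d, HasDegree Q p d := by
  obtain ⟨M, hM⟩ := exists_stClass_eq p
  obtain ⟨N, ⟨e⟩⟩ := exists_tensor_iso p hM
  obtain ⟨d, hd⟩ := hQ.exists_hasClass e
  exact ⟨d, M, hM, hd⟩

theorem hasDegree_unique (hQ : IsMargolis Q q) {p : PicardGroup St} {d d' : ℤ}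
    (h : HasDegree Q p d) (h' : HasDegree Q p d') : d = d' := by
  obtain ⟨M, hM, hd⟩ := h
  obtain ⟨M', hM', hd'⟩ := h'
  obtain ⟨N, ⟨e⟩⟩ := exists_tensor_iso p hM
  exact hQ.hasClass_unique e hd (hQ.hasClass_of_stClass_eq (hM'.trans hM.symm) hd')

theorem hasDegree_mul (hQ : IsMargolis Q q) {p p' : PicardGroup St} {d d' : ℤ}
    (h : HasDegree Q p d) (h' : HasDegree Q p' d') : HasDegree Q (p * p') (d + d') := by
  obtain ⟨M, hM, hd⟩ := h
  obtain ⟨M', hM', hd'⟩ := h'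
  exact ⟨tensor M M', by rw [stClass_tensor, hM, hM', Units.val_mul], hQ.hasClass_tensor hd hd'⟩

/-- The degree of the Margolis homology of invertible objects. -/
noncomputable def degree (hQ : IsMargolis Q q) : PicardGroup St →* Multiplicative ℤ :=
  MonoidHom.mk' (fun p => Multiplicative.ofAdd (hQ.exists_hasDegree p).choose) fun p p' =>
    congrArg Multiplicative.ofAdd (hQ.hasDegree_unique (hQ.exists_hasDegree (p * p')).choose_spec
      (hQ.hasDegree_mul (hQ.exists_hasDegree p).choose_spec
        (hQ.exists_hasDegree p').choose_spec))

theorem degree_eq (hQ : IsMargolis Q q) {p : PicardGroup St} {d : ℤ} {M : GrMod}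
    (hM : stClass M = p) (h : HasClass Q M d) : hQ.degree p = Multiplicative.ofAdd d :=
  congrArg Multiplicative.ofAdd
    (hQ.hasDegree_unique (hQ.exists_hasDegree p).choose_spec ⟨M, hM, h⟩)

theorem hasClass_of_degree_eq (hQ : IsMargolis Q q) {p : PicardGroup St} {d : ℤ} {M : GrMod}
    (hM : stClass M = p) (h : hQ.degree p = Multiplicative.ofAdd d) : HasClass Q M d := by
  obtain ⟨N, hN, hd⟩ := (hQ.exists_hasDegree p).choose_spec
  have e : (hQ.exists_hasDegree p).choose = d := Multiplicative.ofAdd.injective h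
  rw [e] at hd
  exact hQ.hasClass_of_stClass_eq (hN.trans hM.symm) hd

/-- Outside of its degree, the Margolis homology of an invertible object vanishes. -/
theorem homologyVanishes (hQ : IsMargolis Q q) {p : PicardGroup St} {d : ℤ} {M : GrMod}
    (hM : stClass M = p) (h : hQ.degree p = Multiplicative.ofAdd d) {n : ℤ} (hn : n ≠ d) :
    HomologyVanishes Q q M n := by
  obtain ⟨N, ⟨e⟩⟩ := exists_tensor_iso p hM
  exact fun x hx hx' => hQ.exists_mem_act_eq e (hQ.hasClass_of_degree_eq hM h) hn hx hx'

theorem hasClass_unit (hQ : IsMargolis Q q) : HasClass Q unit 0 := by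
  refine ⟨(1 : 𝔽), ?_, hQ.unit_act 1, ?_⟩
  · change (1 : 𝔽) ∈ unitGr 0
    simp [unitGr]
  · rintro ⟨x, hx⟩
    exact zero_ne_one ((hQ.unit_act x).symm.trans hx)

theorem hasClass_ker_augmentation (hQ : IsMargolis Q q) : HasClass Q (ker augmentation) q := by
  refine ⟨⟨Q, hQ.counit⟩, hQ.mem_gr, Subtype.ext hQ.mul_self, ?_⟩
  rintro ⟨⟨a, ha⟩, h⟩
  change A1 at a
  have h' : Q * a = Q := congrArg Subtype.val h
  obtain ⟨i, hi⟩ := hQ.exists_coord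
  -- If Q = Qa with ε(a) = 0, apply both sides to the bottom class of the question mark: coordinate
  -- `i` of Qe₀ is 1, whereas that of Qae₀ is ε(a) = 0.
  have h1 := hi (Pi.single 0 1)
  have h2 : questionMarkAct a (Pi.single 0 1) 0 = A1.counitHom a * (1 : 𝔽) :=
    questionMarkToUnit.map_act a (Pi.single 0 1 : Fin 3 → 𝔽)
  rw [← h', map_mul, Module.End.mul_apply, hi, h2, show A1.counitHom a = 0 from ha] at h1
  simp at h1

end IsMargolis

theorem HasClass.shift {Q : A1} {M : GrMod} {d : ℤ} (h : HasClass Q M d) (b : ℤ) :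
    HasClass Q (M.shift b) (d + b) := by
  obtain ⟨u, hu, h1, h2⟩ := h
  exact ⟨u, M.mem_gr_congr (add_sub_cancel_right d b).symm hu, h1, h2⟩

theorem joker_q1 (x : Fin 5 → 𝔽) : joker.ρ A1.q1 x = ![0, 0, 0, x 0, x 1] := by
  have e : ∀ u v : 𝔽, (![0, 0, 0, 0, u] + ![0, 0, 0, v, 0] : Fin 5 → 𝔽) = ![0, 0, 0, v, u] := by
    decide
  refine (q1_act joker x).trans ?_
  rw [joker_sq1, joker_sq2]
  exact (congrArg₂ (· + ·) (joker_sq1 _) (joker_sq2 _)).trans (e _ _)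

/-- The middle class survives for Q₀, which pairs e₀ with e₁ and e₃ with e₄. -/
theorem hasClass_sq1_joker : HasClass A1.sq1 joker 0 := by
  refine ⟨jokerBasis 2, jokerBasis_mem 2, (joker_sq1 _).trans (funext fun j => ?_), ?_⟩
  · fin_cases j <;> simp [jokerBasis] <;> rfl
  · rintro ⟨x, hx⟩
    have := congrFun ((joker_sq1 x).symm.trans hx) 2
    simp [jokerBasis] at this

/-- The middle class survives for Q₁ too, which pairs e₀ with e₃ and e₁ with e₄. The degrees
therefore do not distinguish J from 𝟙. -/
theorem hasClass_q1_joker : HasClass A1.q1 joker 0 := by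
  refine ⟨jokerBasis 2, jokerBasis_mem 2, (joker_q1 _).trans (funext fun j => ?_), ?_⟩
  · fin_cases j <;> simp [jokerBasis] <;> rfl
  · rintro ⟨x, hx⟩
    have := congrFun ((joker_q1 x).symm.trans hx) 2
    simp [jokerBasis] at this

/-! ### Generators of the Picard group -/

/-- The class of `Ω 𝟙`. -/
noncomputable def omegaUnit : PicardGroup St :=
  have h : stClass (ker augmentation) * stClass (coker topClass) = 1 := by
    rw [← stClass_tensor]
    exact stClass_eq_iff.2 (nonempty_iso_ker_tensor_coker A1_top_ne_zero)
  ⟨stClass (ker augmentation), stClass (coker topClass), h, (stClass_mul_comm _ _).trans h⟩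

theorem stClass_shift_unit_mul (a b : ℤ) :
    stClass (shift unit a) * stClass (shift unit b) = stClass (shift unit (a + b)) := by
  rw [← stClass_tensor]
  exact (stClass_eq_of_iso (shiftIso _ a)).trans (stClass_eq_of_iso (shiftAddIso unit a b)).symm

theorem stClass_shift_unit_zero : stClass (shift unit 0) = 1 :=
  stClass_eq_of_iso (shiftZeroIso unit)

/-- The class of the shift `𝟙[b]`. -/
noncomputable def shiftUnit : Multiplicative ℤ →* PicardGroup St :=
  MonoidHom.toHomUnits
    { toFun := fun b => stClass (shift unit b.toAdd)
      map_one' := stClass_shift_unit_zero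
      map_mul' := fun a b => (stClass_shift_unit_mul a.toAdd b.toAdd).symm }

theorem stClass_joker_mul_self : stClass joker * stClass joker = 1 := by
  rw [← stClass_tensor]
  exact (stClass_eq_iff.2 nonempty_iso_joker_tensor_joker).symm

/-- The class of the joker. -/
noncomputable def jokerUnit : PicardGroup St :=
  ⟨stClass joker, stClass joker, stClass_joker_mul_self, stClass_joker_mul_self⟩

theorem jokerUnit_mul_self : jokerUnit * jokerUnit = 1 := Units.ext stClass_joker_mul_self

/-- A map from the unit has its value in degree 0, spanned by e₂, and `Sq² e₂ = e₄ ≠ 0` forces it to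
be zero; but the identity of the unit is not stably zero. -/
theorem jokerUnit_ne_one : jokerUnit ≠ 1 := by
  intro h
  obtain ⟨e⟩ := stClass_eq_iff.1 (show stClass unit = stClass joker from
    (congrArg Units.val h).symm)
  obtain ⟨f, hf⟩ := toSt.map_surjective e.hom
  obtain ⟨g, hg⟩ := toSt.map_surjective e.inv
  have hf0 : f.toLin (1 : 𝔽) = (0 : Fin 5 → 𝔽) := by
    have h1 : (f.toLin (1 : 𝔽) : Fin 5 → 𝔽) ∈ jokerGr 0 :=
      f.map_mem 0 (1 : 𝔽) (by change (1 : 𝔽) ∈ unitGr 0; simp [unitGr])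
    have h2 := f.map_act A1.sq2 (1 : 𝔽)
    have h3 : unit.ρ A1.sq2 (1 : 𝔽) = 0 := by
      change unitAct (A1.gen 1) 1 = 0
      rw [unitAct_gen, LinearMap.zero_apply]
    rw [h3, map_zero] at h2
    replace h2 := h2.trans (joker_sq2 _)
    refine funext fun j => ?_
    by_cases hj : j = 2
    · subst hj
      exact (congrFun h2 4).symm
    · refine h1 j fun hj' => hj (Fin.ext ?_)
      change (j : ℕ) = 2
      lia
  have hfg : f ≫ g = 0 := hom_ext (LinearMap.ext_ring
    ((congrArg g.toLin hf0).trans (map_zero g.toLin)))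
  have h1 : (0 : unit ⟶ unit) = 𝟙 unit := isMargolis_sq1.unit_hom_eq (by
    rw [← hfg, Functor.map_comp, hf, hg, e.hom_inv_id, CategoryTheory.Functor.map_id])
  exact zero_ne_one (α := 𝔽) (LinearMap.congr_fun (congrArg Hom.toLin h1) (1 : 𝔽))

/-! ### Degrees of the generators -/

section degree

variable {Q : A1} {q : ℤ} (hQ : IsMargolis Q q)

theorem degree_omegaUnit : hQ.degree omegaUnit = Multiplicative.ofAdd q :=
  hQ.degree_eq rfl hQ.hasClass_ker_augmentation

theorem degree_shiftUnit (b : Multiplicative ℤ) : hQ.degree (shiftUnit b) = b := by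
  have := hQ.degree_eq (p := shiftUnit b) rfl (hQ.hasClass_unit.shift b.toAdd)
  rwa [zero_add] at this

end degree

theorem degree_sq1_jokerUnit : isMargolis_sq1.degree jokerUnit = 1 :=
  isMargolis_sq1.degree_eq rfl hasClass_sq1_joker

theorem degree_q1_jokerUnit : isMargolis_q1.degree jokerUnit = 1 :=
  isMargolis_q1.degree_eq rfl hasClass_q1_joker

theorem stClass_eq_one_of_retract (p : PicardGroup St) {M : GrMod} (hM : stClass M = p)
    (f : toSt.obj unit ⟶ toSt.obj M) (g : toSt.obj M ⟶ toSt.obj unit) (h : f ≫ g = 𝟙 _) :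
    p = 1 := by
  obtain ⟨N, ⟨e⟩⟩ := exists_tensor_iso p hM
  exact Units.ext (hM.symm.trans
    (stClass_eq_iff.2 ⟨⟨g, f, comp_eq_id_of_retract e f g h, h⟩⟩))

/-- An invertible object with both Margolis homologies in degree zero is the unit or the joker. -/
theorem eq_one_or_eq_jokerUnit {p : PicardGroup St} (h0 : isMargolis_sq1.degree p = 1)
    (h1 : isMargolis_q1.degree p = 1) : p = 1 ∨ p = jokerUnit := by
  obtain ⟨M, hfin, hM⟩ := exists_finite_stClass_eq p
  have v0 : ∀ n ≠ 0, HomologyVanishes A1.sq1 1 M n := fun n hn =>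
    isMargolis_sq1.homologyVanishes hM h0 hn
  have v1 : ∀ n ≠ 0, HomologyVanishes A1.q1 3 M n := fun n hn =>
    isMargolis_q1.homologyVanishes hM h1 hn
  obtain ⟨N, ⟨e⟩⟩ := exists_tensor_iso p hM
  rcases exists_unit_or_joker_class v0 v1 (isMargolis_sq1.hasClass_of_degree_eq hM h0)
    (fun u v hu hu' hv hv' => isMargolis_q1.sub_mem_range e hu hu' hv hv') with
    ⟨x, hx, hx1, hx2, hx'⟩ | ⟨b, hb, hb1, hb2⟩
  · obtain ⟨f, g, h⟩ := exists_unit_retraction hx hx1 hx2 fun a ha b hb =>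
      ne_sq1_add_sq2 v0 v1 hx1 hx2 hx' ha hb
    exact Or.inl (stClass_eq_one_of_retract p hM (toSt.map f) (toSt.map g) (by
      rw [← Functor.map_comp, h, CategoryTheory.Functor.map_id]))
  · obtain ⟨f, g, h⟩ := exists_joker_retraction hb hb1 hb2
    obtain ⟨i⟩ := nonempty_iso_joker_tensor_joker
    -- If J is a retract of M, then J ⊗ J, which is stably the unit, is a retract of the invertible
    -- J ⊗ M.
    have key : jokerUnit * p = 1 := stClass_eq_one_of_retract (jokerUnit * p)
      (M := tensor joker M) ((stClass_tensor _ _).trans (congrArg (stClass joker * ·) hM))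
      (i.hom ≫ toSt.map (joker ◁ f)) (toSt.map (joker ◁ g) ≫ i.inv) (by
        have : toSt.map (joker ◁ f) ≫ toSt.map (joker ◁ g) = 𝟙 _ := by
          rw [← Functor.map_comp, ← MonoidalCategory.whiskerLeft_comp, h,
            MonoidalCategory.whiskerLeft_id, CategoryTheory.Functor.map_id]
        rw [Category.assoc, reassoc_of% this]
        exact i.hom_inv_id)
    exact Or.inr (mul_left_cancel (key.trans jokerUnit_mul_self.symm))

/-! ### The isomorphism -/

theorem jokerUnit_pow_val_add (c c' : ZMod 2) :
    jokerUnit ^ (c + c').val = jokerUnit ^ c.val * jokerUnit ^ c'.val := by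
  have h : jokerUnit ^ 2 = 1 := (pow_two _).trans jokerUnit_mul_self
  rw [← pow_add, ZMod.val_add, ← pow_eq_pow_mod _ h]

/-- The map `(a, b, c) ↦ [Ω^a J^c[b]]`. -/
noncomputable def picardHom : Multiplicative (ℤ × ℤ × ZMod 2) →* PicardGroup St :=
  MonoidHom.mk' (fun x => shiftUnit (Multiplicative.ofAdd x.toAdd.2.1) *
    (omegaUnit ^ x.toAdd.1 * jokerUnit ^ x.toAdd.2.2.val)) fun x y => by
      rw [toAdd_mul, Prod.fst_add, Prod.snd_add, Prod.fst_add, Prod.snd_add, ofAdd_add, map_mul,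
        zpow_add, jokerUnit_pow_val_add, mul_mul_mul_comm (omegaUnit ^ _), mul_mul_mul_comm]

theorem picardHom_ofAdd (a b : ℤ) (c : ZMod 2) : picardHom (Multiplicative.ofAdd (a, b, c)) =
    shiftUnit (Multiplicative.ofAdd b) * (omegaUnit ^ a * jokerUnit ^ c.val) := rfl

theorem stClass_shift (M : GrMod) (b : ℤ) :
    stClass (M.shift b) = shiftUnit (Multiplicative.ofAdd b) * stClass M :=
  (stClass_eq_of_iso (shiftIso M b)).symm.trans (stClass_tensor _ _)

theorem stClass_iterate_tensor (L M : GrMod) (n : ℕ) :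
    stClass ((tensor L)^[n] M) = stClass L ^ n * stClass M := by
  induction n with
  | zero => rw [pow_zero, one_mul, Function.iterate_zero_apply]
  | succ n ih => rw [Function.iterate_succ_apply', stClass_tensor, ih, pow_succ', mul_assoc]

theorem stClass_omegaPow (M : GrMod) (a : ℤ) :
    stClass (M.omegaPow a) = (omegaUnit ^ a : PicardGroup St) * stClass M := by
  cases a with
  | ofNat n =>
    rw [Int.ofNat_eq_natCast, zpow_natCast, Units.val_pow_eq_pow_val]
    exact stClass_iterate_tensor (ker augmentation) M n
  | negSucc n =>
    rw [zpow_negSucc, ← inv_pow, Units.val_pow_eq_pow_val]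
    exact stClass_iterate_tensor (coker topClass) M (n + 1)

theorem stClass_tensorPow (M : GrMod) (n : ℕ) : stClass (M.tensorPow n) = stClass M ^ n := by
  induction n with
  | zero => rw [pow_zero]; rfl
  | succ n ih => rw [pow_succ', ← ih]; exact stClass_tensor _ _

theorem picardHom_val (a b : ℤ) (c : ZMod 2) :
    (picardHom (Multiplicative.ofAdd (a, b, c)) : Skeleton St) =
      stClass (((joker.tensorPow c.val).omegaPow a).shift b) := by
  rw [picardHom_ofAdd, stClass_shift, stClass_omegaPow, stClass_tensorPow, Units.val_mul,
    Units.val_mul, Units.val_pow_eq_pow_val jokerUnit]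
  rfl

theorem degree_picardHom {Q : A1} {q : ℤ} (hQ : IsMargolis Q q) (hj : hQ.degree jokerUnit = 1)
    (a b : ℤ) (c : ZMod 2) : hQ.degree (picardHom (Multiplicative.ofAdd (a, b, c))) =
      Multiplicative.ofAdd (b + q * a) := by
  rw [picardHom_ofAdd, map_mul, map_mul, map_pow, map_zpow, hj, one_pow, mul_one,
    degree_shiftUnit, degree_omegaUnit, ← ofAdd_zsmul, smul_eq_mul, ← ofAdd_add, mul_comm]

theorem picardHom_injective : Function.Injective picardHom := by
  rw [injective_iff_map_eq_one]
  intro x hx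
  obtain ⟨⟨a, b, c⟩, rfl⟩ := Multiplicative.ofAdd.surjective x
  have h0 := degree_picardHom isMargolis_sq1 degree_sq1_jokerUnit a b c
  have h1 := degree_picardHom isMargolis_q1 degree_q1_jokerUnit a b c
  rw [hx, map_one, eq_comm, ofAdd_eq_one] at h0 h1
  -- The two degrees b + a and b + 3a both vanish.
  obtain rfl : a = 0 := by lia
  obtain rfl : b = 0 := by lia
  rw [picardHom_ofAdd, ofAdd_zero, map_one, one_mul, zpow_zero, one_mul] at hx
  have hc : c = 0 := by
    fin_cases c
    · rfl
    · exact absurd ((pow_one _).symm.trans hx) jokerUnit_ne_one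
  rw [hc]
  rfl

/-- The degrees of the two Margolis homologies of an invertible object have the same parity. -/
theorem even_degree {p : PicardGroup St} {d : ℤ} (h0 : isMargolis_sq1.degree p = 1)
    (h1 : isMargolis_q1.degree p = Multiplicative.ofAdd d) : Even d := by
  by_contra hd
  obtain ⟨M, hfin, hM⟩ := exists_finite_stClass_eq p
  exact not_odd (Int.not_even_iff_odd.1 hd)
    (fun n hn => isMargolis_sq1.homologyVanishes hM h0 hn)
    (fun n hn => isMargolis_q1.homologyVanishes hM h1 hn)
    (isMargolis_sq1.hasClass_of_degree_eq hM h0)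

theorem picardHom_surjective : Function.Surjective picardHom := by
  intro p
  obtain ⟨d0, h0⟩ := Multiplicative.ofAdd.surjective (isMargolis_sq1.degree p)
  obtain ⟨d1, h1⟩ := Multiplicative.ofAdd.surjective (isMargolis_q1.degree p)
  have e0 := degree_picardHom isMargolis_sq1 degree_sq1_jokerUnit
  have e1 := degree_picardHom isMargolis_q1 degree_q1_jokerUnit
  -- Shifting by -d0 brings the Q₀-degree to 0 and the Q₁-degree to d1 - d0.
  obtain ⟨k, hk⟩ : Even (d1 - d0) := by
    refine even_degree (p := p * (picardHom (Multiplicative.ofAdd (0, d0, 0)))⁻¹) ?_ ?_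
    · rw [map_mul, map_inv, e0, ← h0, ← ofAdd_neg, ← ofAdd_add]
      simp
    · rw [map_mul, map_inv, e1, ← h1, ← ofAdd_neg, ← ofAdd_add]
      congr 1
      ring
  -- a = k and b = d0 - k solve a + b = d0 and 3a + b = d1, so dividing by this class leaves both
  -- degrees zero.
  obtain h | h := eq_one_or_eq_jokerUnit
    (p := p * (picardHom (Multiplicative.ofAdd (k, d0 - k, 0)))⁻¹)
    (by
      rw [map_mul, map_inv, e0, ← h0, ← ofAdd_neg, ← ofAdd_add, ofAdd_eq_one]
      ring)
    (by
      rw [map_mul, map_inv, e1, ← h1, ← ofAdd_neg, ← ofAdd_add, ofAdd_eq_one]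
      lia)
  · exact ⟨_, (mul_inv_eq_one.1 h).symm⟩
  · refine ⟨Multiplicative.ofAdd (0, 0, 1) * Multiplicative.ofAdd (k, d0 - k, 0), ?_⟩
    rw [map_mul, eq_mul_of_mul_inv_eq h, picardHom_ofAdd 0 0 1, ofAdd_zero, map_one, one_mul,
      zpow_zero, one_mul]
    congr 1
    exact pow_one _

end SteenrodA1

theorem mainTheorem5 :
    ∃ φ : Multiplicative (ℤ × ℤ × ZMod 2) ≃* SteenrodA1.PicardGroup SteenrodA1.St,
      ∀ (a b : ℤ) (c : ZMod 2),
        (φ (Multiplicative.ofAdd (a, b, c)) : Skeleton SteenrodA1.St) =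
          toSkeleton (SteenrodA1.toSt.obj
            (((SteenrodA1.GrMod.joker.tensorPow c.val).omegaPow a).shift b)) :=
  ⟨MulEquiv.ofBijective SteenrodA1.picardHom
    ⟨SteenrodA1.picardHom_injective, SteenrodA1.picardHom_surjective⟩, SteenrodA1.picardHom_val⟩
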